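/- **Setting.** Let $r\ge 0$, let $p_0\ge p_1\ge\dots\ge p_r\ge 1$ be integers and $N=p_0+\dots+p_r$. Let $A,B$ be constant real $N\times N$ matrices, divided into blocks of sizes $p_0,\dots,p_r$, such that $A=\begin{bmatrix}A_0&0\\0&0\end{bmatrix}$ with $A_0$ a symmetric positive definite $p_0\times p_0$ matrix, and $$B=\begin{bmatrix}*&B_1&0&\cdots&0\\ *&*&B_2&\cdots&0\\ \vdots&\vdots&\vdots&\ddots&\vdots\\ *&*&*&\cdots&B_r\\ *&*&*&\cdots&*\end{bmatrix},$$ where $B_j$ is a $p_{j-1}\times p_j$ block of rank $p_j$ ($j=1,\dots,r$) and the blocks $*$ are arbitrary. Set $E(s)=\exp(-sB^T)$ and $C(t)=\int_0^tE(s)AE(s)^T\,ds$. On $\mathbb R^{N+1}=\mathbb R^N\times\mathbb R$ put $$(x,t)\circ(\xi,\tau)=(\xi+E(\tau)x,\;t+\tau),\qquad(\xi,\tau)^{-1}=(-E(-\tau)\xi,\,-\tau),$$ $$\|(x,t)\|=\sum_{k=1}^N|x_k|^{1/q_k}+|t|^{1/2},$$ where $q_k=2j+1$ if the $k$-th coordinate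 belongs to the block of size $p_j$ ($0\le j\le r$). Let $Q=\sum_{j=0}^r(2j+1)p_j$, $d(z,\zeta)=\|\zeta^{-1}\circ z\|$, $B(z,\rho)=\{\zeta\in\mathbb R^{N+1}:d(z,\zeta)<\rho\}$, $S=\mathbb R^N\times[-1,1]$, and for $\alpha>0$ $$\|f\|_\alpha=\sup_{x}|f(x)|+\sup_{x\ne y}\frac{|f(x)-f(y)|}{d(x,y)^\alpha},\qquad x,y\in\mathbb R^{N+1};$$ $C^\alpha(\mathbb R^{N+1})$ is the set of functions $f:\mathbb R^{N+1}\to\mathbb R$ with $\|f\|_\alpha<\infty$. Let $$\gamma(x,t)=\frac{(4\pi)^{-N/2}}{\sqrt{\det C(t)}}\exp\Bigl(-\tfrac14\langle C(t)^{-1}x,x\rangle-t\,\mathrm{Tr}B\Bigr)\ \text{ for }t>0,\qquad\gamma(x,t)=0\ \text{ for }t\le0.$$ Given $i,j\in\{1,\dots,p_0\}$, $0<\rho_0<1$ and $\eta\in C_0^\infty(\mathbb R^{N+1})$ with $\eta(z)=1$ for $\|z\|\le\rho_0/2$ and $\eta(z)=0$ for $\|z\|\ge\rho_0$, let $k_0=\eta\,\partial^2_{x_ix_j}\gamma$.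 **Proposition.** There is a constant $R_0>0$, depending only on $A$, $B$ and the block sizes, with the following property. For all $i,j,\rho_0,\eta$ as above, all $\alpha>0$ and all $K\ge0$ there is a constant $c>0$ such that for every $z_0\in S$, every $0<R\le R_0$ and all $a,b\in C^\alpha(\mathbb R^{N+1})$ with $\|a\|_\alpha\le K$, $\|b\|_\alpha\le K$ and (closed) supports contained in $B(z_0,R)$, the kernel $$k(x,y)=a(x)\,k_0(y^{-1}\circ x)\,b(y)$$ satisfies: (a) for all $x\neq y$ in $B(z_0,R)$, $$|k(x,y)|\le\frac{c}{d(x,y)^{Q+2}};$$ for all $x_0,x,y\in B(z_0,R)$ with $d(x_0,y)\ge c\,d(x_0,x)$ (and $y\ne x_0$, the case $y=x_0$ being trivial), $$|k(x,y)-k(x_0,y)|\le c\,\frac{d(x_0,x)^{\alpha}}{d(x_0,y)^{Q+2+\alpha}};$$ and, for all $x\in B(z_0,R)$, the function $k(x,\cdot)$ is integrable with respect to the Lebesgue measure on $\{y\in B(z_0,R):d(x,y)>\varepsilon\}$ for every $\varepsilon>0$, and for all $0<r_1<r_2$ $$\left|\int_{y\in B(z_0,R):\,r_1<d(x,y)<r_2}k(x,y)\,dy\right|\le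 c;$$ (b) for every $x\in B(z_0,R)$ the limit $$h(x)=\lim_{\varepsilon\to0^+}\int_{y\in B(z_0,R):\,d(x,y)>\varepsilon}k(x,y)\,dy$$ exists and is finite. In particular $c$ depends on $z_0$, $R$, $a$, $b$ only through the $C^\alpha$ norms of $a$ and $b$. -/

import Mathlib

open scoped Matrix ENNReal NNReal Topology ContDiff
open MeasureTheory

noncomputable section

namespace OU

/-- Index set of the `N = p 0 + ⋯ + p r` space coordinates, grouped in blocks:
`⟨j, a⟩` is the `a`-th coordinate of the `j`-th block. -/
abbrev Idx {r : ℕ} (p : Fin (r + 1) → ℕ) : Type := (j : Fin (r + 1)) × Fin (p j)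

/-- The space `ℝ^{N+1}` of points `z = (x, t)`. -/
abbrev Pt {r : ℕ} (p : Fin (r + 1) → ℕ) : Type := (Idx p → ℝ) × ℝ

/-- The standing assumptions on the block sizes and on the matrices `A`, `B`:
`p 0 ≥ p 1 ≥ ⋯ ≥ p r ≥ 1`; `A` vanishes outside its upper left `p 0 × p 0` block, which is
symmetric and positive definite; the blocks of `B` strictly above the first block superdiagonal
vanish, and the `j`-th block `B_{j+1}` on that superdiagonal has full rank `p (j + 1)`. -/
structure IsCanonicalPair {r : ℕ} (p : Fin (r + 1) → ℕ) (A B : Matrix (Idx p) (Idx p) ℝ) :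
    Prop where
  anti : Antitone p
  pos : 1 ≤ p (Fin.last r)
  A_zero : ∀ k l : Idx p, ¬ (k.1 = 0 ∧ l.1 = 0) → A k l = 0
  A_posDef : (A.submatrix (Sigma.mk (0 : Fin (r + 1))) (Sigma.mk (0 : Fin (r + 1)))).PosDef
  B_zero : ∀ k l : Idx p, (k.1 : ℕ) + 1 < (l.1 : ℕ) → B k l = 0
  B_rank : ∀ j : Fin r, (B.submatrix (Sigma.mk j.castSucc) (Sigma.mk j.succ)).rank = p j.succ

variable {r : ℕ} {p : Fin (r + 1) → ℕ}

/-- `E(s) = exp(-s Bᵀ)`. -/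
def E (B : Matrix (Idx p) (Idx p) ℝ) (s : ℝ) : Matrix (Idx p) (Idx p) ℝ :=
  NormedSpace.exp (-(s • Bᵀ))

/-- `C(t) = ∫₀ᵗ E(s) A E(s)ᵀ ds`, entry by entry. -/
def C (A B : Matrix (Idx p) (Idx p) ℝ) (t : ℝ) : Matrix (Idx p) (Idx p) ℝ :=
  Matrix.of fun k l => ∫ s in (0 : ℝ)..t, (E B s * A * (E B s)ᵀ) k l

/-- The translation `(x, t) ∘ (ξ, τ) = (ξ + E(τ) x, t + τ)`. -/
def comp (B : Matrix (Idx p) (Idx p) ℝ) (z ζ : Pt p) : Pt p :=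
  (ζ.1 + E B ζ.2 *ᵥ z.1, z.2 + ζ.2)

/-- The inverse `(ξ, τ)⁻¹ = (-E(-τ) ξ, -τ)`. -/
def inv (B : Matrix (Idx p) (Idx p) ℝ) (ζ : Pt p) : Pt p :=
  (-(E B (-ζ.2) *ᵥ ζ.1), -ζ.2)

/-- The homogeneous norm `∑ₖ |xₖ|^{1/qₖ} + |t|^{1/2}`, with `qₖ = 2 j + 1` on the `j`-th block. -/
def hnorm (z : Pt p) : ℝ :=
  ∑ k : Idx p, |z.1 k| ^ (1 / (2 * ((k.1 : ℕ) : ℝ) + 1)) + |z.2| ^ (1 / 2 : ℝ)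

/-- `Q = p 0 + 3 p 1 + ⋯ + (2 r + 1) p r`. -/
def Q (p : Fin (r + 1) → ℕ) : ℕ := ∑ j : Fin (r + 1), (2 * (j : ℕ) + 1) * p j

/-- `d(z, ζ) = ‖ζ⁻¹ ∘ z‖`. -/
def d (B : Matrix (Idx p) (Idx p) ℝ) (z ζ : Pt p) : ℝ := hnorm (comp B (inv B ζ) z)

/-- `B(z, ρ) = {ζ : d(z, ζ) < ρ}`. -/
def ball (B : Matrix (Idx p) (Idx p) ℝ) (z : Pt p) (ρ : ℝ) : Set (Pt p) := {ζ | d B z ζ < ρ}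

/-- The strip `S = ℝ^N × [-1, 1]`. -/
def strip (p : Fin (r + 1) → ℕ) : Set (Pt p) := {z | z.2 ∈ Set.Icc (-1 : ℝ) 1}

/-- The fundamental solution of `div(A∇) + ⟨x, B∇⟩ - ∂ₜ` with pole at the origin. -/
def fundSol (A B : Matrix (Idx p) (Idx p) ℝ) (z : Pt p) : ℝ :=
  if z.2 ≤ 0 then 0
  else (4 * Real.pi) ^ (-(Fintype.card (Idx p) : ℝ) / 2) / Real.sqrt (C A B z.2).det *
    Real.exp (-(1 / 4) * (((C A B z.2)⁻¹ *ᵥ z.1) ⬝ᵥ z.1) - z.2 * B.trace)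

/-- The partial derivative with respect to the space coordinate `k`. -/
def spaceDeriv (k : Idx p) (f : Pt p → ℝ) (z : Pt p) : ℝ :=
  lineDeriv ℝ f z ((Pi.single k 1 : Idx p → ℝ), (0 : ℝ))

/-- `η` is smooth with compact support, equals `1` where `‖z‖ ≤ ρ₀ / 2`
and `0` where `‖z‖ ≥ ρ₀`. -/
structure IsCutoff (ρ₀ : ℝ) (η : Pt p → ℝ) : Prop where
  smooth : ContDiff ℝ ∞ η
  compactSupport : HasCompactSupport η
  eq_one : ∀ z, hnorm z ≤ ρ₀ / 2 → η z = 1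
  eq_zero : ∀ z, ρ₀ ≤ hnorm z → η z = 0

/-- The kernel `k₀ = η ∂²_{xᵢ xⱼ} γ`, for `i, j` in the first block. -/
def k₀ (A B : Matrix (Idx p) (Idx p) ℝ) (η : Pt p → ℝ) (i j : Fin (p 0)) (z : Pt p) : ℝ :=
  η z * spaceDeriv ⟨0, i⟩ (spaceDeriv ⟨0, j⟩ (fundSol A B)) z

/-- The kernel `k(x, y) = a(x) k₀(y⁻¹ ∘ x) b(y)`. -/
def kernel (A B : Matrix (Idx p) (Idx p) ℝ) (η : Pt p → ℝ) (i j : Fin (p 0))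
    (a b : Pt p → ℝ) (x y : Pt p) : ℝ :=
  a x * k₀ A B η i j (comp B (inv B y) x) * b y

/-- The norm of `C^α(ℝ^{N+1})` with respect to `d`,
`sup |f| + sup_{x ≠ y} |f(x) - f(y)| / d(x, y)^α`, with values in `[0, ∞]`;
it is finite exactly for the functions of `C^α`. -/
def holderNorm (B : Matrix (Idx p) (Idx p) ℝ) (α : ℝ) (f : Pt p → ℝ) : ℝ≥0∞ :=
  (⨆ x : Pt p, ENNReal.ofReal |f x|) +
    ⨆ (x : Pt p) (y : Pt p) (_ : x ≠ y), ENNReal.ofReal (|f x - f y| / d B x y ^ α)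

end OU

end

noncomputable section

namespace OU

/-! Conjugation by the block dilation `dil p t` turns `t • Bᵀ` into the transpose of `scaled B t`,
which is polynomial in t and at t = 0 keeps only the superdiagonal blocks of B. Hence C(t) = t D(t)
M(t) D(t), where D(t) = `dil p t` and M = `covMat A B` is C¹ across t = 0 and positive definite for
every t, by the rank condition on B (`C_eq_conj`, `contDiff_covMat`, `C_one_posDef`). So for t > 0
the Hessian of γ is t^(-(Q+2)/2) times a C¹ factor in t times a Gaussian Hessian in the rescaled
variable v = `unitPt z` (`hessSol_of_pos`): the operator is a C¹ perturbation in t of its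
homogeneous part.

Growth and smoothness. Since ‖z‖ ≤ C √t (1 + |v|²), Gaussian decay in v converts negative powers of
√t into negative powers of ‖z‖ (`exists_weight_mul_sqrt_inv_le`). Writing y⁻¹ ∘ x = (y⁻¹ ∘ x₀) ∘
(x₀⁻¹ ∘ x) reduces the Hölder bound to right translations u ↦ u ∘ w with w small compared with u.
The mean value theorem applies on the Euclidean segment from u to u ∘ w when both times are
positive; if the sign of the time changes, the extra factor t in `exists_hessSol_bound` suffices
(`exists_hessSol_comp_bound`).

Cancellation and principal value. In the coordinates y⁻¹ ∘ x = `stretch (v, t)` the measure k dy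
becomes a(x) b(y) η `normKer`(t, v) dv dt / t. Freezing b at x, η at 1 and t at 0 leaves a function
of v over t; its integral over every annulus vanishes, because ∫ dt/t along each v-fibre does not
depend on v and a Gaussian Hessian has mean zero (`setIntegral_annulus_div`). The error is at most a
Gaussian in v times t^(α/2 - 1), an integrable majorant independent of x, z₀, R, a, b
(`exists_remKer_majorant`). It bounds the truncated integrals and gives the limit by dominated
convergence.

All this is for α ≤ 1. If α > 1, a Hölder function is constant along the first-block directions, in
which balls are bounded, so a = 0 (`eq_zero_of_holder_gt_one`). -/

variable {r : ℕ} {p : Fin (r + 1) → ℕ}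

/-! ### Dilations and the rescaled covariance matrix. -/

/-- The matrix with entries `t ^ (j + 1 - m) * B k l`, for `k` in block `j` and `l` in block `m`. -/
def scaled (B : Matrix (Idx p) (Idx p) ℝ) (t : ℝ) : Matrix (Idx p) (Idx p) ℝ :=
  Matrix.of fun k l => t ^ ((k.1 : ℕ) + 1 - (l.1 : ℕ)) * B k l

/-- The diagonal matrix acting as `t ^ j` on the `j`-th block. -/
def dil (p : Fin (r + 1) → ℕ) (t : ℝ) : Matrix (Idx p) (Idx p) ℝ :=
  Matrix.diagonal fun k => t ^ (k.1 : ℕ)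

/-- The normalised covariance matrix. -/
def covMat (A B : Matrix (Idx p) (Idx p) ℝ) (t : ℝ) : Matrix (Idx p) (Idx p) ℝ :=
  C A (scaled B t) 1

/-- On the superdiagonal blocks the exponent is 0, so they are unchanged for every t, including t =
0. Whatever holds at time 1 for canonical pairs therefore holds for the whole family, down to the
homogeneous limit. -/
theorem IsCanonicalPair.scaled {A B : Matrix (Idx p) (Idx p) ℝ} (h : IsCanonicalPair p A B)
    (t : ℝ) : IsCanonicalPair p A (scaled B t) where
  anti := h.anti
  pos := h.pos
  A_zero := h.A_zero
  A_posDef := h.A_posDef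
  B_zero k l hkl := by simp [OU.scaled, h.B_zero k l hkl]
  B_rank j := by
    refine (congrArg Matrix.rank ?_).trans (h.B_rank j)
    ext a b
    simp [OU.scaled]

theorem dil_mul_dil (s t : ℝ) : dil p s * dil p t = dil p (s * t) := by
  simp [dil, Matrix.diagonal_mul_diagonal, mul_pow]

theorem dil_one : dil p 1 = 1 := by simp [dil]

theorem dil_mul_inv {t : ℝ} (ht : t ≠ 0) : dil p t * dil p t⁻¹ = 1 := by
  rw [dil_mul_dil, mul_inv_cancel₀ ht, dil_one]

theorem dil_inv {t : ℝ} (ht : t ≠ 0) : (dil p t)⁻¹ = dil p t⁻¹ :=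
  Matrix.inv_eq_right_inv (dil_mul_inv ht)

theorem dil_transpose (t : ℝ) : (dil p t)ᵀ = dil p t := by simp [dil]

theorem dil_mul_A_mul_dil {A B : Matrix (Idx p) (Idx p) ℝ} (h : IsCanonicalPair p A B) (t : ℝ) :
    dil p t * A * dil p t = A := by
  ext k l
  by_cases hkl : k.1 = 0 ∧ l.1 = 0
  · simp [dil, Matrix.diagonal_mul, Matrix.mul_diagonal, hkl.1, hkl.2]
  · simp [dil, Matrix.diagonal_mul, Matrix.mul_diagonal, h.A_zero k l hkl]

/-- Conjugation multiplies the (k, l) block by t^(k-l), and `scaled` supplies the complementary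
power t^(l+1-k), leaving a single factor t. -/
theorem smul_transpose_eq_conj {A B : Matrix (Idx p) (Idx p) ℝ} (h : IsCanonicalPair p A B)
    {t : ℝ} (ht : t ≠ 0) : t • Bᵀ = dil p t * (scaled B t)ᵀ * dil p t⁻¹ := by
  ext k l
  simp only [dil, Matrix.diagonal_mul, Matrix.mul_diagonal, Matrix.transpose_apply,
    Matrix.smul_apply, scaled, Matrix.of_apply, smul_eq_mul, inv_pow]
  -- The natural subtraction in `scaled` truncates only in the first case, where the entry of B is
  -- zero.
  rcases lt_or_ge ((l.1 : ℕ) + 1) (k.1 : ℕ) with hlt | hle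
  · simp [h.B_zero l k hlt]
  · obtain ⟨m, hm⟩ := Nat.exists_eq_add_of_le hle
    rw [hm, Nat.add_sub_cancel_left]
    have h1 : t ^ (k.1 : ℕ) * t ^ m = t * t ^ (l.1 : ℕ) := by rw [← pow_add, ← hm, pow_succ']
    field_simp
    linear_combination -(B l k) * h1

theorem E_mul_eq_conj {A B : Matrix (Idx p) (Idx p) ℝ} (h : IsCanonicalPair p A B)
    {t : ℝ} (ht : t ≠ 0) (s : ℝ) : E B (t * s) = dil p t * E (scaled B t) s * dil p t⁻¹ := by
  have hu : IsUnit (dil p t) := IsUnit.of_mul_eq_one _ (dil_mul_inv ht)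
  rw [E, E, ← dil_inv ht, ← Matrix.exp_conj _ _ hu, dil_inv ht]
  congr 1
  rw [mul_comm t s, mul_smul, smul_transpose_eq_conj h ht]
  simp

/-- The substitution s ↦ ts brings the integral to unit time; A is invariant under the dilations
because they act trivially on the first block. All degeneracy at t = 0 is now in explicit powers of
t. -/
theorem C_eq_conj {A B : Matrix (Idx p) (Idx p) ℝ} (h : IsCanonicalPair p A B)
    {t : ℝ} (ht : t ≠ 0) : C A B t = t • (dil p t * covMat A B t * dil p t) := by
  have key : ∀ s, E B (t * s) * A * (E B (t * s))ᵀ =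
      dil p t * (E (scaled B t) s * A * (E (scaled B t) s)ᵀ) * dil p t := by
    intro s
    rw [E_mul_eq_conj h ht]
    simp only [Matrix.transpose_mul, dil_transpose]
    conv_rhs => rw [← dil_mul_A_mul_dil h t⁻¹]
    simp only [Matrix.mul_assoc]
  ext k l
  simp only [C, covMat, dil, Matrix.diagonal_mul, Matrix.mul_diagonal, Matrix.of_apply,
    Matrix.smul_apply, smul_eq_mul]
  have := intervalIntegral.mul_integral_comp_mul_left (a := 0) (b := 1)
    (f := fun s => (E B s * A * (E B s)ᵀ) k l) (c := t)
  simp only [mul_zero, mul_one] at this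
  rw [← this]
  simp only [key, dil, Matrix.diagonal_mul, Matrix.mul_diagonal]
  rw [intervalIntegral.integral_mul_const, intervalIntegral.integral_const_mul]

/-! ### The one-parameter group E and the group law. -/

theorem E_zero (B : Matrix (Idx p) (Idx p) ℝ) : E B 0 = 1 := by simp [E]

theorem E_add (B : Matrix (Idx p) (Idx p) ℝ) (s t : ℝ) : E B (s + t) = E B s * E B t := by
  rw [E, E, E, ← Matrix.exp_add_of_commute]
  · congr 1; module
  · exact (((Commute.refl Bᵀ).smul_left s).smul_right t).neg_left.neg_right

theorem E_mul_E_neg (B : Matrix (Idx p) (Idx p) ℝ) (s : ℝ) : E B s * E B (-s) = 1 := by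
  rw [← E_add, add_neg_cancel, E_zero]

theorem E_neg_mul_E (B : Matrix (Idx p) (Idx p) ℝ) (s : ℝ) : E B (-s) * E B s = 1 := by
  rw [← E_add, neg_add_cancel, E_zero]

/-- The determinant is invertible and is the square of the determinant at half the time. -/
theorem det_E_pos (B : Matrix (Idx p) (Idx p) ℝ) (s : ℝ) : 0 < (E B s).det := by
  have h1 : (E B s).det = (E B (s / 2)).det ^ 2 := by
    rw [pow_two, ← Matrix.det_mul, ← E_add, add_halves]
  have h2 : (E B s).det * (E B (-s)).det = 1 := by
    rw [← Matrix.det_mul, E_mul_E_neg, Matrix.det_one]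
  have h3 : (E B s).det ≠ 0 := left_ne_zero_of_mul_eq_one h2
  rw [h1] at h3 ⊢
  positivity

theorem comp_assoc (B : Matrix (Idx p) (Idx p) ℝ) (x y z : Pt p) :
    comp B (comp B x y) z = comp B x (comp B y z) := by
  ext1
  · simp [comp, Matrix.mulVec_add, E_add, add_comm y.2, ← add_assoc]
  · simp [comp, add_assoc]

theorem inv_comp (B : Matrix (Idx p) (Idx p) ℝ) (x : Pt p) : comp B (inv B x) x = 0 := by
  ext1
  · simp [comp, inv, Matrix.mulVec_neg, E_mul_E_neg]
  · simp [comp, inv]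

theorem comp_inv (B : Matrix (Idx p) (Idx p) ℝ) (x : Pt p) : comp B x (inv B x) = 0 := by
  ext1
  · simp [comp, inv]
  · simp [comp, inv]

theorem comp_zero (B : Matrix (Idx p) (Idx p) ℝ) (x : Pt p) : comp B x 0 = x := by
  ext1 <;> simp [comp, E_zero]

theorem zero_comp (B : Matrix (Idx p) (Idx p) ℝ) (x : Pt p) : comp B 0 x = x := by
  ext1 <;> simp [comp]

theorem inv_comp_eq (B : Matrix (Idx p) (Idx p) ℝ) (y x : Pt p) :
    comp B (inv B y) x = (x.1 - E B (x.2 - y.2) *ᵥ y.1, x.2 - y.2) := by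
  ext1
  · simp [comp, inv, Matrix.mulVec_neg, sub_eq_add_neg, E_add]
  · simp [comp, inv, sub_eq_add_neg, add_comm]

/-- `y⁻¹ ∘ x = (y⁻¹ ∘ z) ∘ (z⁻¹ ∘ x)`. -/
theorem inv_comp_trans (B : Matrix (Idx p) (Idx p) ℝ) (x y z : Pt p) :
    comp B (inv B y) x = comp B (comp B (inv B y) z) (comp B (inv B z) x) := by
  rw [comp_assoc, ← comp_assoc B z, comp_inv, zero_comp]

theorem inv_inv_comp (B : Matrix (Idx p) (Idx p) ℝ) (x y : Pt p) :
    inv B (comp B (inv B y) x) = comp B (inv B x) y := by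
  have h1 : comp B (inv B (comp B (inv B y) x))
      (comp B (comp B (inv B y) x) (comp B (inv B x) y)) = comp B (inv B x) y := by
    rw [← comp_assoc, inv_comp, zero_comp]
  rwa [← inv_comp_trans, inv_comp, comp_zero] at h1

theorem comp_inv_eq_of (B : Matrix (Idx p) (Idx p) ℝ) (x w : Pt p) :
    comp B (inv B (comp B x (inv B w))) x = w := by
  rw [← inv_inv_comp, ← comp_assoc, inv_comp, zero_comp]
  ext1 <;> simp [inv, Matrix.mulVec_neg, E_mul_E_neg]

/-! ### Regularity in time of the exponential and of the covariance matrix. -/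

section MatrixNorm

open scoped Matrix.Norms.Operator

/-- If the entries of a matrix function are smooth, so are those of its exponential. -/
theorem contDiff_matrix_exp_apply {ι X : Type*} [Fintype ι] [DecidableEq ι]
    [NormedAddCommGroup X] [NormedSpace ℝ X] {f : X → Matrix ι ι ℝ}
    (hf : ∀ k l, ContDiff ℝ ∞ fun x => f x k l) (k l : ι) :
    ContDiff ℝ ∞ fun x => NormedSpace.exp (f x) k l := by
  let e : (ι → ι → ℝ) ≃L[ℝ] Matrix ι ι ℝ := (Matrix.ofLinearEquiv ℝ).toContinuousLinearEquiv
  have h1 : ContDiff ℝ ∞ fun x => e fun k l => f x k l :=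
    e.contDiff.comp (contDiff_pi.2 fun k => contDiff_pi.2 fun l => hf k l)
  have h2 : ContDiff ℝ ∞ (NormedSpace.exp : Matrix ι ι ℝ → Matrix ι ι ℝ) :=
    contDiff_iff_contDiffAt.2 fun x => (NormedSpace.exp_analytic (𝕂 := ℝ) x).contDiffAt
  have h3 : ContDiff ℝ ∞ fun x => e.symm (NormedSpace.exp (e fun k l => f x k l)) :=
    e.symm.contDiff.comp (h2.comp h1)
  exact contDiff_pi.1 (contDiff_pi.1 h3 k) l

theorem contDiff_E_scaled (B : Matrix (Idx p) (Idx p) ℝ) (k l : Idx p) :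
    ContDiff ℝ ∞ fun x : ℝ × ℝ => E (scaled B x.1) x.2 k l := by
  refine contDiff_matrix_exp_apply (fun k l => ?_) k l
  simp only [Matrix.neg_apply, Matrix.smul_apply, Matrix.transpose_apply, scaled, Matrix.of_apply,
    smul_eq_mul]
  fun_prop

theorem contDiff_E (B : Matrix (Idx p) (Idx p) ℝ) (k l : Idx p) :
    ContDiff ℝ ∞ fun s : ℝ => E B s k l := by
  refine contDiff_matrix_exp_apply (fun k l => ?_) k l
  simp only [Matrix.neg_apply, Matrix.smul_apply, smul_eq_mul]
  fun_prop

/-- `exp (s M) x` solves the linear system with matrix `M`. -/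
theorem hasDerivAt_matrix_exp_mulVec {ι : Type*} [Fintype ι] [DecidableEq ι]
    (M : Matrix ι ι ℝ) (x : ι → ℝ) (s : ℝ) (k : ι) :
    HasDerivAt (fun s : ℝ => (NormedSpace.exp (s • M) *ᵥ x) k)
      ((M *ᵥ (NormedSpace.exp (s • M) *ᵥ x)) k) s := by
  have h1 := hasDerivAt_exp_smul_const' (𝕂 := ℝ) M s
  let L : Matrix ι ι ℝ →ₗ[ℝ] ℝ :=
    { toFun := fun N => (N *ᵥ x) k
      map_add' := fun N N' => by simp [Matrix.add_mulVec]
      map_smul' := fun c N => by simp [Matrix.smul_mulVec] }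
  have h2 := L.toContinuousLinearMap.hasFDerivAt.comp_hasDerivAt s h1
  rw [Matrix.mulVec_mulVec]
  exact h2

theorem hasDerivAt_E_transpose_mulVec (B : Matrix (Idx p) (Idx p) ℝ) (x : Idx p → ℝ) (s : ℝ)
    (k : Idx p) :
    HasDerivAt (fun s => ((E B s)ᵀ *ᵥ x) k) (-(B *ᵥ ((E B s)ᵀ *ᵥ x)) k) s := by
  have h0 : ∀ s, (E B s)ᵀ = NormedSpace.exp (s • (-B)) := fun s => by
    rw [E, ← Matrix.exp_transpose]; simp
  simp only [h0]
  simpa only [Matrix.neg_mulVec, Pi.neg_apply] using hasDerivAt_matrix_exp_mulVec (-B) x s k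

end MatrixNorm

theorem hasDerivAt_intervalIntegral_of_contDiff {f : ℝ × ℝ → ℝ} (hf : ContDiff ℝ ∞ f) (t : ℝ) :
    HasDerivAt (fun t => ∫ s in (0 : ℝ)..1, f (t, s))
      (∫ s in (0 : ℝ)..1, fderiv ℝ f (t, s) (1, 0)) t := by
  have hcont : Continuous fun x : ℝ × ℝ => fderiv ℝ f x (1, 0) :=
    (hf.continuous_fderiv (by simp)).clm_apply continuous_const
  obtain ⟨b, hb⟩ := (((isCompact_closedBall t 1).prod
    (isCompact_Icc (a := (0 : ℝ)) (b := 1))).image hcont.norm).bddAbove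
  refine (intervalIntegral.hasDerivAt_integral_of_dominated_loc_of_deriv_le
    (F := fun t s => f (t, s)) (F' := fun t s => fderiv ℝ f (t, s) (1, 0)) (bound := fun _ => b)
    (Metric.closedBall_mem_nhds t one_pos) ?_ ?_ ?_ ?_ ?_ ?_).2
  · exact Filter.Eventually.of_forall fun x =>
      (hf.continuous.comp (by fun_prop)).aestronglyMeasurable
  · exact (hf.continuous.comp (by fun_prop)).intervalIntegrable _ _
  · exact (hcont.comp (by fun_prop)).aestronglyMeasurable
  · refine Filter.Eventually.of_forall fun s hs x hx => hb ⟨(x, s), ⟨hx, ?_⟩, rfl⟩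
    rw [Set.uIoc_of_le zero_le_one] at hs
    exact ⟨hs.1.le, hs.2⟩
  · exact intervalIntegrable_const
  · refine Filter.Eventually.of_forall fun s _ x _ => ?_
    have h1 : HasDerivAt (fun x : ℝ => (x, s)) ((1 : ℝ), (0 : ℝ)) x :=
      (hasDerivAt_id x).prodMk (hasDerivAt_const x s)
    exact ((hf.differentiable (by simp)) (x, s)).hasFDerivAt.comp_hasDerivAt x h1

theorem contDiff_intervalIntegral {f : ℝ × ℝ → ℝ} (hf : ContDiff ℝ ∞ f) :
    ContDiff ℝ 1 (fun t => ∫ s in (0 : ℝ)..1, f (t, s)) := by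
  rw [contDiff_one_iff_deriv]
  refine ⟨fun t => (hasDerivAt_intervalIntegral_of_contDiff hf t).differentiableAt, ?_⟩
  rw [show deriv (fun t => ∫ s in (0 : ℝ)..1, f (t, s)) = _ from
    funext fun t => (hasDerivAt_intervalIntegral_of_contDiff hf t).deriv]
  refine intervalIntegral.continuous_parametric_intervalIntegral_of_continuous' ?_ 0 1
  exact (hf.continuous_fderiv (by simp)).clm_apply continuous_const

theorem contDiff_covMat (A B : Matrix (Idx p) (Idx p) ℝ) (k l : Idx p) :
    ContDiff ℝ 1 fun t => covMat A B t k l := by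
  refine contDiff_intervalIntegral
    (f := fun x => (E (scaled B x.1) x.2 * A * (E (scaled B x.1) x.2)ᵀ) k l) ?_
  simp only [Matrix.mul_apply, Matrix.transpose_apply]
  have := contDiff_E_scaled (p := p) B
  fun_prop

theorem continuous_E_mul (A B : Matrix (Idx p) (Idx p) ℝ) (k l : Idx p) :
    Continuous fun s => (E B s * A * (E B s)ᵀ) k l := by
  simp only [Matrix.mul_apply, Matrix.transpose_apply]
  have := fun k l => (contDiff_E (p := p) B k l).continuous
  fun_prop

theorem contDiff_det {M : ℝ → Matrix (Idx p) (Idx p) ℝ} {n : WithTop ℕ∞}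
    (hM : ∀ k l, ContDiff ℝ n fun t => M t k l) : ContDiff ℝ n fun t => (M t).det := by
  simp only [Matrix.det_apply]
  refine ContDiff.sum fun σ _ => ContDiff.const_smul _ (contDiff_prod fun i _ => hM _ _)

theorem contDiff_inv {M : ℝ → Matrix (Idx p) (Idx p) ℝ} {n : WithTop ℕ∞}
    (hM : ∀ k l, ContDiff ℝ n fun t => M t k l) (h0 : ∀ t, (M t).det ≠ 0) (k l : Idx p) :
    ContDiff ℝ n fun t => (M t)⁻¹ k l := by
  simp only [Matrix.inv_def, Ring.inverse_eq_inv, Matrix.smul_apply, smul_eq_mul,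
    Matrix.adjugate_apply]
  refine ((contDiff_det hM).inv h0).mul (contDiff_det fun a b => ?_)
  simp only [Matrix.updateRow_apply]
  split_ifs
  · exact contDiff_const
  · exact hM _ _

/-! ### Positive definiteness of the covariance matrices. -/

theorem mulVec_eq_zero_of_rank {m n : ℕ} (M : Matrix (Fin m) (Fin n) ℝ) (h : M.rank = n)
    {v : Fin n → ℝ} (hv : M *ᵥ v = 0) : v = 0 := by
  have h1 : Module.finrank ℝ (LinearMap.ker M.mulVecLin) = 0 := by
    have := M.mulVecLin.finrank_range_add_finrank_ker
    rw [Matrix.rank] at h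
    simp only [Module.finrank_fintype_fun_eq_card, Fintype.card_fin] at this
    omega
  have h2 : v ∈ LinearMap.ker M.mulVecLin := by simpa using hv
  rw [Submodule.finrank_eq_zero.1 h1] at h2
  simpa using h2

/-- A solution of the linear system with matrix `-B` whose zeroth block vanishes on an open set
vanishes there. -/
theorem eq_zero_of_block_zero {A B : Matrix (Idx p) (Idx p) ℝ} (h : IsCanonicalPair p A B)
    {u : ℝ → Idx p → ℝ} (hu : ∀ s k, HasDerivAt (fun s => u s k) (-(B *ᵥ u s) k) s)
    {U : Set ℝ} (hU : IsOpen U) (h0 : ∀ s ∈ U, ∀ a : Fin (p 0), u s ⟨0, a⟩ = 0) :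
    ∀ s ∈ U, u s = 0 := by
  have key : ∀ m : ℕ, ∀ s ∈ U, ∀ k : Idx p, (k.1 : ℕ) ≤ m → u s k = 0 := by
    intro m
    induction m with
    | zero =>
      rintro s hs ⟨k, a⟩ hk
      obtain rfl : k = 0 := Fin.ext (by simpa using hk)
      exact h0 s hs a
    | succ m ih =>
      rintro s hs ⟨k, a'⟩ hk
      rcases Nat.lt_or_ge (k : ℕ) (m + 1) with hlt | hge
      · exact ih s hs _ (Nat.lt_succ_iff.1 hlt)
      have hkm : (k : ℕ) = m + 1 := le_antisymm hk hge
      have hmr : m < r := by have := k.2; omega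
      obtain ⟨j, hjm, rfl⟩ : ∃ j : Fin r, (j : ℕ) = m ∧ k = j.succ :=
        ⟨⟨m, hmr⟩, rfl, Fin.ext (by simpa using hkm)⟩
      have hv : (B.submatrix (Sigma.mk j.castSucc) (Sigma.mk j.succ)) *ᵥ
          (fun a => u s ⟨j.succ, a⟩) = 0 := by
        ext b
        -- Block j of u vanishes on a neighbourhood of s, hence so does its derivative. In row j of
        -- B u the earlier blocks of u are zero and the later blocks of B are zero, so only the
        -- injective superdiagonal block acts, on block j + 1 of u.
        have hd : -(B *ᵥ u s) ⟨j.castSucc, b⟩ = 0 := by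
          refine (hu s ⟨j.castSucc, b⟩).unique ?_
          refine (hasDerivAt_const s (0 : ℝ)).congr_of_eventuallyEq ?_
          filter_upwards [hU.mem_nhds hs] with s' hs'
          exact ih s' hs' _ (by simp [hjm])
        rw [neg_eq_zero, Matrix.mulVec, dotProduct, Fintype.sum_sigma,
          Finset.sum_eq_single j.succ] at hd
        · simpa [Matrix.mulVec, dotProduct] using hd
        · intro i _ hi
          refine Finset.sum_eq_zero fun c _ => ?_
          rcases Nat.lt_or_ge (i : ℕ) (m + 1) with hlt | hge
          · rw [ih s hs ⟨i, c⟩ (Nat.lt_succ_iff.1 hlt), mul_zero]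
          · have : (i : ℕ) ≠ m + 1 := fun hh => hi (Fin.ext (by simpa [hjm] using hh))
            rw [h.B_zero, zero_mul]
            simp only [Fin.val_castSucc]
            omega
        · simp
      exact congrFun (mulVec_eq_zero_of_rank _ (h.B_rank j) hv) a'
  intro s hs
  ext k
  exact key r s hs k (Nat.lt_succ_iff.1 k.1.2)

theorem dotProduct_A_mulVec {A B : Matrix (Idx p) (Idx p) ℝ} (h : IsCanonicalPair p A B)
    (x : Idx p → ℝ) : x ⬝ᵥ A *ᵥ x = (fun a : Fin (p 0) => x ⟨0, a⟩) ⬝ᵥ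
      (A.submatrix (fun a : Fin (p 0) => (⟨0, a⟩ : Idx p)) (fun a => ⟨0, a⟩)) *ᵥ
        (fun a => x ⟨0, a⟩) := by
  simp only [dotProduct, Matrix.mulVec, Fintype.sum_sigma]
  rw [Finset.sum_eq_single 0, Finset.sum_congr rfl]
  · intro a _
    rw [Finset.sum_eq_single 0]
    · simp
    · intro i _ hi
      exact Finset.sum_eq_zero fun c _ => by rw [h.A_zero _ _ (by simp [hi]), zero_mul]
    · simp
  · intro i _ hi
    refine Finset.sum_eq_zero fun c _ => ?_
    rw [Finset.sum_eq_zero, mul_zero]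
    intro j _
    exact Finset.sum_eq_zero fun c _ => by rw [h.A_zero _ _ (by simp [hi]), zero_mul]
  · simp

theorem C_isHermitian {A B : Matrix (Idx p) (Idx p) ℝ} (h : IsCanonicalPair p A B) (t : ℝ) :
    (C A B t).IsHermitian := by
  have hA : Aᵀ = A := by
    ext k l
    rw [Matrix.transpose_apply]
    by_cases hkl : k.1 = 0 ∧ l.1 = 0
    · obtain ⟨k, a⟩ := k
      obtain ⟨l, b⟩ := l
      obtain ⟨rfl, rfl⟩ : k = 0 ∧ l = 0 := hkl
      simpa using h.A_posDef.isHermitian.apply a b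
    · rw [h.A_zero k l hkl, h.A_zero l k (fun h => hkl h.symm)]
  ext k l
  simp only [Matrix.conjTranspose_apply, C, Matrix.of_apply, star_trivial]
  congr 1
  ext s
  have : (E B s * A * (E B s)ᵀ)ᵀ = E B s * A * (E B s)ᵀ := by
    simp [Matrix.transpose_mul, hA, Matrix.mul_assoc]
  rw [← this, Matrix.transpose_apply, this]

/-- The quadratic form at x is ∫ ⟨A u, u⟩ over [0, 1] with u(s) = E(s)ᵀ x. If it is not positive for
some x ≠ 0, the integrand vanishes on (0, 1), so the first block of u vanishes there. The linear
system passes this on to all blocks, and x = 0 since E(s) is invertible. -/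
theorem C_one_posDef {A B : Matrix (Idx p) (Idx p) ℝ} (h : IsCanonicalPair p A B) :
    (C A B 1).PosDef := by
  refine Matrix.PosDef.of_dotProduct_mulVec_pos (C_isHermitian h 1) fun x hx => ?_
  set g : ℝ → ℝ := fun s => ((E B s)ᵀ *ᵥ x) ⬝ᵥ A *ᵥ ((E B s)ᵀ *ᵥ x) with hg
  have hgc : ∀ s, g s = ∑ k, ∑ l, x k * ((E B s * A * (E B s)ᵀ) k l * x l) := by
    intro s
    have : g s = x ⬝ᵥ (E B s * A * (E B s)ᵀ) *ᵥ x := by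
      simp only [hg]
      rw [Matrix.mulVec_transpose, ← Matrix.dotProduct_mulVec, ← Matrix.mulVec_transpose,
        Matrix.mulVec_mulVec, Matrix.mulVec_mulVec]
    rw [this]
    simp only [dotProduct, Matrix.mulVec, Finset.mul_sum]
  have hcont : Continuous g := by
    rw [show g = _ from funext hgc]
    exact continuous_finsetSum _ fun k _ => continuous_finsetSum _ fun l _ =>
      continuous_const.mul ((continuous_E_mul A B k l).mul continuous_const)
  have hint : star x ⬝ᵥ C A B 1 *ᵥ x = ∫ s in (0 : ℝ)..1, g s := by
    simp only [hgc, star_trivial, dotProduct, Matrix.mulVec, C, Matrix.of_apply]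
    rw [intervalIntegral.integral_finsetSum]
    · refine Finset.sum_congr rfl fun k _ => ?_
      rw [intervalIntegral.integral_finsetSum, Finset.mul_sum]
      · refine Finset.sum_congr rfl fun l _ => ?_
        rw [intervalIntegral.integral_const_mul, intervalIntegral.integral_mul_const]
      · intro l _
        exact (continuous_const.mul
          ((continuous_E_mul A B k l).mul continuous_const)).intervalIntegrable _ _
    · intro k _
      exact (continuous_finsetSum _ fun l _ => continuous_const.mul
          ((continuous_E_mul A B k l).mul continuous_const)).intervalIntegrable _ _
  rw [hint]
  have hnn : ∀ s, 0 ≤ g s := fun s => by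
    simp only [hg]
    rw [dotProduct_A_mulVec h]
    simpa using h.A_posDef.posSemidef.dotProduct_mulVec_nonneg
      (fun a => ((E B s)ᵀ *ᵥ x) ⟨0, a⟩)
  by_contra hneg
  have hzero : ∀ s ∈ Set.Ioo (0 : ℝ) 1, g s = 0 := by
    intro s hs
    by_contra hs0
    exact hneg (intervalIntegral.integral_pos zero_lt_one hcont.continuousOn (fun s _ => hnn s)
      ⟨s, ⟨hs.1.le, hs.2.le⟩, lt_of_le_of_ne (hnn s) (Ne.symm hs0)⟩)
  have hu := eq_zero_of_block_zero h (u := fun s => (E B s)ᵀ *ᵥ x)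
    (hasDerivAt_E_transpose_mulVec B x) (isOpen_Ioo (a := (0 : ℝ)) (b := 1)) (by
      intro s hs a
      have h1 := hzero s hs
      simp only [hg] at h1
      rw [dotProduct_A_mulVec h] at h1
      by_contra hne
      refine (h.A_posDef.dotProduct_mulVec_pos
        (x := fun a => ((E B s)ᵀ *ᵥ x) ⟨0, a⟩) ?_).ne' (by simpa using h1)
      exact fun h0 => hne (congrFun h0 a))
  have h2 := hu (1 / 2) (by norm_num)
  apply hx
  have h3 : (E B (-(1 / 2)))ᵀ *ᵥ ((E B (1 / 2))ᵀ *ᵥ x) = x := by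
    rw [Matrix.mulVec_mulVec, ← Matrix.transpose_mul, E_mul_E_neg]; simp
  rw [← h3]
  rw [show (E B (1 / 2))ᵀ *ᵥ x = 0 from h2, Matrix.mulVec_zero]

theorem covMat_posDef {A B : Matrix (Idx p) (Idx p) ℝ} (h : IsCanonicalPair p A B) (t : ℝ) :
    (covMat A B t).PosDef := C_one_posDef (h.scaled t)

theorem covMat_inv_symm {A B : Matrix (Idx p) (Idx p) ℝ} (h : IsCanonicalPair p A B) (t : ℝ) :
    ((covMat A B t)⁻¹)ᵀ = (covMat A B t)⁻¹ := by
  have := (covMat_posDef h t).inv.isHermitian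
  rwa [Matrix.IsHermitian, Matrix.conjTranspose_eq_transpose_of_trivial] at this

theorem contDiff_covMat_inv {A B : Matrix (Idx p) (Idx p) ℝ} (h : IsCanonicalPair p A B)
    (k l : Idx p) : ContDiff ℝ 1 fun t => (covMat A B t)⁻¹ k l :=
  contDiff_inv (contDiff_covMat A B) (fun t => (covMat_posDef h t).det_pos.ne') k l

theorem contDiff_covMat_det (A B : Matrix (Idx p) (Idx p) ℝ) :
    ContDiff ℝ 1 fun t => (covMat A B t).det :=
  contDiff_det (contDiff_covMat A B)

/-- The inverse covariance matrices are uniformly positive definite on compact time intervals. -/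
theorem exists_covMat_inv_lower {A B : Matrix (Idx p) (Idx p) ℝ} (h : IsCanonicalPair p A B)
    (T : ℝ) : ∃ c : ℝ, 0 < c ∧ ∀ t ∈ Set.Icc 0 T, ∀ v : Idx p → ℝ,
      c * ∑ k, v k ^ 2 ≤ ((covMat A B t)⁻¹ *ᵥ v) ⬝ᵥ v := by
  have hcont : Continuous fun x : ℝ × (Idx p → ℝ) => ((covMat A B x.1)⁻¹ *ᵥ x.2) ⬝ᵥ x.2 := by
    simp only [dotProduct, Matrix.mulVec]
    refine continuous_finsetSum _ fun k _ => (continuous_finsetSum _ fun l _ => ?_).mul ?_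
    · exact ((contDiff_covMat_inv h k l).continuous.comp continuous_fst).mul
        ((continuous_apply l).comp continuous_snd)
    · exact (continuous_apply k).comp continuous_snd
  have hpos : ∀ t (v : Idx p → ℝ), v ≠ 0 → 0 < ((covMat A B t)⁻¹ *ᵥ v) ⬝ᵥ v := fun t v hv => by
    rw [dotProduct_comm]
    simpa using (covMat_posDef h t).inv.dotProduct_mulVec_pos hv
  have hcpt : IsCompact (Set.Icc 0 T ×ˢ Metric.sphere (0 : Idx p → ℝ) 1) :=
    isCompact_Icc.prod (isCompact_sphere _ _)
  obtain ⟨c, hc, hcb⟩ : ∃ c : ℝ, 0 < c ∧ ∀ x ∈ Set.Icc 0 T ×ˢ Metric.sphere (0 : Idx p → ℝ) 1,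
      c ≤ ((covMat A B x.1)⁻¹ *ᵥ x.2) ⬝ᵥ x.2 := by
    rcases (Set.Icc 0 T ×ˢ Metric.sphere (0 : Idx p → ℝ) 1).eq_empty_or_nonempty with he | hne
    · exact ⟨1, one_pos, fun x hx => by simp [he] at hx⟩
    · obtain ⟨x, hx, hmin⟩ := hcpt.exists_isMinOn hne hcont.continuousOn
      refine ⟨_, hpos x.1 x.2 ?_, fun y hy => hmin hy⟩
      intro h0
      have := hx.2
      simp [h0] at this
  -- The minimum c was taken on the unit sphere of the sup norm; the denominator pays for passing to
  -- the sum of squares, and its + 1 keeps it positive.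
  refine ⟨c / (Fintype.card (Idx p) + 1), by positivity, fun t ht v => ?_⟩
  rcases eq_or_ne v 0 with rfl | hv
  · simp
  have hv' : 0 < ‖v‖ := norm_pos_iff.2 hv
  have h1 := hcb (t, ‖v‖⁻¹ • v) ⟨ht, by simp [norm_smul, hv'.ne']⟩
  simp only [Matrix.mulVec_smul, smul_dotProduct, dotProduct_smul, smul_eq_mul] at h1
  have h2 : c * ‖v‖ ^ 2 ≤ ((covMat A B t)⁻¹ *ᵥ v) ⬝ᵥ v := by
    rw [← mul_assoc, ← pow_two, inv_pow, inv_mul_eq_div, le_div_iff₀ (by positivity)] at h1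
    exact h1
  have h3 : ∑ k, v k ^ 2 ≤ (Fintype.card (Idx p) + 1) * ‖v‖ ^ 2 := by
    calc ∑ k, v k ^ 2 ≤ ∑ _k : Idx p, ‖v‖ ^ 2 := Finset.sum_le_sum fun k _ => by
          rw [← sq_abs]
          exact pow_le_pow_left₀ (abs_nonneg _) (norm_le_pi_norm v k) 2
      _ = Fintype.card (Idx p) * ‖v‖ ^ 2 := by simp [Finset.sum_const]
      _ ≤ _ := by nlinarith [sq_nonneg ‖v‖]
  calc c / (Fintype.card (Idx p) + 1) * ∑ k, v k ^ 2
      ≤ c / (Fintype.card (Idx p) + 1) * ((Fintype.card (Idx p) + 1) * ‖v‖ ^ 2) := by gcongr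
    _ = c * ‖v‖ ^ 2 := by field_simp
    _ ≤ _ := h2

/-! ### The homogeneous norm and the quasi-distance. -/

/-- The homogeneity degree `2 j + 1` of the coordinates of block `j`. -/
def deg (k : Idx p) : ℕ := 2 * (k.1 : ℕ) + 1

theorem deg_cast (k : Idx p) : ((deg k : ℕ) : ℝ) = 2 * ((k.1 : ℕ) : ℝ) + 1 := by simp [deg]

theorem deg_ne_zero (k : Idx p) : deg k ≠ 0 := by simp [deg]

theorem deg_le (k : Idx p) : deg k ≤ 2 * r + 1 := by
  have := k.1.2
  simp only [deg]
  omega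

theorem sum_deg (p : Fin (r + 1) → ℕ) : ∑ k : Idx p, deg k = Q p := by
  simp [deg, Q, Fintype.sum_sigma, mul_comm]

theorem hnorm_eq (z : Pt p) :
    hnorm z = ∑ k : Idx p, |z.1 k| ^ ((deg k : ℝ)⁻¹) + √|z.2| := by
  simp [hnorm, deg_cast, Real.sqrt_eq_rpow]

theorem hnorm_nonneg (z : Pt p) : 0 ≤ hnorm z := by
  rw [hnorm_eq]; positivity

/-- Together with `abs_snd_le_hnorm_sq` and the converse `hnorm_le_of_le`, this replaces fractional
powers by natural ones, so that norm estimates can be made coordinate by coordinate. -/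
theorem abs_fst_le_hnorm_pow (z : Pt p) (k : Idx p) : |z.1 k| ≤ hnorm z ^ deg k := by
  have h1 : |z.1 k| ^ ((deg k : ℝ)⁻¹) ≤ hnorm z := by
    rw [hnorm_eq]
    have := Finset.single_le_sum (f := fun k => |z.1 k| ^ ((deg k : ℝ)⁻¹))
      (fun k _ => by positivity) (Finset.mem_univ k)
    linarith [Real.sqrt_nonneg |z.2|]
  calc |z.1 k| = (|z.1 k| ^ ((deg k : ℝ)⁻¹)) ^ deg k :=
        (Real.rpow_inv_natCast_pow (abs_nonneg _) (deg_ne_zero k)).symm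
    _ ≤ _ := by gcongr

theorem abs_snd_le_hnorm_sq (z : Pt p) : |z.2| ≤ hnorm z ^ 2 := by
  have h1 : √|z.2| ≤ hnorm z := by
    rw [hnorm_eq]
    have : 0 ≤ ∑ k : Idx p, |z.1 k| ^ ((deg k : ℝ)⁻¹) := by positivity
    linarith
  calc |z.2| = √|z.2| ^ 2 := (Real.sq_sqrt (abs_nonneg _)).symm
    _ ≤ _ := by gcongr

theorem hnorm_le_of_le {z : Pt p} {ρ : ℝ} (hρ : 0 ≤ ρ) (h1 : ∀ k, |z.1 k| ≤ ρ ^ deg k)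
    (h2 : |z.2| ≤ ρ ^ 2) : hnorm z ≤ (Fintype.card (Idx p) + 1) * ρ := by
  rw [hnorm_eq, add_mul, one_mul]
  refine add_le_add ?_ (Real.sqrt_le_iff.2 ⟨hρ, h2⟩)
  calc ∑ k : Idx p, |z.1 k| ^ ((deg k : ℝ)⁻¹) ≤ ∑ _k : Idx p, ρ := by
        refine Finset.sum_le_sum fun k _ => ?_
        calc |z.1 k| ^ ((deg k : ℝ)⁻¹) ≤ (ρ ^ deg k) ^ ((deg k : ℝ)⁻¹) := by
              gcongr; exact h1 k
          _ = ρ := Real.pow_rpow_inv_natCast hρ (deg_ne_zero k)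
    _ = _ := by simp

/-- All exponents are at most 1, and such powers are subadditive. This is the triangle inequality
for Euclidean addition, needed on straight segments; the group law only has the quasi-triangle
inequality `exists_hnorm_comp_le`. -/
theorem hnorm_add_le (z w : Pt p) : hnorm (z + w) ≤ hnorm z + hnorm w := by
  simp only [hnorm, Prod.fst_add, Prod.snd_add, Pi.add_apply]
  have key : ∀ (a b e : ℝ), 0 ≤ e → e ≤ 1 → |a + b| ^ e ≤ |a| ^ e + |b| ^ e := by
    intro a b e h0 h1
    exact (Real.rpow_le_rpow (abs_nonneg _) (abs_add_le a b) h0).trans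
      (Real.rpow_add_le_add_rpow (abs_nonneg _) (abs_nonneg _) h0 h1)
  have h1 : ∑ k : Idx p, |z.1 k + w.1 k| ^ (1 / (2 * ((k.1 : ℕ) : ℝ) + 1)) ≤
      ∑ k : Idx p, (|z.1 k| ^ (1 / (2 * ((k.1 : ℕ) : ℝ) + 1)) +
        |w.1 k| ^ (1 / (2 * ((k.1 : ℕ) : ℝ) + 1))) := by
    refine Finset.sum_le_sum fun k _ => key _ _ _ (by positivity) ?_
    rw [div_le_one (by positivity)]
    have : (0 : ℝ) ≤ ((k.1 : ℕ) : ℝ) := by positivity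
    linarith
  rw [Finset.sum_add_distrib] at h1
  have h2 := key z.2 w.2 (1 / 2) (by norm_num) (by norm_num)
  linarith

theorem hnorm_neg (z : Pt p) : hnorm (-z) = hnorm z := by simp [hnorm]

theorem hnorm_zero : hnorm (0 : Pt p) = 0 := by
  have h1 : hnorm (0 : Pt p) ≤ (Fintype.card (Idx p) + 1) * 0 :=
    hnorm_le_of_le le_rfl (fun k => by simp) (by simp)
  exact le_antisymm (by simpa using h1) (hnorm_nonneg _)

theorem eq_zero_of_hnorm {z : Pt p} (h : hnorm z = 0) : z = 0 := by
  ext k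
  · have := abs_fst_le_hnorm_pow z k
    rw [h, zero_pow (deg_ne_zero k)] at this
    simpa using this
  · have := abs_snd_le_hnorm_sq z
    rw [h] at this
    simpa using this

theorem continuous_hnorm : Continuous (hnorm : Pt p → ℝ) := by
  rw [show (hnorm : Pt p → ℝ) = _ from funext hnorm_eq]
  refine (continuous_finsetSum _ fun k _ => ?_).add (by fun_prop)
  exact Continuous.rpow_const (by fun_prop) fun z => Or.inr (by positivity)

theorem d_nonneg (B : Matrix (Idx p) (Idx p) ℝ) (x y : Pt p) : 0 ≤ d B x y := hnorm_nonneg _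

theorem d_self (B : Matrix (Idx p) (Idx p) ℝ) (x : Pt p) : d B x x = 0 := by
  rw [d, inv_comp, hnorm_zero]

theorem eq_of_d_eq_zero {B : Matrix (Idx p) (Idx p) ℝ} {x y : Pt p} (h : d B x y = 0) : x = y := by
  have h1 := eq_zero_of_hnorm h
  have h2 : comp B y (comp B (inv B y) x) = x := by rw [← comp_assoc, comp_inv, zero_comp]
  rw [h1, comp_zero] at h2
  exact h2.symm

/-- The entries of `E` below the diagonal blocks are small near `0`. -/
theorem exists_E_bound {A B : Matrix (Idx p) (Idx p) ℝ} (h : IsCanonicalPair p A B) (T : ℝ) :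
    ∃ c : ℝ, 0 ≤ c ∧ ∀ τ : ℝ, |τ| ≤ T → ∀ k l : Idx p,
      |E B τ k l| ≤ c * |τ| ^ ((k.1 : ℕ) - (l.1 : ℕ)) := by
  -- One continuous function dominates two: `E (scaled B τ) 1` is for the entries below the diagonal
  -- blocks, where conjugation by the dilations provides the power of τ, and `E B τ` for all others,
  -- where no power is claimed.
  have hcont : ∀ k l : Idx p, Continuous fun τ : ℝ =>
      |E (scaled B τ) 1 k l| + |E B τ k l| * (1 + |τ| ^ ((l.1 : ℕ) - (k.1 : ℕ))) := fun k l =>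
    ((contDiff_E_scaled B k l).continuous.comp (by fun_prop :
      Continuous fun τ : ℝ => (τ, (1 : ℝ)))).abs.add
        ((contDiff_E B k l).continuous.abs.mul (by fun_prop))
  have hb : ∀ k l : Idx p, ∃ c : ℝ, 0 ≤ c ∧ ∀ τ : ℝ, |τ| ≤ T →
      |E (scaled B τ) 1 k l| + |E B τ k l| * (1 + |τ| ^ ((l.1 : ℕ) - (k.1 : ℕ))) ≤ c := by
    intro k l
    obtain ⟨c, hc⟩ := ((isCompact_Icc (a := -T) (b := T)).image (hcont k l)).bddAbove
    exact ⟨max c 0, le_max_right _ _, fun τ hτ =>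
      (hc ⟨τ, abs_le.1 hτ, rfl⟩).trans (le_max_left _ _)⟩
  choose c hc0 hc using hb
  refine ⟨∑ k, ∑ l, c k l, Finset.sum_nonneg fun k _ => Finset.sum_nonneg fun l _ => hc0 k l,
    fun τ hτ k l => ?_⟩
  have hle : c k l ≤ ∑ k, ∑ l, c k l :=
    (Finset.single_le_sum (f := fun l => c k l) (fun l _ => hc0 k l) (Finset.mem_univ l)).trans
      (Finset.single_le_sum (f := fun k => ∑ l, c k l)
        (fun k _ => Finset.sum_nonneg fun l _ => hc0 k l) (Finset.mem_univ k))
  refine le_trans ?_ (mul_le_mul_of_nonneg_right hle (by positivity))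
  have h1 := hc k l τ hτ
  rcases le_or_gt (k.1 : ℕ) (l.1 : ℕ) with hkl | hkl
  · rw [Nat.sub_eq_zero_of_le hkl, pow_zero, mul_one]
    have : 0 ≤ |E B τ k l| * |τ| ^ ((l.1 : ℕ) - (k.1 : ℕ)) := by positivity
    linarith [abs_nonneg (E (scaled B τ) 1 k l)]
  · rcases eq_or_ne τ 0 with rfl | hτ0
    · have : k ≠ l := fun h => by simp [h] at hkl
      simp [E_zero, Matrix.one_apply_ne this, zero_pow (Nat.sub_ne_zero_of_lt hkl)]
    · have h2 := E_mul_eq_conj h hτ0 1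
      rw [mul_one] at h2
      have h3 : E B τ k l = τ ^ ((k.1 : ℕ) - (l.1 : ℕ)) * E (scaled B τ) 1 k l := by
        rw [h2, dil, dil, Matrix.mul_diagonal, Matrix.diagonal_mul, pow_sub₀ τ hτ0 hkl.le]
        simp only [inv_pow]
        ring
      rw [h3, abs_mul, abs_pow, mul_comm]
      gcongr
      have : 0 ≤ |E B τ k l| * (1 + |τ| ^ ((l.1 : ℕ) - (k.1 : ℕ))) := by positivity
      linarith

/-- The mean value theorem gives one factor |τ| everywhere; two or more blocks below the diagonal
the identity has no entries and `exists_E_bound` gives the higher power. -/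
theorem exists_E_sub_one_bound {A B : Matrix (Idx p) (Idx p) ℝ} (h : IsCanonicalPair p A B)
    (T : ℝ) : ∃ c : ℝ, 0 ≤ c ∧ ∀ τ : ℝ, |τ| ≤ T → ∀ k l : Idx p,
      |E B τ k l - (1 : Matrix (Idx p) (Idx p) ℝ) k l| ≤
        c * |τ| ^ (max 1 ((k.1 : ℕ) - (l.1 : ℕ))) := by
  have hb : ∀ k l : Idx p, ∃ c : ℝ, 0 ≤ c ∧ ∀ τ : ℝ, |τ| ≤ T →
      |E B τ k l - (1 : Matrix (Idx p) (Idx p) ℝ) k l| ≤ c * |τ| := by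
    intro k l
    have hE := contDiff_E B k l
    obtain ⟨c, hc⟩ := ((isCompact_Icc (a := -T) (b := T)).image
      (hE.continuous_deriv (by simp)).norm).bddAbove
    refine ⟨max c 0, le_max_right _ _, fun τ hτ => ?_⟩
    have hT : 0 ≤ T := (abs_nonneg τ).trans hτ
    have := (convex_Icc (-T) T).norm_image_sub_le_of_norm_deriv_le (f := fun s => E B s k l)
      (x := 0) (y := τ) (C := max c 0)
      (fun x _ => (hE.differentiable (by simp)) x)
      (fun x hx => (hc ⟨x, hx, rfl⟩).trans (le_max_left _ _)) ⟨by linarith, hT⟩ (abs_le.1 hτ)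
    simpa [E_zero] using this
  choose c hc0 hc using hb
  obtain ⟨c', hc'0, hc'⟩ := exists_E_bound h T
  have hs0 : 0 ≤ ∑ k, ∑ l, c k l :=
    Finset.sum_nonneg fun k _ => Finset.sum_nonneg fun l _ => hc0 k l
  refine ⟨c' + ∑ k, ∑ l, c k l, by positivity, fun τ hτ k l => ?_⟩
  have hle : c k l ≤ ∑ k, ∑ l, c k l :=
    (Finset.single_le_sum (f := fun l => c k l) (fun l _ => hc0 k l) (Finset.mem_univ l)).trans
      (Finset.single_le_sum (f := fun k => ∑ l, c k l)
        (fun k _ => Finset.sum_nonneg fun l _ => hc0 k l) (Finset.mem_univ k))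
  rcases le_or_gt ((k.1 : ℕ) - (l.1 : ℕ)) 1 with hkl | hkl
  · rw [max_eq_left hkl, pow_one]
    refine (hc k l τ hτ).trans ?_
    gcongr
    linarith
  · rw [max_eq_right hkl.le]
    have : k ≠ l := fun h => by simp [h] at hkl
    rw [Matrix.one_apply_ne this, sub_zero]
    refine (hc' τ hτ k l).trans ?_
    gcongr
    linarith

theorem sum_le_of_forall_le {ι : Type*} [Fintype ι] {f : ι → ℝ} {c : ℝ} (h : ∀ i, f i ≤ c) :
    ∑ i, f i ≤ Fintype.card ι * c := by
  calc ∑ i, f i ≤ ∑ _i : ι, c := Finset.sum_le_sum fun i _ => h i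
    _ = _ := by simp

theorem abs_mulVec_le {ι : Type*} [Fintype ι] (M : Matrix ι ι ℝ) (x : ι → ℝ) (k : ι) {c : ℝ}
    (h : ∀ l, |M k l| * |x l| ≤ c) : |(M *ᵥ x) k| ≤ Fintype.card ι * c := by
  rw [Matrix.mulVec, dotProduct]
  refine (Finset.abs_sum_le_sum_abs _ _).trans (sum_le_of_forall_le fun l => ?_)
  rw [abs_mul]
  exact h l

theorem pow_le_pow_mul_pow {ρ L : ℝ} (h0 : 0 ≤ ρ) (hL : ρ ≤ L) (h1 : 1 ≤ L) {a b m : ℕ}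
    (hab : a ≤ b) (hm : b ≤ a + m) : ρ ^ b ≤ L ^ m * ρ ^ a := by
  obtain ⟨n, rfl⟩ := Nat.exists_eq_add_of_le hab
  rw [pow_add, mul_comm]
  gcongr
  exact (pow_le_pow_left₀ h0 hL n).trans (pow_le_pow_right₀ h1 (by omega))

/-- With |τ| ≤ ρ² the (k, l) term has size ρ^(2(k-l) + deg l), subtraction being truncated. This is
ρ^(deg k) for l ≤ k and a higher power otherwise, whose excess is absorbed by L. -/
theorem exists_E_mulVec_bound {A B : Matrix (Idx p) (Idx p) ℝ} (h : IsCanonicalPair p A B)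
    {L : ℝ} (hL : 1 ≤ L) : ∃ c : ℝ, 0 ≤ c ∧ ∀ ρ : ℝ, 0 ≤ ρ → ρ ≤ L → ∀ τ : ℝ, |τ| ≤ ρ ^ 2 →
      ∀ x : Idx p → ℝ, (∀ k, |x k| ≤ ρ ^ deg k) → ∀ k, |(E B τ *ᵥ x) k| ≤ c * ρ ^ deg k := by
  obtain ⟨c, hc0, hc⟩ := exists_E_bound h (L ^ 2)
  refine ⟨Fintype.card (Idx p) * (c * L ^ (2 * r)), by positivity, ?_⟩
  intro ρ hρ hρL τ hτ x hx k
  rw [mul_assoc]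
  refine abs_mulVec_le _ _ _ fun l => ?_
  have hk := k.1.2
  have hl := l.1.2
  calc |E B τ k l| * |x l|
      ≤ (c * (ρ ^ 2) ^ ((k.1 : ℕ) - (l.1 : ℕ))) * ρ ^ deg l := by
        refine mul_le_mul ((hc τ (hτ.trans (by gcongr)) k l).trans ?_) (hx l) (abs_nonneg _)
          (by positivity)
        gcongr
    _ = c * ρ ^ (2 * ((k.1 : ℕ) - (l.1 : ℕ)) + deg l) := by rw [pow_add, pow_mul, mul_assoc]
    _ ≤ c * (L ^ (2 * r) * ρ ^ deg k) := by
        refine mul_le_mul_of_nonneg_left (pow_le_pow_mul_pow hρ hρL hL ?_ ?_) hc0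
        · simp only [deg]; omega
        · simp only [deg]; omega
    _ = _ := by ring

theorem exists_hnorm_comp_le {A B : Matrix (Idx p) (Idx p) ℝ} (h : IsCanonicalPair p A B)
    (L : ℝ) : ∃ c : ℝ, 1 ≤ c ∧ ∀ z w : Pt p, hnorm z ≤ L → hnorm w ≤ L →
      hnorm (comp B z w) ≤ c * (hnorm z + hnorm w) := by
  have hL : 1 ≤ 2 * max L 1 := by linarith [le_max_right L 1]
  obtain ⟨c, hc0, hc⟩ := exists_E_mulVec_bound h hL
  refine ⟨(Fintype.card (Idx p) + 1) * (1 + c), ?_, fun z w hz hw => ?_⟩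
  · have : (0 : ℝ) ≤ Fintype.card (Idx p) := by positivity
    nlinarith
  set ρ := hnorm z + hnorm w with hρ
  have hz0 := hnorm_nonneg z
  have hw0 := hnorm_nonneg w
  have hρ0 : 0 ≤ ρ := by positivity
  rw [mul_assoc]
  refine hnorm_le_of_le (by positivity) (fun k => ?_) ?_
  · have h1 : |(E B w.2 *ᵥ z.1) k| ≤ c * ρ ^ deg k := by
      refine hc ρ hρ0 (by linarith [le_max_left L 1]) _ ?_ _ (fun l => ?_) k
      · exact (abs_snd_le_hnorm_sq w).trans (by gcongr; linarith)
      · exact (abs_fst_le_hnorm_pow z l).trans (by gcongr; linarith)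
    have h2 : |w.1 k| ≤ ρ ^ deg k :=
      (abs_fst_le_hnorm_pow w k).trans (by gcongr; linarith)
    calc |(comp B z w).1 k| ≤ |w.1 k| + |(E B w.2 *ᵥ z.1) k| := by
          simpa [comp] using abs_add_le (w.1 k) ((E B w.2 *ᵥ z.1) k)
      _ ≤ (1 + c) * ρ ^ deg k := by linarith
      -- The constant is moved under the power `deg k` so that `hnorm_le_of_le` applies with radius
      -- (1 + c) ρ.
      _ ≤ (1 + c) ^ deg k * ρ ^ deg k := by
          gcongr
          exact le_self_pow₀ (by linarith) (deg_ne_zero k)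
      _ = _ := by rw [mul_pow]
  · have h1 := abs_snd_le_hnorm_sq w
    have h2 := abs_snd_le_hnorm_sq z
    calc |(comp B z w).2| ≤ |z.2| + |w.2| := by simpa [comp] using abs_add_le z.2 w.2
      _ ≤ ρ ^ 2 := by nlinarith
      _ ≤ ((1 + c) * ρ) ^ 2 := by
          gcongr
          nlinarith

theorem exists_hnorm_inv_le {A B : Matrix (Idx p) (Idx p) ℝ} (h : IsCanonicalPair p A B)
    (L : ℝ) : ∃ c : ℝ, 1 ≤ c ∧ ∀ z : Pt p, hnorm z ≤ L → hnorm (inv B z) ≤ c * hnorm z := by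
  have hL : 1 ≤ max L 1 := le_max_right L 1
  obtain ⟨c, hc0, hc⟩ := exists_E_mulVec_bound h hL
  refine ⟨(Fintype.card (Idx p) + 1) * (1 + c), ?_, fun z hz => ?_⟩
  · have : (0 : ℝ) ≤ Fintype.card (Idx p) := by positivity
    nlinarith
  have hz0 := hnorm_nonneg z
  rw [mul_assoc]
  refine hnorm_le_of_le (by positivity) (fun k => ?_) ?_
  · have h1 : |(E B (-z.2) *ᵥ z.1) k| ≤ c * hnorm z ^ deg k := by
      refine hc _ hz0 (hz.trans (le_max_left L 1)) _ ?_ _ (abs_fst_le_hnorm_pow z) k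
      rw [abs_neg]
      exact abs_snd_le_hnorm_sq z
    calc |(inv B z).1 k| = |(E B (-z.2) *ᵥ z.1) k| := by simp [inv]
      _ ≤ (1 + c) * hnorm z ^ deg k := h1.trans (by gcongr; linarith)
      _ ≤ (1 + c) ^ deg k * hnorm z ^ deg k := by
          gcongr
          exact le_self_pow₀ (by linarith) (deg_ne_zero k)
      _ = _ := by rw [mul_pow]
  · have h1 := abs_snd_le_hnorm_sq z
    calc |(inv B z).2| = |z.2| := by simp [inv]
      _ ≤ hnorm z ^ 2 := h1
      _ ≤ ((1 + c) * hnorm z) ^ 2 := by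
          gcongr
          nlinarith

/-- Coordinatewise size of the increment of a right translation. -/
theorem exists_comp_sub_bound {A B : Matrix (Idx p) (Idx p) ℝ} (h : IsCanonicalPair p A B)
    (L : ℝ) : ∃ c : ℝ, 1 ≤ c ∧ ∀ u w : Pt p, hnorm u ≤ L → hnorm w ≤ hnorm u → ∀ k,
      |(comp B u w - u).1 k| ≤ c * (hnorm w * hnorm u ^ (2 * (k.1 : ℕ))) := by
  set L' := max L 1
  have hL : 1 ≤ L' := le_max_right L 1
  obtain ⟨c, hc0, hc⟩ := exists_E_sub_one_bound h (L' ^ 2)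
  refine ⟨1 + Fintype.card (Idx p) * (c * L' ^ (2 * (r + 1))),
    le_add_of_nonneg_right (by positivity), ?_⟩
  intro u w hu hw k
  have hw0 := hnorm_nonneg w
  have hu0 := hnorm_nonneg u
  have huL : hnorm u ≤ L' := hu.trans (le_max_left L 1)
  have hτ := abs_snd_le_hnorm_sq w
  have heq : (comp B u w - u).1 k = w.1 k + ((E B w.2 - 1) *ᵥ u.1) k := by
    simp [comp, Matrix.sub_mulVec, add_sub_assoc]
  have h1 : |w.1 k| ≤ hnorm w * hnorm u ^ (2 * (k.1 : ℕ)) := by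
    refine (abs_fst_le_hnorm_pow w k).trans ?_
    rw [deg, pow_succ']
    gcongr
  have h2 : |((E B w.2 - 1) *ᵥ u.1) k| ≤ Fintype.card (Idx p) *
      (c * L' ^ (2 * (r + 1)) * (hnorm w * hnorm u ^ (2 * (k.1 : ℕ)))) := by
    refine abs_mulVec_le _ _ _ fun l => ?_
    have hk := k.1.2
    have hl := l.1.2
    obtain ⟨m, hm⟩ : ∃ m, max 1 ((k.1 : ℕ) - (l.1 : ℕ)) = m + 1 :=
      ⟨max 1 ((k.1 : ℕ) - (l.1 : ℕ)) - 1, by omega⟩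
    have h3 := hc w.2 (hτ.trans (by gcongr; exact hw.trans huL)) k l
    rw [hm] at h3
    -- Only one power of ‖w‖ is kept; the other 2m + 1 are exchanged for powers of ‖u‖.
    have h4 : |w.2| ^ (m + 1) ≤ hnorm w * hnorm u ^ (2 * m + 1) := by
      calc |w.2| ^ (m + 1) ≤ (hnorm w ^ 2) ^ (m + 1) := by gcongr
        _ = hnorm w * hnorm w ^ (2 * m + 1) := by ring
        _ ≤ _ := by gcongr
    calc |(E B w.2 - 1) k l| * |u.1 l|
        ≤ (c * (hnorm w * hnorm u ^ (2 * m + 1))) * hnorm u ^ deg l := by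
          refine mul_le_mul ?_ (abs_fst_le_hnorm_pow u l) (abs_nonneg _) (by positivity)
          exact h3.trans (by gcongr)
      _ = c * hnorm w * hnorm u ^ (2 * m + 1 + deg l) := by rw [pow_add]; ring
      _ ≤ c * hnorm w * (L' ^ (2 * (r + 1)) * hnorm u ^ (2 * (k.1 : ℕ))) := by
          refine mul_le_mul_of_nonneg_left (pow_le_pow_mul_pow hu0 huL hL ?_ ?_) (by positivity)
          · simp only [deg]; omega
          · simp only [deg]; omega
      _ = _ := by ring
  calc |(comp B u w - u).1 k| ≤ |w.1 k| + |((E B w.2 - 1) *ᵥ u.1) k| := by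
        rw [heq]; exact abs_add_le _ _
    _ ≤ hnorm w * hnorm u ^ (2 * (k.1 : ℕ)) + Fintype.card (Idx p) *
      (c * L' ^ (2 * (r + 1)) * (hnorm w * hnorm u ^ (2 * (k.1 : ℕ)))) := add_le_add h1 h2
    _ = _ := by ring

/-- If `w` is much smaller than `u`, the segment from `u` to `u ∘ w` stays away from the origin. -/
theorem exists_hnorm_segment {A B : Matrix (Idx p) (Idx p) ℝ} (h : IsCanonicalPair p A B)
    (L : ℝ) : ∃ ε : ℝ, 0 < ε ∧ ε ≤ 1 ∧ ∀ u w : Pt p, hnorm u ≤ L → hnorm w ≤ ε * hnorm u →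
      ∀ s ∈ Set.Icc (0 : ℝ) 1, hnorm u / 2 ≤ hnorm (u + s • (comp B u w - u)) ∧
        hnorm (u + s • (comp B u w - u)) ≤ 2 * hnorm u := by
  obtain ⟨c, hc1, hc⟩ := exists_comp_sub_bound h L
  -- The value of θ cancels the constant in `hnorm_le_of_le`, so that the displacement has norm at
  -- most ‖u‖/2. In ε the power 2r + 1 is the largest degree, and c comes from
  -- `exists_comp_sub_bound`.
  set θ : ℝ := 1 / (2 * (Fintype.card (Idx p) + 1)) with hθ
  have hθ0 : 0 < θ := by positivity
  have hθ1 : θ ≤ 1 := by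
    rw [hθ, div_le_one (by positivity)]
    have : (0 : ℝ) ≤ Fintype.card (Idx p) := by positivity
    linarith
  have hθp : θ ^ (2 * r + 1) ≤ θ := pow_le_of_le_one hθ0.le hθ1 (by omega)
  have hεθ : θ ^ (2 * r + 1) / c ≤ θ := (div_le_self (by positivity) hc1).trans hθp
  refine ⟨θ ^ (2 * r + 1) / c, by positivity, hεθ.trans hθ1, fun u w hu hw s hs => ?_⟩
  have hu0 := hnorm_nonneg u
  have hw0 := hnorm_nonneg w
  have hwu : hnorm w ≤ hnorm u :=
    hw.trans (mul_le_of_le_one_left hu0 (hεθ.trans hθ1))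
  have hΔ : hnorm (s • (comp B u w - u)) ≤ hnorm u / 2 := by
    have h1 : hnorm (s • (comp B u w - u)) ≤
        (Fintype.card (Idx p) + 1) * (θ * hnorm u) := by
      refine hnorm_le_of_le (by positivity) (fun k => ?_) ?_
      · calc |(s • (comp B u w - u)).1 k| = s * |(comp B u w - u).1 k| := by
              rw [Prod.smul_fst, Pi.smul_apply, smul_eq_mul, abs_mul, abs_of_nonneg hs.1]
          _ ≤ 1 * (c * (hnorm w * hnorm u ^ (2 * (k.1 : ℕ)))) :=
              mul_le_mul hs.2 (hc u w hu hwu k) (abs_nonneg _) zero_le_one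
          _ ≤ 1 * (c * (θ ^ (2 * r + 1) / c * hnorm u * hnorm u ^ (2 * (k.1 : ℕ)))) := by gcongr
          _ = θ ^ (2 * r + 1) * hnorm u ^ deg k := by rw [deg, pow_succ' (hnorm u)]; field_simp
          _ ≤ θ ^ deg k * hnorm u ^ deg k := by
              gcongr ?_ * _
              exact pow_le_pow_of_le_one hθ0.le hθ1 (deg_le k)
          _ = _ := by rw [mul_pow]
      · calc |(s • (comp B u w - u)).2| = s * |w.2| := by
              simp [comp, abs_mul, abs_of_nonneg hs.1]
          _ ≤ 1 * (hnorm w) ^ 2 :=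
              mul_le_mul hs.2 (abs_snd_le_hnorm_sq w) (abs_nonneg _) zero_le_one
          _ ≤ _ := by
              rw [one_mul]
              gcongr
              exact hw.trans (by gcongr)
    refine h1.trans (le_of_eq ?_)
    rw [hθ]; field_simp
  have h1 := hnorm_add_le (u + s • (comp B u w - u)) (-(s • (comp B u w - u)))
  rw [add_neg_cancel_right, hnorm_neg] at h1
  have h2 := hnorm_add_le u (s • (comp B u w - u))
  constructor <;> linarith

/-! ### Gaussian Hessians and their derivatives along curves. -/

section Gauss

variable {ι : Type*} [Fintype ι]

/-- The Hessian entry of `exp (-⟨N v, v⟩ / 4)`. -/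
def gaussHess (N : Matrix ι ι ℝ) (i j : ι) (v : ι → ℝ) : ℝ :=
  ((1 / 4) * ((N *ᵥ v) i * (N *ᵥ v) j) - (1 / 2) * N i j) * Real.exp (-(1 / 4) * ((N *ᵥ v) ⬝ᵥ v))

/-- `1 + ∑ vₖ²`. -/
def weight (v : ι → ℝ) : ℝ := 1 + ∑ k, v k ^ 2

theorem one_le_weight (v : ι → ℝ) : 1 ≤ weight v :=
  le_add_of_nonneg_right (Finset.sum_nonneg fun _ _ => sq_nonneg _)

theorem weight_pos (v : ι → ℝ) : 0 < weight v := one_pos.trans_le (one_le_weight v)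

theorem abs_le_weight (v : ι → ℝ) (k : ι) : |v k| ≤ weight v := by
  have h1 : v k ^ 2 ≤ ∑ k, v k ^ 2 :=
    Finset.single_le_sum (f := fun k => v k ^ 2) (fun _ _ => sq_nonneg _) (Finset.mem_univ k)
  rw [weight]
  nlinarith [sq_abs (v k), sq_nonneg (|v k| - 1), abs_nonneg (v k)]

theorem abs_dotProduct_le {v w : ι → ℝ} {a b : ℝ} (ha : 0 ≤ a) (hv : ∀ k, |v k| ≤ a)
    (hw : ∀ k, |w k| ≤ b) : |v ⬝ᵥ w| ≤ Fintype.card ι * (a * b) := by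
  rw [dotProduct]
  refine (Finset.abs_sum_le_sum_abs _ _).trans (sum_le_of_forall_le fun l => ?_)
  rw [abs_mul]
  exact mul_le_mul (hv l) (hw l) (abs_nonneg _) ha

theorem abs_mulVec_le_mul {N : Matrix ι ι ℝ} {v : ι → ℝ} {a b : ℝ} (ha : 0 ≤ a)
    (hN : ∀ k l, |N k l| ≤ a) (hv : ∀ k, |v k| ≤ b) (k : ι) :
    |(N *ᵥ v) k| ≤ Fintype.card ι * (a * b) :=
  abs_dotProduct_le ha (hN k) hv

theorem hasDerivAt_mulVec {N : ℝ → Matrix ι ι ℝ} {v : ℝ → ι → ℝ} {N' : Matrix ι ι ℝ} {v' : ι → ℝ}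
    {s : ℝ} (hN : ∀ k l, HasDerivAt (fun s => N s k l) (N' k l) s)
    (hv : ∀ k, HasDerivAt (fun s => v s k) (v' k) s) (k : ι) :
    HasDerivAt (fun s => (N s *ᵥ v s) k) ((N' *ᵥ v s) k + (N s *ᵥ v') k) s := by
  simp only [Matrix.mulVec, dotProduct, ← Finset.sum_add_distrib]
  exact HasDerivAt.fun_sum fun l _ => (hN k l).mul (hv l)

/-- X bounds the sizes and X κ the rates of change of N, v and N v. Two powers of X come from the
quadratic factor and two more from differentiating the exponent. -/
theorem hasDerivAt_gaussHess {N : ℝ → Matrix ι ι ℝ} {v : ℝ → ι → ℝ} {N' : Matrix ι ι ℝ}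
    {v' : ι → ℝ} {s : ℝ} (hN : ∀ k l, HasDerivAt (fun s => N s k l) (N' k l) s)
    (hv : ∀ k, HasDerivAt (fun s => v s k) (v' k) s) (i j : ι) {X κ : ℝ} (hX : 1 ≤ X)
    (hκ : 0 ≤ κ) (hvX : ∀ k, |v s k| ≤ X) (hwX : ∀ k, |(N s *ᵥ v s) k| ≤ X)
    (hNX : |N s i j| ≤ X) (hv'X : ∀ k, |v' k| ≤ X * κ)
    (hw'X : ∀ k, |(N' *ᵥ v s) k + (N s *ᵥ v') k| ≤ X * κ) (hN'X : |N' i j| ≤ X * κ) :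
    ∃ D, HasDerivAt (fun s => gaussHess (N s) i j (v s)) D s ∧
      |D| ≤ (Fintype.card ι + 1) * X ^ 4 * κ *
        Real.exp (-(1 / 4) * ((N s *ᵥ v s) ⬝ᵥ v s)) := by
  set w' : ι → ℝ := fun k => (N' *ᵥ v s) k + (N s *ᵥ v') k with hw'
  set w := N s *ᵥ v s with hw
  set e := Real.exp (-(1 / 4) * (w ⬝ᵥ v s)) with he
  have hdw : ∀ k, HasDerivAt (fun s => (N s *ᵥ v s) k) (w' k) s := hasDerivAt_mulVec hN hv
  have hdq : HasDerivAt (fun s => (N s *ᵥ v s) ⬝ᵥ v s) (w' ⬝ᵥ v s + w ⬝ᵥ v') s := by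
    simp only [dotProduct, ← Finset.sum_add_distrib]
    exact HasDerivAt.fun_sum fun k _ => (hdw k).mul (hv k)
  have hd := ((((hdw i).fun_mul (hdw j)).const_mul (1 / 4)).fun_sub
    ((hN i j).const_mul (1 / 2))).fun_mul
    ((hdq.const_mul (-(1 / 4))).exp)
  refine ⟨_, hd, ?_⟩
  have hX0 : 0 ≤ X := by linarith
  have hXκ : 0 ≤ X * κ := by positivity
  have hn : (0 : ℝ) ≤ Fintype.card ι := by positivity
  have h1 : |w' i * w j + w i * w' j| ≤ 2 * (X ^ 2 * κ) := by
    refine (abs_add_le _ _).trans ?_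
    rw [abs_mul, abs_mul]
    have a1 := mul_le_mul (hw'X i) (hwX j) (abs_nonneg _) hXκ
    have a2 := mul_le_mul (hwX i) (hw'X j) (abs_nonneg _) hX0
    linarith [mul_comm X (X * κ)]
  have hXX : X ≤ X ^ 2 := by nlinarith
  have h2 : |(1 / 4) * (w' i * w j + w i * w' j) - (1 / 2) * N' i j| ≤ X ^ 2 * κ := by
    refine (abs_sub _ _).trans ?_
    rw [abs_mul (1 / 4 : ℝ), abs_mul (1 / 2 : ℝ), abs_of_pos (by norm_num : (0 : ℝ) < 1 / 4),
      abs_of_pos (by norm_num : (0 : ℝ) < 1 / 2)]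
    have := mul_le_mul_of_nonneg_right hXX hκ
    linarith
  have h3 : |(1 / 4) * (w i * w j) - (1 / 2) * N s i j| ≤ X ^ 2 := by
    refine (abs_sub _ _).trans ?_
    rw [abs_mul (1 / 4 : ℝ), abs_mul (1 / 2 : ℝ), abs_of_pos (by norm_num : (0 : ℝ) < 1 / 4),
      abs_of_pos (by norm_num : (0 : ℝ) < 1 / 2), abs_mul]
    have := mul_le_mul (hwX i) (hwX j) (abs_nonneg _) hX0
    nlinarith [sq_nonneg X]
  have h4 : |-(1 / 4) * (w' ⬝ᵥ v s + w ⬝ᵥ v')| ≤ Fintype.card ι * (X ^ 2 * κ) := by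
    rw [abs_mul, abs_of_neg (by norm_num : -(1 / 4 : ℝ) < 0)]
    have a1 := abs_dotProduct_le hXκ hw'X hvX
    have a2 := abs_dotProduct_le hX0 hwX hv'X
    have a3 := abs_add_le (w' ⬝ᵥ v s) (w ⬝ᵥ v')
    have a4 : 0 ≤ Fintype.card ι * (X ^ 2 * κ) := by positivity
    have a5 : Fintype.card ι * (X * κ * X) = Fintype.card ι * (X ^ 2 * κ) := by ring
    have a6 : Fintype.card ι * (X * (X * κ)) = Fintype.card ι * (X ^ 2 * κ) := by ring
    linarith
  have he0 : 0 < e := Real.exp_pos _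
  refine (abs_add_le _ _).trans ?_
  rw [abs_mul, abs_mul, abs_mul, abs_of_pos he0]
  have h5 : |(1 / 4) * (w' i * w j + w i * w' j) - (1 / 2) * N' i j| * e ≤ X ^ 2 * κ * e := by
    gcongr
  have h6 : |(1 / 4) * (w i * w j) - (1 / 2) * N s i j| *
      (e * |-(1 / 4) * (w' ⬝ᵥ v s + w ⬝ᵥ v')|) ≤
        X ^ 2 * (e * (Fintype.card ι * (X ^ 2 * κ))) := by
    gcongr
  refine (add_le_add h5 h6).trans ?_
  have h7 : X ^ 2 * κ * e ≤ X ^ 4 * κ * e := by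
    gcongr
    norm_num
  nlinarith

theorem abs_gaussHess_le {N : Matrix ι ι ℝ} {v : ι → ℝ} {i j : ι} {X : ℝ} (hX : 1 ≤ X)
    (hwX : ∀ k, |(N *ᵥ v) k| ≤ X) (hNX : |N i j| ≤ X) :
    |gaussHess N i j v| ≤ X ^ 2 * Real.exp (-(1 / 4) * ((N *ᵥ v) ⬝ᵥ v)) := by
  rw [gaussHess, abs_mul, abs_of_pos (Real.exp_pos _)]
  gcongr
  refine (abs_sub _ _).trans ?_
  rw [abs_mul (1 / 4 : ℝ), abs_mul (1 / 2 : ℝ), abs_of_pos (by norm_num : (0 : ℝ) < 1 / 4),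
    abs_of_pos (by norm_num : (0 : ℝ) < 1 / 2), abs_mul]
  have := mul_le_mul (hwX i) (hwX j) (abs_nonneg _) (by linarith)
  nlinarith [sq_nonneg X]

variable [DecidableEq ι]

theorem hasDerivAt_mulVec_line (N : Matrix ι ι ℝ) (v : ι → ℝ) (j k : ι) :
    HasDerivAt (fun s : ℝ => (N *ᵥ (v + s • Pi.single j 1)) k) (N k j) 0 := by
  have h : (fun s : ℝ => (N *ᵥ (v + s • Pi.single j 1)) k) = fun s => (N *ᵥ v) k + s * N k j := by
    ext s
    simp [Matrix.mulVec_add, Matrix.mulVec_smul]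
  rw [h]
  simpa using ((hasDerivAt_id (0 : ℝ)).mul_const (N k j)).const_add ((N *ᵥ v) k)

theorem hasDerivAt_gauss_line {N : Matrix ι ι ℝ} (hN : Nᵀ = N) (v : ι → ℝ) (j : ι) :
    HasDerivAt (fun s : ℝ => Real.exp (-(1 / 4) *
        ((N *ᵥ (v + s • Pi.single j 1)) ⬝ᵥ (v + s • Pi.single j 1))))
      (-(1 / 2) * (N *ᵥ v) j * Real.exp (-(1 / 4) * ((N *ᵥ v) ⬝ᵥ v))) 0 := by
  have hsym : N.col j ⬝ᵥ v = (N *ᵥ v) j := by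
    rw [Matrix.mulVec]
    congr 1
    ext k
    exact congrFun (congrFun hN j) k
  have h : (fun s : ℝ => (N *ᵥ (v + s • Pi.single j 1)) ⬝ᵥ (v + s • Pi.single j 1)) =
      fun s : ℝ => (N *ᵥ v) ⬝ᵥ v + s * (2 * (N *ᵥ v) j) + s * s * N j j := by
    ext s
    simp [Matrix.mulVec_add, Matrix.mulVec_smul, hsym]
    ring
  have h1 : HasDerivAt (fun s : ℝ => (N *ᵥ (v + s • Pi.single j 1)) ⬝ᵥ (v + s • Pi.single j 1))
      (2 * (N *ᵥ v) j) 0 := by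
    rw [h]
    have hid := hasDerivAt_id (0 : ℝ)
    simpa using ((hid.mul_const (2 * (N *ᵥ v) j)).const_add ((N *ᵥ v) ⬝ᵥ v)).fun_add
      ((hid.fun_mul hid).mul_const (N j j))
  have h2 := (h1.const_mul (-(1 / 4))).exp
  simp only [zero_smul, add_zero] at h2
  convert h2 using 1
  ring

theorem hasDerivAt_gauss_line_line {N : Matrix ι ι ℝ} (hN : Nᵀ = N) (v : ι → ℝ) (i j : ι) :
    HasDerivAt (fun s : ℝ => -(1 / 2) * (N *ᵥ (v + s • Pi.single i 1)) j * Real.exp (-(1 / 4) *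
        ((N *ᵥ (v + s • Pi.single i 1)) ⬝ᵥ (v + s • Pi.single i 1))))
      (gaussHess N i j v) 0 := by
  have h := ((hasDerivAt_mulVec_line N v i j).const_mul (-(1 / 2))).fun_mul
    (hasDerivAt_gauss_line hN v i)
  simp only [zero_smul, add_zero] at h
  refine h.congr_deriv ?_
  have : N j i = N i j := congrFun (congrFun hN i) j
  unfold gaussHess
  rw [this]
  ring

end Gauss

/-- Half of the exponential rate absorbs any fixed polynomial factor, by comparing S^m with one term
of the exponential series. -/
theorem exists_weight_pow_mul_exp_le {c : ℝ} (hc : 0 < c) (m : ℕ) : ∃ K : ℝ, 0 ≤ K ∧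
    ∀ S : ℝ, 1 ≤ S → S ^ m * Real.exp (-c * (S - 1)) ≤ K * Real.exp (-(c / 2) * (S - 1)) := by
  refine ⟨m.factorial / (c / 2) ^ m * Real.exp (c / 2), by positivity, fun S hS => ?_⟩
  have h1 := Real.pow_div_factorial_le_exp (c / 2 * S) (by positivity) m
  rw [div_le_iff₀ (by positivity), mul_pow] at h1
  have h2 : Real.exp (-c * (S - 1)) =
      Real.exp (c / 2) * (Real.exp (c / 2 * S))⁻¹ * Real.exp (-(c / 2) * (S - 1)) := by
    rw [← Real.exp_neg, ← Real.exp_add, ← Real.exp_add]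
    congr 1
    ring
  rw [h2, ← mul_assoc, ← mul_assoc]
  refine mul_le_mul_of_nonneg_right ?_ (Real.exp_pos _).le
  have h3 : S ^ m ≤ m.factorial / (c / 2) ^ m * Real.exp (c / 2 * S) := by
    rw [div_mul_eq_mul_div, le_div_iff₀ (by positivity)]
    linarith
  calc S ^ m * Real.exp (c / 2) * (Real.exp (c / 2 * S))⁻¹
      ≤ m.factorial / (c / 2) ^ m * Real.exp (c / 2 * S) * Real.exp (c / 2) *
        (Real.exp (c / 2 * S))⁻¹ := by gcongr
    _ = _ := by
      field_simp

theorem exists_bound_Icc {f : ℝ → ℝ} (hf : Continuous f) (T : ℝ) :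
    ∃ K : ℝ, 1 ≤ K ∧ ∀ t ∈ Set.Icc 0 T, |f t| ≤ K := by
  obtain ⟨c, hc⟩ := ((isCompact_Icc (a := 0) (b := T)).image hf.abs).bddAbove
  exact ⟨max c 1, le_max_right _ _, fun t ht => (hc ⟨t, ht, rfl⟩).trans (le_max_left _ _)⟩

theorem exists_bound_Icc_forall {ι : Type*} [Fintype ι] {f : ι → ℝ → ℝ} (hf : ∀ k, Continuous (f k))
    (T : ℝ) : ∃ K : ℝ, 1 ≤ K ∧ ∀ t ∈ Set.Icc 0 T, ∀ k, |f k t| ≤ K := by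
  obtain ⟨K, hK, h⟩ := exists_bound_Icc (f := fun t => ∑ k, |f k t|)
    (continuous_finsetSum _ fun k _ => (hf k).abs) T
  refine ⟨K, hK, fun t ht k => ?_⟩
  refine le_trans ?_ ((le_abs_self _).trans (h t ht))
  exact Finset.single_le_sum (f := fun k => |f k t|) (fun k _ => abs_nonneg _) (Finset.mem_univ k)

/-- Gaussian bounds for the normalised Hessian and for its derivative along curves. -/
theorem exists_gaussHess_bounds {A B : Matrix (Idx p) (Idx p) ℝ} (h : IsCanonicalPair p A B)
    (T : ℝ) : ∃ c K : ℝ, 0 < c ∧ 1 ≤ K ∧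
      (∀ t ∈ Set.Icc 0 T, ∀ i j v, |gaussHess (covMat A B t)⁻¹ i j v| ≤
        K * (weight v ^ 4 * Real.exp (-c * (weight v - 1)))) ∧
      (∀ (i j : Idx p) (τ : ℝ → ℝ) (τ' : ℝ) (v : ℝ → Idx p → ℝ) (v' : Idx p → ℝ) (s κ : ℝ),
        τ s ∈ Set.Icc 0 T → HasDerivAt τ τ' s → (∀ k, HasDerivAt (fun s => v s k) (v' k) s) →
        |τ'| ≤ κ → (∀ k, |v' k| ≤ weight (v s) * κ) →
        ∃ D, HasDerivAt (fun s => gaussHess (covMat A B (τ s))⁻¹ i j (v s)) D s ∧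
          |D| ≤ K * κ * (weight (v s) ^ 4 * Real.exp (-c * (weight (v s) - 1)))) := by
  obtain ⟨c, hc, hcl⟩ := exists_covMat_inv_lower h T
  obtain ⟨Λ₁, hΛ₁, hb₁⟩ := exists_bound_Icc_forall (ι := Idx p × Idx p)
    (f := fun k t => (covMat A B t)⁻¹ k.1 k.2) (fun k => (contDiff_covMat_inv h _ _).continuous) T
  obtain ⟨Λ₂, hΛ₂, hb₂⟩ := exists_bound_Icc_forall (ι := Idx p × Idx p)
    (f := fun k => deriv fun t => (covMat A B t)⁻¹ k.1 k.2)
    (fun k => (contDiff_covMat_inv h _ _).continuous_deriv le_rfl) T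
  set n : ℝ := ((Fintype.card (Idx p) : ℕ) : ℝ) with hn
  have hn0 : 0 ≤ n := by positivity
  set Λ := Λ₁ + Λ₂
  have hN : ∀ t ∈ Set.Icc 0 T, ∀ k l, |(covMat A B t)⁻¹ k l| ≤ Λ := fun t ht k l =>
    (hb₁ t ht (k, l)).trans (by simp only [Λ]; linarith)
  have hN' : ∀ t ∈ Set.Icc 0 T, ∀ k l, |deriv (fun t => (covMat A B t)⁻¹ k l) t| ≤ Λ :=
    fun t ht k l => (hb₂ t ht (k, l)).trans (by simp only [Λ]; linarith)
  have hΛ : 1 ≤ Λ := by simp only [Λ]; linarith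
  -- Chosen so that Θ times the weight serves as X in `hasDerivAt_gaussHess`; the 2n accounts for
  -- the two matrix-vector products in the derivative of N v.
  set Θ := (1 + 2 * n) * Λ
  have hΘ : 1 ≤ Θ := by simp only [Θ]; nlinarith
  have hnΛ : 0 ≤ n * Λ := by positivity
  have hexp : ∀ t ∈ Set.Icc 0 T, ∀ v : Idx p → ℝ,
      Real.exp (-(1 / 4) * (((covMat A B t)⁻¹ *ᵥ v) ⬝ᵥ v)) ≤
        Real.exp (-(c / 4) * (weight v - 1)) := by
    intro t ht v
    have := hcl t ht v
    refine Real.exp_le_exp.2 ?_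
    rw [weight]
    linarith
  have hw : ∀ t ∈ Set.Icc 0 T, ∀ v k, |((covMat A B t)⁻¹ *ᵥ v) k| ≤ n * Λ * weight v := by
    intro t ht v k
    have := abs_mulVec_le_mul (by linarith) (hN t ht) (abs_le_weight v) k
    rwa [← mul_assoc] at this
  refine ⟨c / 4, (n + 1) * Θ ^ 4, by positivity, ?_, ?_, ?_⟩
  · have := one_le_pow₀ hΘ (n := 4)
    nlinarith
  · intro t ht i j v
    have hW := one_le_weight v
    have h1 : 1 ≤ Θ * weight v := by nlinarith
    refine (abs_gaussHess_le h1 (fun k => ?_) ?_).trans ?_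
    · refine (hw t ht v k).trans ?_
      gcongr
      simp only [Θ]
      nlinarith
    · refine (hN t ht i j).trans ?_
      simp only [Θ]
      nlinarith
    · have h2 : (Θ * weight v) ^ 2 ≤ (n + 1) * (Θ * weight v) ^ 4 := by
        have := pow_le_pow_right₀ h1 (by norm_num : 2 ≤ 4)
        nlinarith [pow_nonneg (by linarith : 0 ≤ Θ * weight v) 4]
      calc (Θ * weight v) ^ 2 * Real.exp (-(1 / 4) * (((covMat A B t)⁻¹ *ᵥ v) ⬝ᵥ v))
          ≤ ((n + 1) * (Θ * weight v) ^ 4) * Real.exp (-(c / 4) * (weight v - 1)) := by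
            exact mul_le_mul h2 (hexp t ht v) (Real.exp_pos _).le (by positivity)
        _ = _ := by ring
  · intro i j τ τ' v v' s κ hτ hdτ hdv hτ' hv'
    have hκ : 0 ≤ κ := (abs_nonneg _).trans hτ'
    have hW := one_le_weight (v s)
    have hW0 := weight_pos (v s)
    have h1 : 1 ≤ Θ * weight (v s) := by nlinarith
    have hNd : ∀ k l, HasDerivAt (fun s => (covMat A B (τ s))⁻¹ k l)
        (deriv (fun t => (covMat A B t)⁻¹ k l) (τ s) * τ') s := fun k l =>
      HasDerivAt.comp s ((contDiff_covMat_inv h k l).differentiable (by simp) (τ s)).hasDerivAt hdτ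
    have hN'κ : ∀ k l, |deriv (fun t => (covMat A B t)⁻¹ k l) (τ s) * τ'| ≤ Λ * κ := by
      intro k l
      rw [abs_mul]
      exact mul_le_mul (hN' _ hτ k l) hτ' (abs_nonneg _) (by linarith)
    obtain ⟨D, hD, hDb⟩ := hasDerivAt_gaussHess
      (N' := Matrix.of fun k l => deriv (fun t => (covMat A B t)⁻¹ k l) (τ s) * τ')
      (N := fun s => (covMat A B (τ s))⁻¹) hNd hdv i j h1 hκ
      (fun k => (abs_le_weight _ k).trans (by nlinarith))
      (fun k => (hw _ hτ _ k).trans (by gcongr; simp only [Θ]; nlinarith))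
      ((hN _ hτ i j).trans (by simp only [Θ]; nlinarith))
      (fun k => (hv' k).trans (by gcongr; nlinarith))
      (fun k => by
        have a1 := abs_mulVec_le_mul (N := Matrix.of fun k l =>
          deriv (fun t => (covMat A B t)⁻¹ k l) (τ s) * τ') (by positivity) hN'κ
            (abs_le_weight (v s)) k
        have a2 := abs_mulVec_le_mul (by linarith) (hN _ hτ) hv' k
        refine (abs_add_le _ _).trans ((add_le_add a1 a2).trans ?_)
        have : n * (Λ * κ * weight (v s)) + n * (Λ * (weight (v s) * κ)) =
          (2 * n * Λ) * (weight (v s) * κ) := by ring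
        rw [← hn, this, mul_assoc Θ]
        gcongr
        simp only [Θ]
        nlinarith)
      ((hN'κ i j).trans (by
        gcongr
        simp only [Θ]
        nlinarith))
    refine ⟨D, hD, hDb.trans ?_⟩
    calc (n + 1) * (Θ * weight (v s)) ^ 4 * κ *
          Real.exp (-(1 / 4) * (((covMat A B (τ s))⁻¹ *ᵥ v s) ⬝ᵥ v s))
        ≤ (n + 1) * (Θ * weight (v s)) ^ 4 * κ *
          Real.exp (-(c / 4) * (weight (v s) - 1)) := by
            exact mul_le_mul_of_nonneg_left (hexp _ hτ _) (by positivity)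
      _ = _ := by ring

/-! ### The Hessian of the fundamental solution: size and regularity. -/

/-- The space variable rescaled to unit time. -/
def unitPt (z : Pt p) : Idx p → ℝ := fun k => z.1 k / √z.2 ^ deg k

/-- The time-dependent factor of the fundamental solution after rescaling. -/
def prefactor (A B : Matrix (Idx p) (Idx p) ℝ) (t : ℝ) : ℝ :=
  (4 * Real.pi) ^ (-(Fintype.card (Idx p) : ℝ) / 2) / √(covMat A B t).det *
    Real.exp (-(t * B.trace))

/-- The second derivative `∂ᵢ∂ⱼ` of the fundamental solution, for `i, j` in the first block. -/
def hessSol (A B : Matrix (Idx p) (Idx p) ℝ) (i j : Fin (p 0)) (z : Pt p) : ℝ :=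
  spaceDeriv ⟨0, i⟩ (spaceDeriv ⟨0, j⟩ (fundSol A B)) z

theorem contDiff_prefactor {A B : Matrix (Idx p) (Idx p) ℝ} (h : IsCanonicalPair p A B) :
    ContDiff ℝ 1 (prefactor A B) := by
  have hdet : ∀ t, (covMat A B t).det ≠ 0 := fun t => (covMat_posDef h t).det_pos.ne'
  refine ContDiff.mul (contDiff_const.div ?_ ?_) ?_
  · exact (contDiff_covMat_det A B).sqrt hdet
  · exact fun t => (Real.sqrt_pos.2 (covMat_posDef h t).det_pos).ne'
  · fun_prop

theorem det_dil (t : ℝ) : (dil p t).det = t ^ ∑ k : Idx p, (k.1 : ℕ) := by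
  rw [dil, Matrix.det_diagonal, Finset.prod_pow_eq_pow_sum]

theorem det_C {A B : Matrix (Idx p) (Idx p) ℝ} (h : IsCanonicalPair p A B) {t : ℝ} (ht : t ≠ 0) :
    (C A B t).det = t ^ Q p * (covMat A B t).det := by
  have hQ : Q p = Fintype.card (Idx p) + (∑ k : Idx p, (k.1 : ℕ) + ∑ k : Idx p, (k.1 : ℕ)) := by
    rw [← sum_deg]
    simp only [deg, Finset.sum_add_distrib, ← Finset.mul_sum, Finset.sum_const, smul_eq_mul,
      mul_one, Finset.card_univ]
    ring
  rw [C_eq_conj h ht, Matrix.det_smul, Matrix.det_mul, Matrix.det_mul, det_dil, hQ, pow_add,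
    pow_add]
  ring

theorem inv_C {A B : Matrix (Idx p) (Idx p) ℝ} (h : IsCanonicalPair p A B) {t : ℝ} (ht : t ≠ 0) :
    (C A B t)⁻¹ = t⁻¹ • (dil p t⁻¹ * (covMat A B t)⁻¹ * dil p t⁻¹) := by
  refine Matrix.inv_eq_right_inv ?_
  have hu : IsUnit (covMat A B t).det := (covMat_posDef h t).det_pos.ne'.isUnit
  rw [C_eq_conj h ht, Matrix.smul_mul, Matrix.mul_smul, smul_smul, mul_inv_cancel₀ ht, one_smul]
  calc dil p t * covMat A B t * dil p t * (dil p t⁻¹ * (covMat A B t)⁻¹ * dil p t⁻¹)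
      = dil p t * covMat A B t * (dil p t * dil p t⁻¹) * (covMat A B t)⁻¹ * dil p t⁻¹ := by
        simp only [Matrix.mul_assoc]
    _ = dil p t * (covMat A B t * (covMat A B t)⁻¹) * dil p t⁻¹ := by
        rw [dil_mul_inv ht, mul_one]; simp only [Matrix.mul_assoc]
    _ = 1 := by rw [Matrix.mul_nonsing_inv _ hu, mul_one, dil_mul_inv ht]

theorem inv_C_symm {A B : Matrix (Idx p) (Idx p) ℝ} (h : IsCanonicalPair p A B) {t : ℝ}
    (ht : t ≠ 0) : ((C A B t)⁻¹)ᵀ = (C A B t)⁻¹ := by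
  rw [inv_C h ht, Matrix.transpose_smul, Matrix.transpose_mul, Matrix.transpose_mul, dil_transpose,
    covMat_inv_symm h, Matrix.mul_assoc]

theorem inv_C_apply {A B : Matrix (Idx p) (Idx p) ℝ} (h : IsCanonicalPair p A B) {t : ℝ}
    (ht : 0 < t) (k l : Idx p) :
    (C A B t)⁻¹ k l = (covMat A B t)⁻¹ k l / (√t ^ deg k * √t ^ deg l) := by
  have hs : √t ≠ 0 := (Real.sqrt_pos.2 ht).ne'
  have hk : ∀ k : Idx p, √t ^ deg k = √t * t ^ (k.1 : ℕ) := fun k => by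
    rw [deg, pow_succ', pow_mul, Real.sq_sqrt ht.le]
  rw [inv_C h ht.ne', hk, hk, Matrix.smul_apply, dil, Matrix.mul_diagonal, Matrix.diagonal_mul,
    smul_eq_mul, inv_pow, inv_pow]
  have : √t * t ^ (k.1 : ℕ) * (√t * t ^ (l.1 : ℕ)) = t * t ^ (k.1 : ℕ) * t ^ (l.1 : ℕ) := by
    linear_combination (t ^ (k.1 : ℕ) * t ^ (l.1 : ℕ)) * Real.mul_self_sqrt ht.le
  rw [this]
  field_simp

theorem inv_C_mulVec {A B : Matrix (Idx p) (Idx p) ℝ} (h : IsCanonicalPair p A B) {z : Pt p}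
    (ht : 0 < z.2) (k : Idx p) :
    ((C A B z.2)⁻¹ *ᵥ z.1) k = ((covMat A B z.2)⁻¹ *ᵥ unitPt z) k / √z.2 ^ deg k := by
  simp only [Matrix.mulVec, dotProduct, inv_C_apply h ht, unitPt, Finset.sum_div]
  refine Finset.sum_congr rfl fun l _ => ?_
  have hs : √z.2 ≠ 0 := (Real.sqrt_pos.2 ht).ne'
  field_simp

theorem inv_C_quadratic {A B : Matrix (Idx p) (Idx p) ℝ} (h : IsCanonicalPair p A B) {z : Pt p}
    (ht : 0 < z.2) :
    ((C A B z.2)⁻¹ *ᵥ z.1) ⬝ᵥ z.1 = ((covMat A B z.2)⁻¹ *ᵥ unitPt z) ⬝ᵥ unitPt z := by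
  simp only [dotProduct, inv_C_mulVec h ht, unitPt]
  refine Finset.sum_congr rfl fun l _ => ?_
  rw [div_mul_eq_mul_div, mul_div_assoc]

theorem lineDeriv_eq_of_hasDerivAt {f : Pt p → ℝ} {z v : Pt p} {D : ℝ}
    (h : HasDerivAt (fun s : ℝ => f (z + s • v)) D 0) : lineDeriv ℝ f z v = D := h.deriv

/-- Space derivatives stay in one time slice, so this includes t = 0 even though γ is singular at
the origin. -/
theorem hessSol_of_nonpos (A B : Matrix (Idx p) (Idx p) ℝ) (i j : Fin (p 0)) {z : Pt p}
    (hz : z.2 ≤ 0) : hessSol A B i j z = 0 := by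
  have h1 : ∀ z : Pt p, z.2 ≤ 0 → spaceDeriv ⟨0, j⟩ (fundSol A B) z = 0 := by
    intro z hz
    refine lineDeriv_eq_of_hasDerivAt ?_
    have : (fun s : ℝ => fundSol A B (z + s • (Pi.single (⟨0, j⟩ : Idx p) 1, 0))) =
        fun _ => 0 := by
      ext s; simp [fundSol, hz]
    rw [this]
    exact hasDerivAt_const _ _
  refine lineDeriv_eq_of_hasDerivAt ?_
  have : (fun s : ℝ => spaceDeriv ⟨0, j⟩ (fundSol A B)
      (z + s • (Pi.single (⟨0, i⟩ : Idx p) 1, 0))) = fun _ => 0 := by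
    ext s; exact h1 _ (by simpa using hz)
  rw [this]
  exact hasDerivAt_const _ _

/-- The central formula: √(det C) contributes √t^Q and the two derivatives, in first-block
directions of degree 1, contribute √t². What remains is C¹ in t up to t = 0. -/
theorem hessSol_of_pos {A B : Matrix (Idx p) (Idx p) ℝ} (h : IsCanonicalPair p A B)
    (i j : Fin (p 0)) {z : Pt p} (hz : 0 < z.2) :
    hessSol A B i j z = prefactor A B z.2 * (√z.2 ^ (Q p + 2))⁻¹ *
      gaussHess (covMat A B z.2)⁻¹ ⟨0, i⟩ ⟨0, j⟩ (unitPt z) := by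
  set c : ℝ := (4 * Real.pi) ^ (-(Fintype.card (Idx p) : ℝ) / 2) / √(C A B z.2).det *
    Real.exp (-(z.2 * B.trace)) with hc
  have hsym := inv_C_symm h hz.ne'
  have hf : ∀ x : Idx p → ℝ, fundSol A B (x, z.2) =
      c * Real.exp (-(1 / 4) * (((C A B z.2)⁻¹ *ᵥ x) ⬝ᵥ x)) := by
    intro x
    rw [fundSol, if_neg (not_le.2 hz), hc, sub_eq_add_neg, Real.exp_add]
    ring
  have h1 : ∀ x : Idx p → ℝ, spaceDeriv ⟨0, j⟩ (fundSol A B) (x, z.2) =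
      c * (-(1 / 2) * ((C A B z.2)⁻¹ *ᵥ x) ⟨0, j⟩ *
        Real.exp (-(1 / 4) * (((C A B z.2)⁻¹ *ᵥ x) ⬝ᵥ x))) := by
    intro x
    refine lineDeriv_eq_of_hasDerivAt ?_
    have := (hasDerivAt_gauss_line hsym x ⟨0, j⟩).const_mul c
    simp only [Prod.smul_mk, smul_zero, Prod.mk_add_mk, add_zero, hf]
    exact this
  have h2 : hessSol A B i j z = c * gaussHess (C A B z.2)⁻¹ ⟨0, i⟩ ⟨0, j⟩ z.1 := by
    refine lineDeriv_eq_of_hasDerivAt ?_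
    have := (hasDerivAt_gauss_line_line hsym z.1 ⟨0, i⟩ ⟨0, j⟩).const_mul c
    have hz' : ∀ s : ℝ, z + s • ((Pi.single (⟨0, i⟩ : Idx p) 1 : Idx p → ℝ), (0 : ℝ)) =
        (z.1 + s • Pi.single (⟨0, i⟩ : Idx p) 1, z.2) := fun s => by ext1 <;> simp
    simp only [hz', h1]
    exact this
  have hs : √z.2 ≠ 0 := (Real.sqrt_pos.2 hz).ne'
  have hdet : √(C A B z.2).det = √z.2 ^ Q p * √(covMat A B z.2).det := by
    have hQ : z.2 ^ Q p = (√z.2 ^ Q p) ^ 2 := by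
      rw [← pow_mul, mul_comm, pow_mul, Real.sq_sqrt hz.le]
    rw [det_C h hz.ne', Real.sqrt_mul (by positivity), hQ, Real.sqrt_sq (by positivity)]
  have hdet0 : √(covMat A B z.2).det ≠ 0 := (Real.sqrt_pos.2 (covMat_posDef h _).det_pos).ne'
  rw [h2, hc, hdet, prefactor, gaussHess, gaussHess, inv_C_quadratic h hz, inv_C_mulVec h hz,
    inv_C_mulVec h hz, inv_C_apply h hz]
  simp only [deg, Fin.val_zero, mul_zero, zero_add, pow_one]
  rw [pow_add]
  field_simp

theorem hnorm_le_sqrt_mul_weight {z : Pt p} (hz : 0 < z.2) :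
    hnorm z ≤ (Fintype.card (Idx p) + 1) * (√z.2 * weight (unitPt z)) := by
  have hs : 0 < √z.2 := Real.sqrt_pos.2 hz
  have hW := one_le_weight (unitPt z)
  refine hnorm_le_of_le (by positivity) (fun k => ?_) ?_
  · have h1 : z.1 k = √z.2 ^ deg k * unitPt z k := by
      rw [unitPt]; field_simp
    rw [h1, abs_mul, abs_of_pos (by positivity), mul_pow]
    gcongr
    exact (abs_le_weight _ k).trans (le_self_pow₀ hW (deg_ne_zero k))
  · rw [abs_of_pos hz, mul_pow, Real.sq_sqrt hz.le]
    exact le_mul_of_one_le_right hz.le (one_le_pow₀ hW)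

theorem sqrt_le_hnorm {z : Pt p} (hz : 0 < z.2) : √z.2 ≤ hnorm z := by
  have := abs_snd_le_hnorm_sq z
  rw [abs_of_pos hz] at this
  exact Real.sqrt_le_iff.2 ⟨hnorm_nonneg z, this⟩

theorem hnorm_pos_of_pos {z : Pt p} (hz : 0 < z.2) : 0 < hnorm z :=
  (Real.sqrt_pos.2 hz).trans_le (sqrt_le_hnorm hz)

/-- By `hnorm_le_sqrt_mul_weight` each factor ‖z‖/√t costs one power of the weight, which the
Gaussian absorbs. -/
theorem exists_weight_mul_sqrt_inv_le {c : ℝ} (hc : 0 < c) (a b₀ : ℕ) : ∃ K : ℝ, 0 ≤ K ∧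
    ∀ z : Pt p, 0 < z.2 → ∀ b ≤ b₀,
      weight (unitPt z) ^ a * Real.exp (-c * (weight (unitPt z) - 1)) *
      (√z.2 ^ b)⁻¹ ≤ K / hnorm z ^ b := by
  obtain ⟨K, hK0, hK⟩ := exists_weight_pow_mul_exp_le hc (a + b₀)
  refine ⟨(Fintype.card (Idx p) + 1) ^ b₀ * K, by positivity, fun z hz b hb => ?_⟩
  have hs : 0 < √z.2 := Real.sqrt_pos.2 hz
  have hz0 := hnorm_pos_of_pos hz
  set W := weight (unitPt z) with hWdef
  have hW : 1 ≤ W := one_le_weight (unitPt z)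
  have hn : (1 : ℝ) ≤ Fintype.card (Idx p) + 1 := le_add_of_nonneg_left (by positivity)
  rw [le_div_iff₀ (by positivity)]
  have h1 : (√z.2 ^ b)⁻¹ * hnorm z ^ b ≤ (Fintype.card (Idx p) + 1) ^ b₀ * W ^ b₀ := by
    rw [inv_mul_le_iff₀ (by positivity)]
    calc hnorm z ^ b ≤ ((Fintype.card (Idx p) + 1) * (√z.2 * W)) ^ b :=
          pow_le_pow_left₀ hz0.le (hnorm_le_sqrt_mul_weight hz) b
      _ = √z.2 ^ b * ((Fintype.card (Idx p) + 1) ^ b * W ^ b) := by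
          rw [mul_pow, mul_pow]; ring
      _ ≤ _ := by gcongr
  calc W ^ a * Real.exp (-c * (W - 1)) * (√z.2 ^ b)⁻¹ * hnorm z ^ b
      = W ^ a * Real.exp (-c * (W - 1)) * ((√z.2 ^ b)⁻¹ * hnorm z ^ b) := by ring
    _ ≤ W ^ a * Real.exp (-c * (W - 1)) * ((Fintype.card (Idx p) + 1) ^ b₀ * W ^ b₀) := by gcongr
    _ = (Fintype.card (Idx p) + 1) ^ b₀ * (W ^ (a + b₀) * Real.exp (-c * (W - 1))) := by ring
    _ ≤ (Fintype.card (Idx p) + 1) ^ b₀ * K := by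
        gcongr
        refine (hK W hW).trans (mul_le_of_le_one_right hK0 (Real.exp_le_one_iff.2 ?_))
        nlinarith

/-- Size of the Hessian of the fundamental solution, with a gain for small times. -/
theorem exists_hessSol_bound {A B : Matrix (Idx p) (Idx p) ℝ} (h : IsCanonicalPair p A B)
    (L : ℝ) : ∃ K : ℝ, 0 ≤ K ∧ ∀ (i j : Fin (p 0)) (z : Pt p), 0 < z.2 → hnorm z ≤ L →
      |hessSol A B i j z| ≤ K * z.2 / hnorm z ^ (Q p + 4) := by
  obtain ⟨c, K₁, hc, hK₁, hb, -⟩ := exists_gaussHess_bounds h (L ^ 2)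
  obtain ⟨K₂, hK₂, hp⟩ := exists_bound_Icc (contDiff_prefactor h).continuous (L ^ 2)
  obtain ⟨K₃, hK₃, hw⟩ := exists_weight_mul_sqrt_inv_le (p := p) hc 4 (Q p + 4)
  refine ⟨K₂ * K₁ * K₃, by positivity, fun i j z hz hzL => ?_⟩
  have hs : 0 < √z.2 := Real.sqrt_pos.2 hz
  have ht : z.2 ∈ Set.Icc 0 (L ^ 2) :=
    ⟨hz.le, (le_abs_self _).trans ((abs_snd_le_hnorm_sq z).trans
      (pow_le_pow_left₀ (hnorm_nonneg z) hzL 2))⟩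
  -- One factor t is set aside before the negative powers of √t are exchanged for powers of ‖z‖; it
  -- is the gain used when a translation crosses t = 0.
  have hsq : (√z.2 ^ (Q p + 2))⁻¹ = z.2 * (√z.2 ^ (Q p + 4))⁻¹ := by
    have : √z.2 ^ (Q p + 4) = √z.2 ^ (Q p + 2) * z.2 := by
      rw [show Q p + 4 = Q p + 2 + 2 by ring, pow_add _ (Q p + 2), Real.sq_sqrt hz.le]
    rw [this]
    field_simp
  rw [hessSol_of_pos h i j hz, abs_mul, abs_mul,
    abs_of_pos (by positivity : 0 < (√z.2 ^ (Q p + 2))⁻¹),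
    hsq]
  calc |prefactor A B z.2| * (z.2 * (√z.2 ^ (Q p + 4))⁻¹) *
        |gaussHess (covMat A B z.2)⁻¹ ⟨0, i⟩ ⟨0, j⟩ (unitPt z)|
      ≤ K₂ * (z.2 * (√z.2 ^ (Q p + 4))⁻¹) * (K₁ * (weight (unitPt z) ^ 4 *
          Real.exp (-c * (weight (unitPt z) - 1)))) := by
        gcongr
        · exact hp _ ht
        · exact hb _ ht _ _ _
    _ = K₂ * K₁ * z.2 * (weight (unitPt z) ^ 4 *
          Real.exp (-c * (weight (unitPt z) - 1)) * (√z.2 ^ (Q p + 4))⁻¹) := by ring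
    _ ≤ K₂ * K₁ * z.2 * (K₃ / hnorm z ^ (Q p + 4)) := by
        gcongr
        exact hw z hz _ le_rfl
    _ = _ := by ring

/-- The bound includes z = 0: the quotient is then 0 by convention, and so is the Hessian because
its time is 0. -/
theorem exists_hessSol_bound' {A B : Matrix (Idx p) (Idx p) ℝ} (h : IsCanonicalPair p A B)
    (L : ℝ) : ∃ K : ℝ, 0 ≤ K ∧ ∀ (i j : Fin (p 0)) (z : Pt p), hnorm z ≤ L →
      |hessSol A B i j z| ≤ K / hnorm z ^ (Q p + 2) := by
  obtain ⟨K, hK0, hK⟩ := exists_hessSol_bound h L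
  refine ⟨K, hK0, fun i j z hz => ?_⟩
  have hz0 := hnorm_nonneg z
  rcases le_or_gt z.2 0 with ht | ht
  · rw [hessSol_of_nonpos A B i j ht, abs_zero]
    positivity
  · refine (hK i j z ht hz).trans ?_
    have hpos := hnorm_pos_of_pos ht
    rw [div_le_div_iff₀ (by positivity) (by positivity),
      show hnorm z ^ (Q p + 4) = hnorm z ^ 2 * hnorm z ^ (Q p + 2) by ring, mul_assoc]
    gcongr
    exact (le_abs_self _).trans (abs_snd_le_hnorm_sq z)

theorem hasDerivAt_inv_sqrt_pow {t t' : ℝ → ℝ} {s : ℝ} (ht : HasDerivAt t (t' s) s)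
    (hpos : 0 < t s) (m : ℕ) :
    HasDerivAt (fun s => (√(t s) ^ m)⁻¹) (-(m / 2) * (t' s / t s) * (√(t s) ^ m)⁻¹) s := by
  have hs : √(t s) ≠ 0 := (Real.sqrt_pos.2 hpos).ne'
  have h1 := ((ht.sqrt hpos.ne').fun_pow m).fun_inv (pow_ne_zero m hs)
  refine h1.congr_deriv ?_
  rcases m with _ | m
  · simp
  · have h2 : t s = √(t s) ^ 2 := (Real.sq_sqrt hpos.le).symm
    rw [show t' s / t s = t' s / √(t s) ^ 2 by rw [← h2], Nat.add_sub_cancel]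
    field_simp
    ring

/-- Lipschitz estimate for the Hessian of the fundamental solution along segments that stay in
`t > 0` and away from the origin. -/
theorem exists_hessSol_sub_bound {A B : Matrix (Idx p) (Idx p) ℝ} (h : IsCanonicalPair p A B)
    (L : ℝ) : ∃ K : ℝ, 0 ≤ K ∧ ∀ (i j : Fin (p 0)) (z Δ : Pt p) (ρ : ℝ), 0 < ρ →
      (∀ s ∈ Set.Icc (0 : ℝ) 1, 0 < (z + s • Δ).2 ∧ ρ ≤ hnorm (z + s • Δ) ∧
        hnorm (z + s • Δ) ≤ L) →
      |hessSol A B i j (z + Δ) - hessSol A B i j z| ≤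
        K * (|Δ.2| / ρ ^ (Q p + 4) + ∑ k, |Δ.1 k| / ρ ^ (Q p + 2 + deg k)) := by
  obtain ⟨c, K₁, hc, hK₁, hb, hbd⟩ := exists_gaussHess_bounds h (L ^ 2)
  obtain ⟨K₂, hK₂, hp⟩ := exists_bound_Icc (contDiff_prefactor h).continuous (L ^ 2)
  obtain ⟨K₄, hK₄, hp'⟩ := exists_bound_Icc
    ((contDiff_prefactor h).continuous_deriv le_rfl) (L ^ 2)
  obtain ⟨K₃, hK₃, hw⟩ := exists_weight_mul_sqrt_inv_le (p := p) hc 4 (Q p + 2 + (2 * r + 2))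
  set m := Q p + 2 with hm
  -- In units of κ, the derivative of v costs 1 for the motion of x and deg k / 2 ≤ r + 1 for the
  -- motion of √t; the derivative of t itself costs L².
  set a : ℝ := r + 2 + L ^ 2 with ha
  have ha0 : 0 ≤ a := by positivity
  -- The three terms of the product rule: the prefactor, the power of √t and the Gaussian Hessian.
  set K : ℝ := K₄ * L ^ 2 * K₁ + K₂ * m * K₁ + K₂ * (K₁ * a) with hK
  have hK0 : 0 ≤ K := by positivity
  refine ⟨K * K₃, by positivity, fun i j z Δ ρ hρ hseg => ?_⟩
  set t : ℝ → ℝ := fun s => z.2 + s * Δ.2 with htdef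
  have hdt : ∀ s, HasDerivAt t Δ.2 s := fun s =>
    (((hasDerivAt_id s).mul_const Δ.2).const_add z.2).congr_deriv (one_mul _)
  have key : ∀ s ∈ Set.Icc (0 : ℝ) 1, ∃ D, HasDerivAt (fun s => hessSol A B i j (z + s • Δ)) D s ∧
      |D| ≤ K * K₃ * (|Δ.2| / ρ ^ (m + 2) + ∑ k, |Δ.1 k| / ρ ^ (m + deg k)) := by
    intro s hs
    obtain ⟨hpos, hlow, hup⟩ := hseg s hs
    have hpos' : 0 < t s := by simpa [htdef] using hpos
    have htIcc : t s ∈ Set.Icc 0 (L ^ 2) := by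
      refine ⟨hpos'.le, ?_⟩
      have := (le_abs_self _).trans (abs_snd_le_hnorm_sq (z + s • Δ))
      refine le_trans (by simpa [htdef] using this)
        (pow_le_pow_left₀ (hnorm_nonneg _) hup 2)
    set σ := √(t s) with hσ
    have hσ0 : 0 < σ := Real.sqrt_pos.2 hpos'
    have hσ2 : σ ^ 2 = t s := Real.sq_sqrt hpos'.le
    set v : ℝ → Idx p → ℝ := fun s => unitPt (z + s • Δ) with hv
    have hveq : ∀ s k, v s k = (z.1 k + s * Δ.1 k) * (√(t s) ^ deg k)⁻¹ := fun s k => by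
      simp [hv, unitPt, htdef, div_eq_mul_inv]
    set w := weight (v s) with hwdef
    have hw1 : 1 ≤ w := one_le_weight _
    -- The relative speed of the segment, each coordinate being measured in its own power of √t.
    set κ : ℝ := |Δ.2| / t s + ∑ k, |Δ.1 k| / σ ^ deg k with hκ
    have hκ1 : |Δ.2| / t s ≤ κ := le_add_of_nonneg_right (by positivity)
    have hκ0 : 0 ≤ κ := le_trans (by positivity) hκ1
    have hκk : ∀ k, |Δ.1 k| / σ ^ deg k ≤ κ := fun k => by
      have := Finset.single_le_sum (f := fun k => |Δ.1 k| / σ ^ deg k)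
        (fun k _ => by positivity) (Finset.mem_univ k)
      have h2 : 0 ≤ |Δ.2| / t s := by positivity
      simp only [hκ]
      linarith
    have hΔ2 : |Δ.2| ≤ L ^ 2 * κ := by
      rw [div_le_iff₀ hpos'] at hκ1
      rw [mul_comm]
      exact hκ1.trans (by gcongr; exact htIcc.2)
    set v' : Idx p → ℝ := fun k => Δ.1 k * (σ ^ deg k)⁻¹ +
      (z.1 k + s * Δ.1 k) * (-(deg k / 2) * (Δ.2 / t s) * (σ ^ deg k)⁻¹) with hv'
    have hdv : ∀ k, HasDerivAt (fun s => v s k) (v' k) s := fun k => by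
      have h1 : HasDerivAt (fun s => z.1 k + s * Δ.1 k) (Δ.1 k) s := by
        simpa using ((hasDerivAt_id s).mul_const (Δ.1 k)).const_add (z.1 k)
      simp only [hveq]
      exact h1.fun_mul (hasDerivAt_inv_sqrt_pow (t' := fun _ => Δ.2) (hdt s) hpos' (deg k))
    have hv'b : ∀ k, |v' k| ≤ w * (a * κ) := fun k => by
      have h1 : v' k = Δ.1 k / σ ^ deg k - deg k / 2 * v s k * (Δ.2 / t s) := by
        rw [hv', hveq]
        ring
      have h2 : |(deg k / 2 * v s k * (Δ.2 / t s) : ℝ)| ≤ (r + 1) * w * κ := by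
        rw [abs_mul, abs_mul, abs_div Δ.2, abs_of_pos hpos',
          abs_of_nonneg (by positivity : (0 : ℝ) ≤ deg k / 2)]
        gcongr
        · have : ((deg k : ℕ) : ℝ) ≤ ((2 * r + 1 : ℕ) : ℝ) := by exact_mod_cast deg_le k
          push_cast at this
          linarith
        · exact abs_le_weight _ k
      rw [h1]
      refine (abs_sub _ _).trans ?_
      have h3 : |Δ.1 k / σ ^ deg k| ≤ w * κ := by
        rw [abs_div, abs_of_pos (by positivity : 0 < σ ^ deg k)]
        exact (hκk k).trans (le_mul_of_one_le_left hκ0 hw1)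
      have h4 : w * (a * κ) = w * κ + (r + 1) * w * κ + L ^ 2 * w * κ := by
        rw [ha]; ring
      have h5 : 0 ≤ L ^ 2 * w * κ := by positivity
      linarith
    obtain ⟨D, hD, hDb⟩ := hbd ⟨0, i⟩ ⟨0, j⟩ t Δ.2 v v' s (a * κ) htIcc (hdt s) hdv
      (hΔ2.trans (by
        refine mul_le_mul_of_nonneg_right ?_ hκ0
        rw [ha]
        have : (0 : ℝ) ≤ r := by positivity
        linarith)) hv'b
    set e := w ^ 4 * Real.exp (-c * (w - 1)) with he
    have he0 : 0 ≤ e := by positivity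
    have hdp : HasDerivAt (fun s => prefactor A B (t s)) (deriv (prefactor A B) (t s) * Δ.2) s :=
      HasDerivAt.comp s ((contDiff_prefactor h).differentiable (by simp) (t s)).hasDerivAt (hdt s)
    have hds := hasDerivAt_inv_sqrt_pow (t' := fun _ => Δ.2) (hdt s) hpos' m
    have hdF := (hdp.fun_mul hds).fun_mul hD
    set g := gaussHess (covMat A B (t s))⁻¹ ⟨0, i⟩ ⟨0, j⟩ (v s) with hg
    have hgb : |g| ≤ K₁ * e := hb _ htIcc _ _ _
    refine ⟨_, hdF.congr_of_eventuallyEq ?_, ?_⟩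
    · have : ∀ᶠ s' in 𝓝 s, 0 < t s' := (hdt s).continuousAt.eventually (lt_mem_nhds hpos')
      filter_upwards [this] with s' hs'
      have h1 : (z + s' • Δ).2 = t s' := by simp [htdef]
      rw [hessSol_of_pos h i j (by rw [h1]; exact hs'), h1]
    · have hσm : 0 < (σ ^ m)⁻¹ := by positivity
      have b1 : |deriv (prefactor A B) (t s) * Δ.2 * (σ ^ m)⁻¹ * g| ≤
          K₄ * L ^ 2 * K₁ * (κ * (σ ^ m)⁻¹ * e) := by
        rw [abs_mul, abs_mul, abs_mul, abs_of_pos hσm]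
        calc |deriv (prefactor A B) (t s)| * |Δ.2| * (σ ^ m)⁻¹ * |g|
            ≤ K₄ * (L ^ 2 * κ) * (σ ^ m)⁻¹ * (K₁ * e) := by
              gcongr
              exact hp' _ htIcc
          _ = _ := by ring
      have b2 : |prefactor A B (t s) * (-(m / 2) * (Δ.2 / t s) * (σ ^ m)⁻¹) * g| ≤
          K₂ * m * K₁ * (κ * (σ ^ m)⁻¹ * e) := by
        rw [abs_mul, abs_mul, abs_mul, abs_mul, abs_of_pos hσm, abs_neg, abs_div Δ.2,
          abs_of_pos hpos', abs_of_nonneg (by positivity : (0 : ℝ) ≤ m / 2)]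
        calc |prefactor A B (t s)| * (m / 2 * (|Δ.2| / t s) * (σ ^ m)⁻¹) * |g|
            ≤ K₂ * (m * κ * (σ ^ m)⁻¹) * (K₁ * e) := by
              gcongr
              · exact hp _ htIcc
              · linarith [(by positivity : (0 : ℝ) ≤ m)]
          _ = _ := by ring
      have b3 : |prefactor A B (t s) * (σ ^ m)⁻¹ * D| ≤
          K₂ * (K₁ * a) * (κ * (σ ^ m)⁻¹ * e) := by
        rw [abs_mul, abs_mul, abs_of_pos hσm]
        calc |prefactor A B (t s)| * (σ ^ m)⁻¹ * |D|
            ≤ K₂ * (σ ^ m)⁻¹ * (K₁ * (a * κ) * e) := by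
              gcongr
              exact hp _ htIcc
          _ = _ := by ring
      -- Each summand of κ raises the negative power of √t by its own degree (2 for time). All these
      -- powers are at most m + 2r + 2, the range for which K₃ was taken, and are exchanged for
      -- powers of ρ.
      have b4 : κ * (σ ^ m)⁻¹ * e ≤
          K₃ * (|Δ.2| / ρ ^ (m + 2) + ∑ k, |Δ.1 k| / ρ ^ (m + deg k)) := by
        have c1 : ∀ b ≤ m + (2 * r + 2), e * (σ ^ b)⁻¹ ≤ K₃ / ρ ^ b := by
          intro b hbm
          have := hw (z + s • Δ) hpos b hbm
          have h1 : (z + s • Δ).2 = t s := by simp [htdef]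
          rw [h1] at this
          refine this.trans ?_
          gcongr
        have c2 : κ * (σ ^ m)⁻¹ * e = |Δ.2| * (e * (σ ^ (m + 2))⁻¹) +
            ∑ k, |Δ.1 k| * (e * (σ ^ (m + deg k))⁻¹) := by
          simp only [hκ, add_mul, Finset.sum_mul]
          congr 1
          · rw [← hσ2, pow_add σ m, mul_inv]
            ring
          · refine Finset.sum_congr rfl fun k _ => ?_
            rw [pow_add σ m, mul_inv]
            ring
        rw [c2, mul_add, Finset.mul_sum]
        refine add_le_add ?_ (Finset.sum_le_sum fun k _ => ?_)
        · calc |Δ.2| * (e * (σ ^ (m + 2))⁻¹) ≤ |Δ.2| * (K₃ / ρ ^ (m + 2)) := by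
                gcongr; exact c1 _ (by omega)
            _ = _ := by ring
        · calc |Δ.1 k| * (e * (σ ^ (m + deg k))⁻¹) ≤ |Δ.1 k| * (K₃ / ρ ^ (m + deg k)) := by
                gcongr; exact c1 _ (by have := deg_le k; omega)
            _ = _ := by ring
      rw [add_mul]
      refine (abs_add_le _ _).trans ((add_le_add (abs_add_le _ _) le_rfl).trans ?_)
      refine (add_le_add (add_le_add b1 b2) b3).trans ?_
      rw [← add_mul, ← add_mul, mul_assoc K]
      exact mul_le_mul_of_nonneg_left b4 hK0
  choose! D hD hDb using key
  have := (convex_Icc (0 : ℝ) 1).norm_image_sub_le_of_norm_hasDerivWithin_le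
    (f := fun s => hessSol A B i j (z + s • Δ)) (f' := D)
    (fun s hs => (hD s hs).hasDerivWithinAt) hDb
    (Set.left_mem_Icc.2 zero_le_one) (Set.right_mem_Icc.2 zero_le_one)
  simpa [Real.norm_eq_abs] using this

/-- Regularity of the Hessian of the fundamental solution under right translations. -/
theorem exists_hessSol_comp_bound {A B : Matrix (Idx p) (Idx p) ℝ} (h : IsCanonicalPair p A B)
    (L : ℝ) : ∃ ε K : ℝ, 0 < ε ∧ ε ≤ 1 ∧ 0 ≤ K ∧ ∀ (i j : Fin (p 0)) (u w : Pt p), hnorm u ≤ L →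
      0 < hnorm u → hnorm w ≤ ε * hnorm u →
      |hessSol A B i j (comp B u w) - hessSol A B i j u| ≤ K * hnorm w / hnorm u ^ (Q p + 3) := by
  obtain ⟨ε, hε0, hε1, hseg⟩ := exists_hnorm_segment h L
  obtain ⟨c, hc1, hc⟩ := exists_comp_sub_bound h L
  obtain ⟨K₁, hK₁, hb₁⟩ := exists_hessSol_bound h (2 * L)
  obtain ⟨K₂, hK₂, hb₂⟩ := exists_hessSol_sub_bound h (2 * L)
  set K : ℝ := K₁ * 2 ^ (Q p + 4) +
    K₂ * (2 ^ (Q p + 4) + Fintype.card (Idx p) * (c * 2 ^ (Q p + 2 + (2 * r + 1))))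
  refine ⟨ε, K, hε0, hε1, by positivity, fun i j u w hu hu0 hw => ?_⟩
  have hw0 := hnorm_nonneg w
  have hwu : hnorm w ≤ hnorm u := hw.trans (mul_le_of_le_one_left hu0.le hε1)
  have hcomp : u + (1 : ℝ) • (comp B u w - u) = comp B u w := by simp
  have hs1 := hseg u w hu hw 1 (Set.right_mem_Icc.2 zero_le_one)
  rw [hcomp] at hs1
  have hw2 : |w.2| ≤ hnorm w * hnorm u :=
    (abs_snd_le_hnorm_sq w).trans (by rw [pow_two]; gcongr)
  have ht : (comp B u w).2 = u.2 + w.2 := rfl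
  have hρ : ∀ m : ℕ, ∀ x : ℝ, x / (hnorm u / 2) ^ m = 2 ^ m * (x / hnorm u ^ m) := by
    intro m x
    rw [div_pow]
    field_simp
  have hpow : hnorm w * hnorm u / hnorm u ^ (Q p + 4) = hnorm w / hnorm u ^ (Q p + 3) := by
    rw [show Q p + 4 = Q p + 3 + 1 by ring, pow_succ]
    field_simp
  have hq0 : 0 ≤ hnorm w / hnorm u ^ (Q p + 3) := by positivity
  have hsmall : K₁ * 2 ^ (Q p + 4) * (hnorm w / hnorm u ^ (Q p + 3)) ≤
      K * hnorm w / hnorm u ^ (Q p + 3) := by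
    rw [mul_div_assoc]
    gcongr
    exact le_add_of_nonneg_right (by positivity)
  -- If exactly one of the two times is positive, it is at most |w.2| ≤ ‖w‖ ‖u‖, and the factor t in
  -- `exists_hessSol_bound` already gives the estimate. If both are positive, so are all times on
  -- the segment.
  rcases le_or_gt u.2 0 with htu | htu <;> rcases le_or_gt (comp B u w).2 0 with htw | htw
  · rw [hessSol_of_nonpos A B i j htu, hessSol_of_nonpos A B i j htw]
    simp only [sub_zero, abs_zero]
    positivity
  · rw [hessSol_of_nonpos A B i j htu, sub_zero]
    refine le_trans ?_ hsmall
    have h1 := hb₁ i j _ htw (hs1.2.trans (by linarith))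
    have h2 : (comp B u w).2 ≤ hnorm w * hnorm u := by
      rw [ht]; linarith [le_abs_self w.2]
    calc |hessSol A B i j (comp B u w)|
        ≤ K₁ * (comp B u w).2 / hnorm (comp B u w) ^ (Q p + 4) := h1
      _ ≤ K₁ * (hnorm w * hnorm u) / (hnorm u / 2) ^ (Q p + 4) := by
          gcongr
          exact hs1.1
      _ = _ := by rw [hρ, mul_div_assoc, hpow]; ring
  · rw [hessSol_of_nonpos A B i j htw, zero_sub, abs_neg]
    refine le_trans ?_ hsmall
    have h1 := hb₁ i j _ htu (by linarith)
    have h2 : u.2 ≤ hnorm w * hnorm u := by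
      rw [ht] at htw; linarith [neg_abs_le w.2]
    calc |hessSol A B i j u| ≤ K₁ * u.2 / hnorm u ^ (Q p + 4) := h1
      _ ≤ K₁ * (hnorm w * hnorm u) / hnorm u ^ (Q p + 4) := by gcongr
      _ = K₁ * 1 * (hnorm w / hnorm u ^ (Q p + 3)) := by rw [mul_div_assoc, hpow]; ring
      _ ≤ _ := by
          gcongr
          exact one_le_pow₀ one_le_two
  · have h1 := hb₂ i j u (comp B u w - u) (hnorm u / 2) (by positivity) (by
      intro s hs
      obtain ⟨ha, hb⟩ := hseg u w hu hw s hs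
      refine ⟨?_, ha, hb.trans (by linarith)⟩
      have : (u + s • (comp B u w - u)).2 = (1 - s) * u.2 + s * (comp B u w).2 := by
        simp only [Prod.snd_add, Prod.smul_snd, Prod.snd_sub, smul_eq_mul]
        ring
      rw [this]
      rcases eq_or_lt_of_le hs.1 with h0 | h0
      · rw [← h0]; simpa using htu
      · have := mul_pos h0 htw
        have := mul_nonneg (sub_nonneg.2 hs.2) htu.le
        linarith)
    rw [add_sub_cancel] at h1
    refine h1.trans ?_
    have h2 : |(comp B u w - u).2| / (hnorm u / 2) ^ (Q p + 4) ≤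
        2 ^ (Q p + 4) * (hnorm w / hnorm u ^ (Q p + 3)) := by
      rw [hρ, ← hpow]
      gcongr
      simpa [ht] using hw2
    have h3 : ∑ k, |(comp B u w - u).1 k| / (hnorm u / 2) ^ (Q p + 2 + deg k) ≤
        Fintype.card (Idx p) * (c * 2 ^ (Q p + 2 + (2 * r + 1)) *
          (hnorm w / hnorm u ^ (Q p + 3))) := by
      refine sum_le_of_forall_le fun k => ?_
      calc |(comp B u w - u).1 k| / (hnorm u / 2) ^ (Q p + 2 + deg k)
          ≤ c * (hnorm w * hnorm u ^ (2 * (k.1 : ℕ))) / (hnorm u / 2) ^ (Q p + 2 + deg k) := by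
            gcongr
            exact hc u w hu hwu k
        _ = c * 2 ^ (Q p + 2 + deg k) * (hnorm w / hnorm u ^ (Q p + 3)) := by
            rw [hρ, show Q p + 2 + deg k = Q p + 3 + 2 * (k.1 : ℕ) by rw [deg]; ring,
              pow_add (hnorm u)]
            field_simp
        _ ≤ _ := by
            gcongr
            · exact one_le_two
            · exact deg_le k
    calc K₂ * (|(comp B u w - u).2| / (hnorm u / 2) ^ (Q p + 4) +
          ∑ k, |(comp B u w - u).1 k| / (hnorm u / 2) ^ (Q p + 2 + deg k))
        ≤ K₂ * (2 ^ (Q p + 4) * (hnorm w / hnorm u ^ (Q p + 3)) +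
          Fintype.card (Idx p) * (c * 2 ^ (Q p + 2 + (2 * r + 1)) *
          (hnorm w / hnorm u ^ (Q p + 3)))) := by gcongr
      _ = K₂ * (2 ^ (Q p + 4) + Fintype.card (Idx p) * (c * 2 ^ (Q p + 2 + (2 * r + 1)))) *
          (hnorm w / hnorm u ^ (Q p + 3)) := by ring
      _ ≤ K * (hnorm w / hnorm u ^ (Q p + 3)) := by
          gcongr
          exact le_add_of_nonneg_left (by positivity)
      _ = _ := by rw [mul_div_assoc]

/-! ### Growth and Hölder estimates for the kernels. -/

theorem exists_cutoff_bound {ρ₀ : ℝ} {η : Pt p → ℝ} (hη : IsCutoff ρ₀ η) :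
    ∃ K : ℝ, 0 ≤ K ∧ ∀ z, |η z| ≤ K := by
  obtain ⟨K, hK⟩ := hη.compactSupport.exists_bound_of_continuous hη.smooth.continuous
  exact ⟨max K 0, le_max_right _ _, fun z => (hK z).trans (le_max_left _ _)⟩

theorem k₀_eq (A B : Matrix (Idx p) (Idx p) ℝ) (η : Pt p → ℝ) (i j : Fin (p 0)) (z : Pt p) :
    k₀ A B η i j z = η z * hessSol A B i j z := rfl

theorem exists_k₀_bound {A B : Matrix (Idx p) (Idx p) ℝ} (h : IsCanonicalPair p A B) {ρ₀ : ℝ}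
    {η : Pt p → ℝ} (hη : IsCutoff ρ₀ η) : ∃ K : ℝ, 0 ≤ K ∧ ∀ (i j : Fin (p 0)) (z : Pt p),
      |k₀ A B η i j z| ≤ K / hnorm z ^ (Q p + 2) := by
  obtain ⟨K₁, hK₁, hb₁⟩ := exists_cutoff_bound hη
  obtain ⟨K₂, hK₂, hb₂⟩ := exists_hessSol_bound' h ρ₀
  refine ⟨K₁ * K₂, by positivity, fun i j z => ?_⟩
  have hz := hnorm_nonneg z
  rw [k₀_eq]
  rcases le_or_gt ρ₀ (hnorm z) with hle | hlt
  · rw [hη.eq_zero z hle, zero_mul, abs_zero]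
    positivity
  · rw [abs_mul, mul_div_assoc]
    exact mul_le_mul (hb₁ z) (hb₂ i j z hlt.le) (abs_nonneg _) hK₁

/-- The cutoff is Lipschitz for the Euclidean norm, and on bounded sets the Euclidean displacement
from u to u ∘ w is O(‖w‖). The resulting term is less singular by one power of ‖u‖, which is
bounded. -/
theorem exists_k₀_comp_bound {A B : Matrix (Idx p) (Idx p) ℝ} (h : IsCanonicalPair p A B) {ρ₀ : ℝ}
    {η : Pt p → ℝ} (hη : IsCutoff ρ₀ η) (L : ℝ) : ∃ ε K : ℝ, 0 < ε ∧ ε ≤ 1 ∧ 0 ≤ K ∧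
      ∀ (i j : Fin (p 0)) (u w : Pt p), hnorm u ≤ L → 0 < hnorm u → hnorm w ≤ ε * hnorm u →
      |k₀ A B η i j (comp B u w) - k₀ A B η i j u| ≤ K * hnorm w / hnorm u ^ (Q p + 3) := by
  obtain ⟨K₁, hK₁, hb₁⟩ := exists_cutoff_bound hη
  obtain ⟨ε, K₂, hε0, hε1, hK₂, hb₂⟩ := exists_hessSol_comp_bound h L
  obtain ⟨K₃, hK₃, hb₃⟩ := exists_hessSol_bound' h L
  obtain ⟨c, hc1, hc⟩ := exists_comp_sub_bound h L
  obtain ⟨Λ, hΛ⟩ := ContDiff.lipschitzWith_of_hasCompactSupport hη.compactSupport hη.smooth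
    (by simp)
  set L' := max L 1
  have hL' : 1 ≤ L' := le_max_right _ _
  refine ⟨ε, K₁ * K₂ + Λ * (c * L' ^ (2 * r + 1)) * (K₃ * L'), hε0, hε1, by positivity,
    fun i j u w hu hu0 hw => ?_⟩
  have hw0 := hnorm_nonneg w
  have hwu : hnorm w ≤ hnorm u := hw.trans (mul_le_of_le_one_left hu0.le hε1)
  have huL : hnorm u ≤ L' := hu.trans (le_max_left _ _)
  have h1 : |η (comp B u w) - η u| ≤ Λ * (c * L' ^ (2 * r + 1) * hnorm w) := by
    have h2 := hΛ.dist_le_mul (comp B u w) u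
    rw [Real.dist_eq, dist_eq_norm] at h2
    refine h2.trans ?_
    gcongr
    have h3 : ∀ m ≤ 2 * r + 1, ∀ x : ℝ, x ≤ c * (hnorm w * hnorm u ^ m) →
        x ≤ c * L' ^ (2 * r + 1) * hnorm w := by
      intro m hm x hx
      refine hx.trans ?_
      rw [mul_assoc]
      gcongr ?_ * ?_
      rw [mul_comm]
      gcongr
      exact (pow_le_pow_left₀ hu0.le huL m).trans (pow_le_pow_right₀ hL' hm)
    refine norm_prod_le_iff.2 ⟨(pi_norm_le_iff_of_nonneg (by positivity)).2 fun k => ?_, ?_⟩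
    · exact h3 _ (by have := k.1.2; omega) _ (hc u w hu hwu k)
    · refine h3 1 (by omega) _ ?_
      have h4 : ‖(comp B u w - u).2‖ ≤ hnorm w * hnorm u ^ 1 := by
        have : (comp B u w - u).2 = w.2 := by simp [comp]
        rw [this, Real.norm_eq_abs, pow_one]
        exact (abs_snd_le_hnorm_sq w).trans (by rw [pow_two]; gcongr)
      exact h4.trans (le_mul_of_one_le_left (by positivity) hc1)
  have h2 : k₀ A B η i j (comp B u w) - k₀ A B η i j u =
      η (comp B u w) * (hessSol A B i j (comp B u w) - hessSol A B i j u) +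
        (η (comp B u w) - η u) * hessSol A B i j u := by
    rw [k₀_eq, k₀_eq]; ring
  have h3 : |hessSol A B i j u| ≤ K₃ * L' / hnorm u ^ (Q p + 3) := by
    refine (hb₃ i j u hu).trans ?_
    rw [div_le_div_iff₀ (by positivity) (by positivity), mul_assoc,
      show hnorm u ^ (Q p + 3) = hnorm u * hnorm u ^ (Q p + 2) by ring]
    gcongr
  rw [h2]
  refine (abs_add_le _ _).trans ?_
  rw [abs_mul, abs_mul]
  calc |η (comp B u w)| * |hessSol A B i j (comp B u w) - hessSol A B i j u| +
        |η (comp B u w) - η u| * |hessSol A B i j u|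
      ≤ K₁ * (K₂ * hnorm w / hnorm u ^ (Q p + 3)) + (Λ * (c * L' ^ (2 * r + 1) * hnorm w)) *
        (K₃ * L' / hnorm u ^ (Q p + 3)) := by
        gcongr
        · exact hb₁ _
        · exact hb₂ i j u w hu hu0 hw
    _ = _ := by ring

theorem exists_d_comm_bound {A B : Matrix (Idx p) (Idx p) ℝ} (h : IsCanonicalPair p A B) (L : ℝ) :
    ∃ K : ℝ, 1 ≤ K ∧ ∀ x y : Pt p, d B x y ≤ L → d B y x ≤ K * d B x y := by
  obtain ⟨K, hK, hb⟩ := exists_hnorm_inv_le h L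
  refine ⟨K, hK, fun x y hxy => ?_⟩
  have := hb _ hxy
  rwa [inv_inv_comp] at this

/-- The quasi-symmetry and quasi-triangle constants are only local; radii at most 1 make them
uniform in the centre. -/
theorem exists_d_ball_bound {A B : Matrix (Idx p) (Idx p) ℝ} (h : IsCanonicalPair p A B) :
    ∃ L : ℝ, 1 ≤ L ∧ ∀ (z₀ x y : Pt p) (R : ℝ), R ≤ 1 → x ∈ ball B z₀ R → y ∈ ball B z₀ R →
      d B x y ≤ L := by
  obtain ⟨K₁, hK₁, hb₁⟩ := exists_d_comm_bound h 1
  obtain ⟨K₂, hK₂, hb₂⟩ := exists_hnorm_comp_le h K₁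
  refine ⟨K₂ * (1 + K₁), by nlinarith, fun z₀ x y R hR hx hy => ?_⟩
  have hx' : d B z₀ x ≤ 1 := (le_of_lt hx).trans hR
  have hy' : d B z₀ y ≤ 1 := (le_of_lt hy).trans hR
  have hxr : d B x z₀ ≤ K₁ :=
    (hb₁ _ _ hx').trans (mul_le_of_le_one_right (by linarith) hx')
  rw [d, inv_comp_trans B x y z₀]
  refine (hb₂ _ _ (hy'.trans hK₁) hxr).trans ?_
  gcongr
  · exact hy'
  · exact hxr

/-- The pointwise content of `holderNorm B α f ≤ K`. -/
theorem holderNorm_le {B : Matrix (Idx p) (Idx p) ℝ} {α : ℝ} {f : Pt p → ℝ} {K : ℝ≥0}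
    (hf : holderNorm B α f ≤ K) :
    (∀ x, |f x| ≤ K) ∧ ∀ x y, |f x - f y| ≤ K * d B x y ^ α := by
  have h1 : ∀ a : ℝ, ENNReal.ofReal a ≤ K → a ≤ K := fun a ha => by
    rw [← ENNReal.ofReal_coe_nnreal] at ha
    exact (ENNReal.ofReal_le_ofReal_iff K.2).1 ha
  constructor
  · intro x
    refine h1 _ (le_trans ?_ (le_self_add.trans hf))
    exact le_iSup (fun x => ENNReal.ofReal |f x|) x
  · intro x y
    rcases eq_or_ne x y with rfl | hxy
    · simp only [sub_self, abs_zero]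
      exact mul_nonneg K.2 (Real.rpow_nonneg (d_nonneg _ _ _) _)
    · have hd : 0 < d B x y :=
        lt_of_le_of_ne (d_nonneg _ _ _) fun h0 => hxy (eq_of_d_eq_zero h0.symm)
      rw [← div_le_iff₀ (Real.rpow_pos_of_pos hd α)]
      refine h1 _ (le_trans ?_ (le_add_self.trans hf))
      exact le_iSup_of_le x (le_iSup_of_le y (le_iSup_of_le hxy le_rfl))

theorem exists_kernel_growth {A B : Matrix (Idx p) (Idx p) ℝ} (h : IsCanonicalPair p A B) {ρ₀ : ℝ}
    {η : Pt p → ℝ} (hη : IsCutoff ρ₀ η) {K : ℝ} (hK : 0 ≤ K) : ∃ c₀ : ℝ, 0 ≤ c₀ ∧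
      ∀ (i j : Fin (p 0)) (a b : Pt p → ℝ), (∀ x, |a x| ≤ K) → (∀ x, |b x| ≤ K) →
        ∀ x y, |kernel A B η i j a b x y| ≤ c₀ / d B x y ^ (Q p + 2) := by
  obtain ⟨K₁, hK₁, hb⟩ := exists_k₀_bound h hη
  refine ⟨K * K₁ * K, by positivity, fun i j a b ha hb' x y => ?_⟩
  rw [kernel, abs_mul, abs_mul]
  calc |a x| * |k₀ A B η i j (comp B (inv B y) x)| * |b y|
      ≤ K * (K₁ / d B x y ^ (Q p + 2)) * K := by
        gcongr
        · exact mul_nonneg hK (div_nonneg hK₁ (pow_nonneg (d_nonneg _ _ _) _))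
        · exact ha x
        · exact hb i j _
        · exact hb' y
    _ = _ := by ring

/-- Since δ/D ≤ 1, its first power is at most its α-th. The restriction α ≤ 1 enters the Hölder
estimate here. -/
theorem div_pow_succ_le_rpow_div {δ D α : ℝ} (hδ : 0 ≤ δ) (hδD : δ ≤ D) (hD : 0 < D)
    (hα1 : α ≤ 1) (m : ℕ) : δ / D ^ (m + 1) ≤ δ ^ α / D ^ ((m : ℝ) + α) := by
  have hrat : δ / D ≤ (δ / D) ^ α :=
    Real.self_le_rpow_of_le_one (by positivity) ((div_le_one hD).2 hδD) hα1
  rw [Real.div_rpow hδ hD.le] at hrat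
  rw [Real.rpow_add hD, Real.rpow_natCast, pow_succ', mul_comm (D ^ m), ← div_div, ← div_div]
  gcongr

theorem rpow_div_pow_le {δ D L α : ℝ} (hδ : 0 ≤ δ) (hD : 0 < D) (hDL : D ≤ L) (hα : 0 < α)
    (m : ℕ) : δ ^ α / D ^ m ≤ L ^ α * (δ ^ α / D ^ ((m : ℝ) + α)) := by
  have hDα : 0 < D ^ α := Real.rpow_pos_of_pos hD α
  have h1 : δ ^ α / D ^ m = D ^ α * (δ ^ α / D ^ ((m : ℝ) + α)) := by
    rw [Real.rpow_add hD, Real.rpow_natCast]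
    field_simp
  rw [h1]
  gcongr

/-- With u = y⁻¹ ∘ x₀ and w = x₀⁻¹ ∘ x the argument of k₀ moves from u to u ∘ w, which
`exists_k₀_comp_bound` controls. The other term of the product rule uses the Hölder bound on a and
the size of k₀. -/
theorem exists_kernel_holder {A B : Matrix (Idx p) (Idx p) ℝ} (h : IsCanonicalPair p A B) {ρ₀ : ℝ}
    {η : Pt p → ℝ} (hη : IsCutoff ρ₀ η) {α : ℝ} (hα : 0 < α) (hα1 : α ≤ 1) {K : ℝ} (hK : 0 ≤ K) :
    ∃ c₀ : ℝ, 0 ≤ c₀ ∧ ∀ (i j : Fin (p 0)) (a b : Pt p → ℝ), (∀ x, |a x| ≤ K) →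
      (∀ x, |b x| ≤ K) → (∀ x y, |a x - a y| ≤ K * d B x y ^ α) →
      ∀ (z₀ : Pt p) (R : ℝ), R ≤ 1 → ∀ x₀ ∈ ball B z₀ R, ∀ x ∈ ball B z₀ R, ∀ y ∈ ball B z₀ R,
      c₀ * d B x₀ x ≤ d B x₀ y →
        |kernel A B η i j a b x y - kernel A B η i j a b x₀ y| ≤
          c₀ * (d B x₀ x ^ α / d B x₀ y ^ ((Q p : ℝ) + 2 + α)) := by
  obtain ⟨L, hL, hLb⟩ := exists_d_ball_bound h
  obtain ⟨K₁, hK₁, hb₁⟩ := exists_k₀_bound h hη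
  obtain ⟨ε, K₂, hε0, hε1, hK₂, hb₂⟩ := exists_k₀_comp_bound h hη L
  obtain ⟨K₃, hK₃, hb₃⟩ := exists_d_comm_bound h L
  -- The summand K₃/ε makes ‖w‖ ≤ ε ‖u‖, K₃ paying for the asymmetry of d; the other summand is the
  -- constant of the estimate. Their sum serves both purposes.
  refine ⟨K₃ / ε + K * K * (K₂ * K₃ + K₁ * L ^ α), by positivity, ?_⟩
  set c₁ := K * K * (K₂ * K₃ + K₁ * L ^ α) with hc₁
  have hc₁0 : 0 ≤ c₁ := by positivity
  intro i j a b ha hb hab z₀ R hR x₀ hx₀ x hx y hy hdist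
  set δ := d B x₀ x with hδ
  set D := d B x₀ y with hD
  have hδ0 : 0 ≤ δ := d_nonneg _ _ _
  have hD0 : 0 ≤ D := d_nonneg _ _ _
  have hfrac : 0 ≤ δ ^ α / D ^ ((Q p : ℝ) + 2 + α) := by positivity
  have h1 : K₃ / ε * δ ≤ D := by
    refine le_trans ?_ hdist
    gcongr
    exact le_add_of_nonneg_right hc₁0
  have hδD : δ ≤ D := by
    refine le_trans ?_ h1
    exact le_mul_of_one_le_left hδ0 ((one_le_div hε0).2 (hε1.trans hK₃))
  rcases eq_or_lt_of_le hD0 with hDz | hDpos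
  · have : x₀ = x := eq_of_d_eq_zero (le_antisymm (hδD.trans hDz.symm.le) hδ0)
    rw [this, sub_self, abs_zero]
    positivity
  have hDL : D ≤ L := hLb z₀ x₀ y R hR hx₀ hy
  set u := comp B (inv B y) x₀ with hu
  set w := comp B (inv B x₀) x with hw
  have hcomp : comp B (inv B y) x = comp B u w := inv_comp_trans B x y x₀
  have hwδ : hnorm w ≤ K₃ * δ := hb₃ x₀ x (hLb z₀ x₀ x R hR hx₀ hx)
  have hwu : hnorm w ≤ ε * hnorm u := by
    refine hwδ.trans ?_
    have : ε * (K₃ / ε * δ) = K₃ * δ := by field_simp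
    rw [← this]
    exact mul_le_mul_of_nonneg_left h1 hε0.le
  have hk := hb₂ i j u w hDL hDpos hwu
  have huD : hnorm u = D := rfl
  have hcast : (Q p : ℝ) + 2 + α = ((Q p + 2 : ℕ) : ℝ) + α := by push_cast; ring
  rw [hcast] at hfrac ⊢
  rw [huD] at hk
  have hk₀ := hb₁ i j u
  rw [huD] at hk₀
  set q := δ ^ α / D ^ (((Q p + 2 : ℕ) : ℝ) + α) with hq
  have e1 : K₂ * hnorm w / D ^ (Q p + 3) ≤ K₂ * K₃ * q := by
    calc K₂ * hnorm w / D ^ (Q p + 3) ≤ K₂ * (K₃ * δ) / D ^ (Q p + 3) := by gcongr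
      _ = K₂ * K₃ * (δ / D ^ (Q p + 2 + 1)) := by ring
      _ ≤ K₂ * K₃ * q := by
        refine mul_le_mul_of_nonneg_left ?_ (by positivity)
        exact div_pow_succ_le_rpow_div hδ0 hδD hDpos hα1 (Q p + 2)
  have e2 : δ ^ α * (K₁ / D ^ (Q p + 2)) ≤ K₁ * L ^ α * q := by
    calc δ ^ α * (K₁ / D ^ (Q p + 2)) = K₁ * (δ ^ α / D ^ (Q p + 2)) := by ring
      _ ≤ K₁ * (L ^ α * q) :=
        mul_le_mul_of_nonneg_left (rpow_div_pow_le hδ0 hDpos hDL hα (Q p + 2)) hK₁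
      _ = _ := by ring
  have hsplit : kernel A B η i j a b x y - kernel A B η i j a b x₀ y =
      a x * b y * (k₀ A B η i j (comp B u w) - k₀ A B η i j u) +
        (a x - a x₀) * b y * k₀ A B η i j u := by
    rw [kernel, kernel, hcomp]; ring
  rw [hsplit]
  refine (abs_add_le _ _).trans ?_
  rw [abs_mul, abs_mul, abs_mul, abs_mul]
  calc |a x| * |b y| * |k₀ A B η i j (comp B u w) - k₀ A B η i j u| +
        |a x - a x₀| * |b y| * |k₀ A B η i j u|
      ≤ K * K * (K₂ * hnorm w / D ^ (Q p + 3)) +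
        K * δ ^ α * K * (K₁ / D ^ (Q p + 2)) := by
        refine add_le_add ?_ ?_
        · exact mul_le_mul (mul_le_mul (ha x) (hb y) (abs_nonneg _) hK) hk (abs_nonneg _)
            (by positivity)
        · refine mul_le_mul (mul_le_mul ?_ (hb y) (abs_nonneg _) (by positivity))
            hk₀ (abs_nonneg _) (by positivity)
          rw [abs_sub_comm]
          exact hab x₀ x
    _ = K * K * (K₂ * hnorm w / D ^ (Q p + 3)) +
        K * K * (δ ^ α * (K₁ / D ^ (Q p + 2))) := by ring
    _ ≤ K * K * (K₂ * K₃ * q) + K * K * (K₁ * L ^ α * q) := by gcongr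
    _ = c₁ * q := by rw [hc₁]; ring
    _ ≤ _ := by
        refine mul_le_mul_of_nonneg_right ?_ hfrac
        exact le_add_of_nonneg_left (by positivity)

/-! ### Hölder exponents greater than one. -/

theorem eq_of_abs_sub_le_rpow {g : ℝ → ℝ} {K α : ℝ} (hα : 1 < α)
    (hg : ∀ s t, |g s - g t| ≤ K * |s - t| ^ α) (s t : ℝ) : g s = g t := by
  have hd : ∀ t, HasDerivAt g 0 t := by
    intro t
    rw [hasDerivAt_iff_isLittleO]
    simp only [smul_zero, sub_zero]
    have h1 : (fun s => g s - g t) =O[𝓝 t] fun s => |s - t| ^ α :=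
      Asymptotics.IsBigO.of_bound K (Filter.Eventually.of_forall fun s => by
        rw [Real.norm_eq_abs, Real.norm_eq_abs, abs_of_nonneg (by positivity : 0 ≤ |s - t| ^ α)]
        exact hg s t)
    refine h1.trans_isLittleO ?_
    have h2 : Filter.Tendsto (fun s => |s - t|) (𝓝 t) (𝓝 0) := by
      have : Continuous fun s => |s - t| := by fun_prop
      simpa using this.tendsto t
    rw [Asymptotics.isLittleO_iff]
    intro c hc
    have h3 : Filter.Tendsto (fun s => |s - t| ^ (α - 1)) (𝓝 t) (𝓝 0) := by
      have := h2.rpow_const (p := α - 1) (Or.inr (by linarith))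
      rwa [Real.zero_rpow (by linarith)] at this
    filter_upwards [h3.eventually (gt_mem_nhds hc)] with s hs
    rw [Real.norm_eq_abs, Real.norm_eq_abs, abs_of_nonneg (by positivity : 0 ≤ |s - t| ^ α)]
    rcases eq_or_lt_of_le (abs_nonneg (s - t)) with h0 | h0
    · rw [← h0, Real.zero_rpow (by linarith), mul_zero]
    · have : |s - t| ^ α = |s - t| ^ (α - 1) * |s - t| := by
        rw [← Real.rpow_add_one h0.ne']; ring_nf
      rw [this]
      gcongr
  exact is_const_of_deriv_eq_zero (fun t => (hd t).differentiableAt) (fun t => (hd t).deriv) s t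

/-- Compactly localised functions that are Hölder of order `> 1` vanish. -/
theorem eq_zero_of_holder_gt_one {A B : Matrix (Idx p) (Idx p) ℝ} (h : IsCanonicalPair p A B)
    {α : ℝ} (hα : 1 < α) {K : ℝ} {f : Pt p → ℝ} (hf : ∀ x y, |f x - f y| ≤ K * d B x y ^ α)
    {z₀ : Pt p} {R : ℝ} (hs : tsupport f ⊆ ball B z₀ R) (z : Pt p) : f z = 0 := by
  have hp0 : 0 < p 0 := lt_of_lt_of_le h.pos (h.anti (Fin.zero_le _))
  set o : Idx p := ⟨0, ⟨0, hp0⟩⟩ with ho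
  set e : Idx p → ℝ := Pi.single o 1 with he
  -- At fixed time and in a first-block direction, of degree 1, d is the Euclidean distance.
  have hline : ∀ s t : ℝ, d B (z.1 + s • e, z.2) (z.1 + t • e, z.2) = |s - t| := by
    intro s t
    rw [d, inv_comp_eq, sub_self, E_zero, Matrix.one_mulVec, add_sub_add_left_eq_sub, ← sub_smul,
      hnorm_eq, Finset.sum_eq_single o]
    · simp [he, deg, ho]
    · intro k _ hk
      simp [he, hk, Real.zero_rpow (inv_ne_zero (Nat.cast_ne_zero.2 (deg_ne_zero k)))]
    · simp
  have hconst : ∀ s : ℝ, f z = f (z.1 + s • e, z.2) := fun s => by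
    have := eq_of_abs_sub_le_rpow (g := fun s => f (z.1 + s • e, z.2)) hα
      (fun s t => by simpa only [hline] using hf (z.1 + s • e, z.2) (z.1 + t • e, z.2)) 0 s
    simpa using this
  by_contra hne
  have hball : ∀ s : ℝ, d B z₀ (z.1 + s • e, z.2) < R := fun s => by
    refine hs (subset_tsupport f ?_)
    rw [Function.mem_support, ← hconst s]
    exact hne
  -- If f(z) ≠ 0, the whole line lies in the ball. Since E is invertible, some coordinate of the
  -- points of the line relative to z₀ is a nonconstant affine function of s, hence unbounded.
  have hee : E B (z₀.2 - z.2) *ᵥ e ≠ 0 := by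
    intro h0
    have h1 : E B (-(z₀.2 - z.2)) *ᵥ (E B (z₀.2 - z.2) *ᵥ e) = e := by
      rw [Matrix.mulVec_mulVec, E_neg_mul_E, Matrix.one_mulVec]
    rw [h0, Matrix.mulVec_zero] at h1
    have := congrFun h1 o
    simp [he] at this
  obtain ⟨k, hk⟩ := Function.ne_iff.1 hee
  set g := (E B (z₀.2 - z.2) *ᵥ e) k with hg
  set x := z₀.1 k - (E B (z₀.2 - z.2) *ᵥ z.1) k with hx
  have hb : ∀ s : ℝ, |x - s * g| ≤ R ^ deg k := by
    intro s
    have h1 := abs_fst_le_hnorm_pow (comp B (inv B (z.1 + s • e, z.2)) z₀) k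
    rw [inv_comp_eq] at h1
    simp only [Matrix.mulVec_add, Matrix.mulVec_smul, Pi.sub_apply, Pi.add_apply, Pi.smul_apply,
      smul_eq_mul, ← sub_sub] at h1
    refine h1.trans ?_
    have h2 := (hball s).le
    rw [d, inv_comp_eq] at h2
    simp only [Matrix.mulVec_add, Matrix.mulVec_smul, ← sub_sub] at h2
    exact pow_le_pow_left₀ (hnorm_nonneg _) h2 _
  have hg0 : g ≠ 0 := hk
  -- This s makes x - s g equal to -(R ^ deg k + 1), beyond the bound.
  have h3 := hb ((x + (R ^ deg k + 1)) / g)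
  rw [div_mul_cancel₀ _ hg0, sub_add_cancel_left, abs_neg] at h3
  linarith [le_abs_self (R ^ deg k + 1)]

/-! ### The change of variables adapted to the kernel. -/

/-- The map `(v, t) ↦ (D(√t) v, t)` undoing `unitPt`. -/
def stretch (ζ : Pt p) : Pt p := (fun k => √ζ.2 ^ deg k * ζ.1 k, ζ.2)

/-- The point `y` with `y⁻¹ ∘ x = stretch ζ`. -/
def param (B : Matrix (Idx p) (Idx p) ℝ) (x ζ : Pt p) : Pt p := comp B x (inv B (stretch ζ))

/-- The Jacobian of `param`. -/
def jac (B : Matrix (Idx p) (Idx p) ℝ) (t : ℝ) : ℝ := (E B (-t)).det * √t ^ Q p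

theorem inv_param_comp (B : Matrix (Idx p) (Idx p) ℝ) (x ζ : Pt p) :
    comp B (inv B (param B x ζ)) x = stretch ζ := comp_inv_eq_of B x _

theorem unitPt_stretch {ζ : Pt p} (h : 0 < ζ.2) : unitPt (stretch ζ) = ζ.1 := by
  ext k
  have : √ζ.2 ≠ 0 := (Real.sqrt_pos.2 h).ne'
  simp only [unitPt, stretch]
  field_simp

theorem hnorm_stretch {ζ : Pt p} (h : 0 < ζ.2) : hnorm (stretch ζ) = √ζ.2 * hnorm (ζ.1, 1) := by
  have hs : 0 ≤ √ζ.2 := Real.sqrt_nonneg _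
  rw [hnorm_eq, hnorm_eq, mul_add, Finset.mul_sum]
  congr 1
  · refine Finset.sum_congr rfl fun k _ => ?_
    simp only [stretch]
    rw [abs_mul, Real.mul_rpow (abs_nonneg _) (abs_nonneg _), abs_of_nonneg (by positivity),
      Real.pow_rpow_inv_natCast hs (deg_ne_zero k)]
  · simp [stretch, abs_of_pos h]

theorem continuous_E_mulVec (B : Matrix (Idx p) (Idx p) ℝ) {X : Type*} [TopologicalSpace X]
    {f : X → ℝ} {g : X → Idx p → ℝ} (hf : Continuous f) (hg : Continuous g) :
    Continuous fun x => E B (f x) *ᵥ g x := by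
  refine continuous_pi fun k => ?_
  simp only [Matrix.mulVec, dotProduct]
  exact continuous_finsetSum _ fun l _ => ((contDiff_E B k l).continuous.comp hf).mul
    ((continuous_apply l).comp hg)

theorem continuous_comp (B : Matrix (Idx p) (Idx p) ℝ) {X : Type*} [TopologicalSpace X]
    {f g : X → Pt p} (hf : Continuous f) (hg : Continuous g) :
    Continuous fun x => comp B (f x) (g x) :=
  (hg.fst.add (continuous_E_mulVec B hg.snd hf.fst)).prodMk (hf.snd.add hg.snd)

theorem continuous_inv (B : Matrix (Idx p) (Idx p) ℝ) {X : Type*} [TopologicalSpace X]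
    {f : X → Pt p} (hf : Continuous f) : Continuous fun x => inv B (f x) :=
  (continuous_E_mulVec B hf.snd.neg hf.fst).neg.prodMk hf.snd.neg

theorem continuous_stretch : Continuous (stretch : Pt p → Pt p) := by
  refine Continuous.prodMk (continuous_pi fun k => ?_) continuous_snd
  fun_prop

theorem continuous_param (B : Matrix (Idx p) (Idx p) ℝ) (x : Pt p) : Continuous (param B x) :=
  continuous_comp B continuous_const (continuous_inv B continuous_stretch)

theorem continuous_jac (B : Matrix (Idx p) (Idx p) ℝ) : Continuous (jac B) := by
  refine Continuous.mul ?_ (by fun_prop)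
  have h1 : Continuous fun t => (E B t).det :=
    (contDiff_det (n := ∞) (contDiff_E B)).continuous
  exact h1.comp continuous_neg

theorem jac_pos (B : Matrix (Idx p) (Idx p) ℝ) {t : ℝ} (ht : 0 < t) : 0 < jac B t :=
  mul_pos (det_E_pos B _) (pow_pos (Real.sqrt_pos.2 ht) _)

theorem lintegral_mulVec {ι : Type*} [Fintype ι] [DecidableEq ι] {M : Matrix ι ι ℝ}
    (hM : 0 < M.det) {f : (ι → ℝ) → ℝ≥0∞} (hf : Measurable f) :
    ∫⁻ v, f v = ENNReal.ofReal M.det * ∫⁻ v, f (M *ᵥ v) := by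
  have h1 := Real.map_matrix_volume_pi_eq_smul_volume_pi hM.ne'
  have hmeas : Measurable (Matrix.toLin' M) :=
    (Matrix.toLin' M).continuous_of_finiteDimensional.measurable
  have h2 : ∫⁻ v, f (M *ᵥ v) = ENNReal.ofReal M.det⁻¹ * ∫⁻ v, f v := by
    have := lintegral_map hf hmeas (μ := volume)
    rw [h1, lintegral_smul_measure, abs_of_pos (inv_pos.2 hM)] at this
    simpa using this.symm
  rw [h2, ← mul_assoc, ← ENNReal.ofReal_mul hM.le, mul_inv_cancel₀ hM.ne', ENNReal.ofReal_one,
    one_mul]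

/-- On a time slice the map is v ↦ E(-t)(x - Dv) with D diagonal with entries √t^(deg k): a diagonal
map, a reflection and a linear map, whose determinants multiply to `jac`. -/
theorem lintegral_param_fibre (B : Matrix (Idx p) (Idx p) ℝ) (x : Pt p) {t : ℝ} (ht : 0 < t)
    {f : (Idx p → ℝ) → ℝ≥0∞} (hf : Measurable f) :
    ∫⁻ y, f y = ENNReal.ofReal (jac B t) * ∫⁻ v, f (param B x (v, t)).1 := by
  set D : Matrix (Idx p) (Idx p) ℝ := Matrix.diagonal fun k => √t ^ deg k with hD
  have hDdet : D.det = √t ^ Q p := by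
    rw [hD, Matrix.det_diagonal, Finset.prod_pow_eq_pow_sum, sum_deg]
  have hs : 0 < √t := Real.sqrt_pos.2 ht
  have hE : Continuous fun y : Idx p → ℝ => E B (-t) *ᵥ y :=
    continuous_E_mulVec B continuous_const continuous_id
  have hf1 : Measurable fun y : Idx p → ℝ => f (E B (-t) *ᵥ y) := hf.comp hE.measurable
  have hf2 : Measurable fun y : Idx p → ℝ => f (E B (-t) *ᵥ (x.1 - y)) :=
    hf1.comp (measurable_const.sub measurable_id)
  rw [lintegral_mulVec (det_E_pos B (-t)) hf,
    ← lintegral_sub_left_eq_self (fun y => f (E B (-t) *ᵥ y)) x.1,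
    lintegral_mulVec (M := D) (by rw [hDdet]; positivity) hf2, hDdet, ← mul_assoc,
    ← ENNReal.ofReal_mul (det_E_pos B _).le]
  congr 1
  refine lintegral_congr fun v => ?_
  congr 1
  have : D *ᵥ v = (stretch (v, t)).1 := by
    ext k
    simp [hD, Matrix.mulVec_diagonal, stretch]
  rw [this, Matrix.mulVec_sub]
  simp [param, comp, inv, stretch, sub_eq_add_neg, add_comm]

theorem lintegral_param (B : Matrix (Idx p) (Idx p) ℝ) (x : Pt p) {f : Pt p → ℝ≥0∞}
    (hf : Measurable f) : ∫⁻ y in {y | y.2 < x.2}, f y =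
      ∫⁻ ζ in {ζ : Pt p | 0 < ζ.2}, ENNReal.ofReal (jac B ζ.2) * f (param B x ζ) := by
  have hs1 : MeasurableSet {y : Pt p | y.2 < x.2} :=
    measurableSet_lt measurable_snd measurable_const
  have hs2 : MeasurableSet {y : Pt p | 0 < y.2} := measurableSet_lt measurable_const measurable_snd
  have hm : Measurable fun ζ : Pt p => ENNReal.ofReal (jac B ζ.2) * f (param B x ζ) :=
    (((continuous_jac B).measurable.comp measurable_snd).ennreal_ofReal).mul
      (hf.comp (continuous_param B x).measurable)
  rw [← lintegral_indicator hs1, ← lintegral_indicator hs2, Measure.volume_eq_prod,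
    lintegral_prod_symm' _ (hf.indicator hs1), lintegral_prod_symm' _ (hm.indicator hs2),
    ← lintegral_sub_left_eq_self _ x.2]
  refine lintegral_congr fun t => ?_
  rcases le_or_gt t 0 with ht | ht
  · have h1 : ∀ v : Idx p → ℝ, ((v, x.2 - t) : Pt p) ∉ {y : Pt p | y.2 < x.2} := fun v => by
      simpa using ht
    have h2 : ∀ v : Idx p → ℝ, ((v, t) : Pt p) ∉ {y : Pt p | 0 < y.2} := fun v => by
      simpa using ht
    simp only [Set.indicator_of_notMem (h1 _), Set.indicator_of_notMem (h2 _)]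
  · have h1 : ∀ v : Idx p → ℝ, ((v, x.2 - t) : Pt p) ∈ {y : Pt p | y.2 < x.2} := fun v => by
      simpa using ht
    have h2 : ∀ v : Idx p → ℝ, ((v, t) : Pt p) ∈ {y : Pt p | 0 < y.2} := fun v => by
      simpa using ht
    simp only [Set.indicator_of_mem (h1 _), Set.indicator_of_mem (h2 _)]
    have hf' : Measurable fun v : Idx p → ℝ => f (v, x.2 - t) := hf.comp (by fun_prop)
    rw [lintegral_param_fibre B x ht hf', lintegral_const_mul]
    · congr 1
    · exact hf.comp ((continuous_param B x).measurable.comp (by fun_prop))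

/-- As an identity of measures, the change of variables transfers both Bochner integrals and
integrability to the new coordinates. -/
theorem map_param (B : Matrix (Idx p) (Idx p) ℝ) (x : Pt p) :
    Measure.map (param B x) (((volume : Measure (Pt p)).restrict {ζ | 0 < ζ.2}).withDensity
      fun ζ => ENNReal.ofReal (jac B ζ.2)) = volume.restrict {y | y.2 < x.2} := by
  have hj : Measurable fun ζ : Pt p => ENNReal.ofReal (jac B ζ.2) :=
    ((continuous_jac B).measurable.comp measurable_snd).ennreal_ofReal
  refine Measure.ext_of_lintegral _ fun f hf => ?_
  rw [lintegral_map hf (continuous_param B x).measurable, lintegral_param B x hf]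
  exact lintegral_withDensity_eq_lintegral_mul _ hj (hf.comp (continuous_param B x).measurable)

theorem integral_param (B : Matrix (Idx p) (Idx p) ℝ) (x : Pt p) {f : Pt p → ℝ}
    (hf : Measurable f) (h0 : ∀ y, x.2 ≤ y.2 → f y = 0) :
    ∫ y, f y = ∫ ζ in {ζ : Pt p | 0 < ζ.2}, jac B ζ.2 * f (param B x ζ) := by
  have hj : Measurable fun ζ : Pt p => ENNReal.ofReal (jac B ζ.2) :=
    ((continuous_jac B).measurable.comp measurable_snd).ennreal_ofReal
  have hs2 : MeasurableSet {y : Pt p | 0 < y.2} := measurableSet_lt measurable_const measurable_snd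
  rw [← setIntegral_eq_integral_of_forall_compl_eq_zero (s := {y : Pt p | y.2 < x.2})
    (fun y hy => h0 y (not_lt.1 hy)), ← map_param B x,
    integral_map (continuous_param B x).measurable.aemeasurable hf.aestronglyMeasurable,
    integral_withDensity_eq_integral_toReal_smul hj (by simp)]
  refine setIntegral_congr_fun hs2 fun ζ hζ => ?_
  simp [ENNReal.toReal_ofReal (jac_pos B hζ).le]

theorem integrable_param (B : Matrix (Idx p) (Idx p) ℝ) (x : Pt p) {f : Pt p → ℝ}
    (hf : Measurable f) (h0 : ∀ y, x.2 ≤ y.2 → f y = 0)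
    (hi : IntegrableOn (fun ζ => jac B ζ.2 * f (param B x ζ)) {ζ : Pt p | 0 < ζ.2}) :
    Integrable f := by
  have hj : Measurable fun ζ : Pt p => ENNReal.ofReal (jac B ζ.2) :=
    ((continuous_jac B).measurable.comp measurable_snd).ennreal_ofReal
  have hs1 : MeasurableSet {y : Pt p | y.2 < x.2} :=
    measurableSet_lt measurable_snd measurable_const
  have hs2 : MeasurableSet {y : Pt p | 0 < y.2} := measurableSet_lt measurable_const measurable_snd
  have h1 : IntegrableOn f {y : Pt p | y.2 < x.2} := by
    rw [IntegrableOn, ← map_param B x, integrable_map_measure hf.aestronglyMeasurable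
      (continuous_param B x).measurable.aemeasurable,
      integrable_withDensity_iff_integrable_smul' hj (by simp)]
    refine IntegrableOn.congr_fun hi (fun ζ hζ => ?_) hs2
    simp [ENNReal.toReal_ofReal (jac_pos B hζ).le]
  rw [← integrable_indicator_iff hs1] at h1
  refine h1.congr (Filter.Eventually.of_forall fun y => ?_)
  by_cases hy : y.2 < x.2
  · exact Set.indicator_of_mem (s := {y : Pt p | y.2 < x.2}) hy f
  · rw [Set.indicator_of_notMem (s := {y : Pt p | y.2 < x.2}) hy f, h0 y (not_lt.1 hy)]

/-! ### Cancellation of the principal part over annuli. -/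

theorem integrable_exp_weight {ι : Type*} [Fintype ι] {c : ℝ} (hc : 0 < c) :
    Integrable fun v : ι → ℝ => Real.exp (-c * (weight v - 1)) := by
  have h1 : (fun v : ι → ℝ => Real.exp (-c * (weight v - 1))) =
      fun v => ∏ k, Real.exp (-c * v k ^ 2) := by
    ext v
    rw [← Real.exp_sum, weight, add_sub_cancel_left, Finset.mul_sum]
  rw [h1]
  exact Integrable.fintype_prod (f := fun (_ : ι) (s : ℝ) => Real.exp (-c * s ^ 2))
    fun _ => integrable_exp_neg_mul_sq hc

theorem continuous_covMat_inv_mulVec {A B : Matrix (Idx p) (Idx p) ℝ} (h : IsCanonicalPair p A B)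
    (k : Idx p) : Continuous fun ζ : Pt p => ((covMat A B ζ.2)⁻¹ *ᵥ ζ.1) k := by
  simp only [Matrix.mulVec, dotProduct]
  exact continuous_finsetSum _ fun l _ =>
    ((contDiff_covMat_inv h k l).continuous.comp continuous_snd).mul
      ((continuous_apply l).comp continuous_fst)

theorem continuous_covMat_inv_quadratic {A B : Matrix (Idx p) (Idx p) ℝ}
    (h : IsCanonicalPair p A B) :
    Continuous fun ζ : Pt p => ((covMat A B ζ.2)⁻¹ *ᵥ ζ.1) ⬝ᵥ ζ.1 := by
  simp only [dotProduct]
  exact continuous_finsetSum _ fun k _ => (continuous_covMat_inv_mulVec h k).mul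
    ((continuous_apply k).comp continuous_fst)

theorem continuous_gaussHess {A B : Matrix (Idx p) (Idx p) ℝ} (h : IsCanonicalPair p A B)
    (i j : Idx p) : Continuous fun ζ : Pt p => gaussHess (covMat A B ζ.2)⁻¹ i j ζ.1 := by
  unfold gaussHess
  refine Continuous.mul (Continuous.sub (continuous_const.mul ?_) (continuous_const.mul ?_))
    (Real.continuous_exp.comp (continuous_const.mul (continuous_covMat_inv_quadratic h)))
  · exact (continuous_covMat_inv_mulVec h i).mul (continuous_covMat_inv_mulVec h j)
  · exact (contDiff_covMat_inv h i j).continuous.comp continuous_snd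

theorem continuous_gaussHess_const {ι : Type*} [Fintype ι] (N : Matrix ι ι ℝ) (i j : ι) :
    Continuous fun v => gaussHess N i j v := by
  have hcont : Continuous fun v : ι → ℝ => N *ᵥ v := continuous_const.matrix_mulVec continuous_id
  exact ((continuous_const.mul (((continuous_apply i).comp hcont).mul
    ((continuous_apply j).comp hcont))).sub continuous_const).mul
      (Real.continuous_exp.comp (continuous_const.mul (hcont.dotProduct continuous_id)))

theorem integrable_of_weight_bound {ι : Type*} [Fintype ι] {f : (ι → ℝ) → ℝ} (hf : Continuous f)
    {c K : ℝ} (hc : 0 < c) (hK : 0 ≤ K) (m : ℕ)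
    (hb : ∀ v, |f v| ≤ K * (weight v ^ m * Real.exp (-c * (weight v - 1)))) : Integrable f := by
  obtain ⟨K', -, hK'⟩ := exists_weight_pow_mul_exp_le hc m
  refine ((integrable_exp_weight (ι := ι) (half_pos hc)).const_mul (K * K')).mono'
    hf.aestronglyMeasurable (Filter.Eventually.of_forall fun v => ?_)
  refine (hb v).trans ?_
  rw [mul_assoc]
  exact mul_le_mul_of_nonneg_left (hK' _ (one_le_weight v)) hK

/-- The integrand is the derivative, in a fixed direction, of an integrable function; integration by
parts against the constant 1 gives zero. -/
theorem integral_gaussHess_of_integrable {ι : Type*} [Fintype ι] [DecidableEq ι]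
    {N : Matrix ι ι ℝ} (hN : Nᵀ = N) (i j : ι) (hint : Integrable fun v => gaussHess N i j v)
    (hφ : Integrable fun v => -(1 / 2) * (N *ᵥ v) j * Real.exp (-(1 / 4) * ((N *ᵥ v) ⬝ᵥ v))) :
    ∫ v, gaussHess N i j v = 0 := by
  have key := integral_bilinear_hasLineDerivAt_right_eq_neg_left_of_integrable
    (μ := (volume : Measure (ι → ℝ))) (f := fun _ => (1 : ℝ)) (f' := fun _ => (0 : ℝ))
    (g := fun v => -(1 / 2) * (N *ᵥ v) j * Real.exp (-(1 / 4) * ((N *ᵥ v) ⬝ᵥ v)))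
    (g' := fun v => gaussHess N i j v) (v := Pi.single i 1) (B := ContinuousLinearMap.mul ℝ ℝ)
  simp only [ContinuousLinearMap.mul_apply', zero_mul, one_mul, integral_zero, neg_zero] at key
  exact key (integrable_zero _ _ _) hint hφ (fun v _ => hasDerivAt_const _ _)
    (fun v _ => hasDerivAt_gauss_line_line hN v i j)

theorem integrable_gauss_mulVec {ι : Type*} [Fintype ι] {N : Matrix ι ι ℝ} {c : ℝ} (hc : 0 < c)
    (hl : ∀ v : ι → ℝ, c * ∑ k, v k ^ 2 ≤ (N *ᵥ v) ⬝ᵥ v) (j : ι) :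
    Integrable fun v => -(1 / 2) * (N *ᵥ v) j * Real.exp (-(1 / 4) * ((N *ᵥ v) ⬝ᵥ v)) := by
  set Λ := ∑ k, ∑ l, |N k l| with hΛdef
  have hΛ : ∀ k l, |N k l| ≤ Λ := fun k l =>
    (Finset.single_le_sum (f := fun l => |N k l|) (fun l _ => abs_nonneg _)
      (Finset.mem_univ l)).trans (Finset.single_le_sum (f := fun k => ∑ l, |N k l|)
        (fun k _ => Finset.sum_nonneg fun l _ => abs_nonneg _) (Finset.mem_univ k))
  have hΛ0 : 0 ≤ Λ := Finset.sum_nonneg fun k _ => Finset.sum_nonneg fun l _ => abs_nonneg _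
  have hcont : Continuous fun v : ι → ℝ => N *ᵥ v := continuous_const.matrix_mulVec continuous_id
  refine integrable_of_weight_bound ?_ (c := c / 4)
    (K := Fintype.card ι * Λ) (by positivity) (by positivity) 1 fun v => ?_
  · exact (continuous_const.mul ((continuous_apply j).comp hcont)).mul
      (Real.continuous_exp.comp (continuous_const.mul (hcont.dotProduct continuous_id)))
  have h1 := abs_mulVec_le_mul hΛ0 hΛ (abs_le_weight v) j
  have h2 : Real.exp (-(1 / 4) * ((N *ᵥ v) ⬝ᵥ v)) ≤ Real.exp (-(c / 4) * (weight v - 1)) := by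
    have := hl v
    refine Real.exp_le_exp.2 ?_
    rw [weight]
    linarith
  have hW := weight_pos v
  rw [abs_mul, abs_mul, abs_of_pos (Real.exp_pos _), abs_neg,
    abs_of_pos (by norm_num : (0 : ℝ) < 1 / 2), pow_one]
  calc 1 / 2 * |(N *ᵥ v) j| * Real.exp (-(1 / 4) * ((N *ᵥ v) ⬝ᵥ v))
      ≤ 1 * (Fintype.card ι * (Λ * weight v)) * Real.exp (-(c / 4) * (weight v - 1)) := by
        refine mul_le_mul (mul_le_mul (by norm_num) h1 (abs_nonneg _) zero_le_one) h2
          (Real.exp_pos _).le (by positivity)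
    _ = _ := by ring

theorem integral_gaussHess {A B : Matrix (Idx p) (Idx p) ℝ} (h : IsCanonicalPair p A B) {t : ℝ}
    (ht : 0 ≤ t) (i j : Idx p) : ∫ v, gaussHess (covMat A B t)⁻¹ i j v = 0 := by
  have htt : t ∈ Set.Icc 0 t := ⟨ht, le_rfl⟩
  obtain ⟨c, K, hc, hK, hb, -⟩ := exists_gaussHess_bounds h t
  obtain ⟨c', hc', hl⟩ := exists_covMat_inv_lower h t
  have hint := integrable_of_weight_bound (continuous_gaussHess_const _ i j) hc (by linarith) 4
    (hb t htt i j)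
  have hφ := integrable_gauss_mulVec hc' (hl t htt) j
  have hsym := covMat_inv_symm h t
  exact integral_gaussHess_of_integrable hsym i j hint hφ

/-- The points `(v, t)` with `t > 0` whose image under `stretch` has size between `ρ₁` and `ρ₂`. -/
def annulus (p : Fin (r + 1) → ℕ) (ρ₁ ρ₂ : ℝ) : Set (Pt p) :=
  {ζ | 0 < ζ.2 ∧ ρ₁ < hnorm (stretch ζ) ∧ hnorm (stretch ζ) < ρ₂}

theorem measurableSet_annulus (ρ₁ ρ₂ : ℝ) : MeasurableSet (annulus p ρ₁ ρ₂) := by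
  have h : Measurable fun ζ : Pt p => hnorm (stretch ζ) :=
    (continuous_hnorm.comp continuous_stretch).measurable
  exact (measurableSet_lt measurable_const measurable_snd).inter
    ((measurableSet_lt measurable_const h).inter (measurableSet_lt h measurable_const))

theorem annulus_snd_lt {ρ₁ ρ₂ : ℝ} {ζ : Pt p} (hζ : ζ ∈ annulus p ρ₁ ρ₂) : ζ.2 < ρ₂ ^ 2 := by
  have h1 := abs_snd_le_hnorm_sq (stretch ζ)
  have h2 : |(stretch ζ).2| = ζ.2 := abs_of_pos hζ.1
  rw [h2] at h1
  exact h1.trans_lt (pow_lt_pow_left₀ hζ.2.2 (hnorm_nonneg _) two_ne_zero)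

theorem one_le_hnorm_one (v : Idx p → ℝ) : 1 ≤ hnorm ((v, 1) : Pt p) := by
  have := sqrt_le_hnorm (z := ((v, 1) : Pt p)) one_pos
  simpa using this

theorem hnorm_one_le (v : Idx p → ℝ) :
    hnorm ((v, 1) : Pt p) ≤ (Fintype.card (Idx p) + 1) * weight v := by
  have h1 := hnorm_le_sqrt_mul_weight (z := ((v, 1) : Pt p)) one_pos
  have h2 : unitPt ((v, 1) : Pt p) = v := by ext k; simp [unitPt]
  simpa [h2] using h1

theorem integrable_mul_indicator {c : ℝ} (hc : 0 < c) {T : ℝ} {g : ℝ → ℝ}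
    (hg : IntegrableOn g (Set.Ioo 0 T)) :
    Integrable fun ζ : Pt p => Real.exp (-c * (weight ζ.1 - 1)) * (Set.Ioo 0 T).indicator g ζ.2 :=
  (integrable_exp_weight hc).mul_prod ((integrable_indicator_iff measurableSet_Ioo).2 hg)

/-- The inner radius removes the singularity: ρ₁ < ‖stretch ζ‖ ≤ n √t W, with W the weight of v,
gives 1/t ≤ (n/ρ₁)² W², and the Gaussian absorbs W². The outer radius bounds t. -/
theorem integrableOn_annulus_div {f : (Idx p → ℝ) → ℝ} (hf : Continuous f) {c K : ℝ}
    (hc : 0 < c) (hK : 0 ≤ K) {m : ℕ}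
    (hb : ∀ v, |f v| ≤ K * (weight v ^ m * Real.exp (-c * (weight v - 1)))) {ρ₁ : ℝ} (hρ₁ : 0 < ρ₁)
    (ρ₂ : ℝ) : IntegrableOn (fun ζ : Pt p => f ζ.1 / ζ.2) (annulus p ρ₁ ρ₂) := by
  obtain ⟨K', hK', hw⟩ := exists_weight_pow_mul_exp_le hc (m + 2)
  set n : ℝ := (((Fintype.card (Idx p) : ℕ) : ℝ) + 1) with hn
  have hdom : Integrable fun ζ : Pt p => K * (n / ρ₁) ^ 2 * K' *
      (Real.exp (-(c / 2) * (weight ζ.1 - 1)) *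
        (Set.Ioo 0 (ρ₂ ^ 2)).indicator (fun _ => (1 : ℝ)) ζ.2) :=
    (integrable_mul_indicator (half_pos hc) (g := fun _ => (1 : ℝ))
      (integrableOn_const (by simp))).const_mul _
  refine Integrable.mono' hdom.integrableOn ?_ ?_
  · exact ((hf.comp continuous_fst).measurable.div measurable_snd).aestronglyMeasurable
  · refine (ae_restrict_iff' (measurableSet_annulus ρ₁ ρ₂)).2 (Filter.Eventually.of_forall ?_)
    intro ζ hζ
    have hmem : ζ.2 ∈ Set.Ioo 0 (ρ₂ ^ 2) := ⟨hζ.1, annulus_snd_lt hζ⟩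
    rw [Set.indicator_of_mem hmem, mul_one, Real.norm_eq_abs, abs_div, abs_of_pos hζ.1]
    have hW := weight_pos ζ.1
    have h1 : 1 / ζ.2 ≤ (n / ρ₁) ^ 2 * weight ζ.1 ^ 2 := by
      have h2 : ρ₁ ≤ √ζ.2 * (n * weight ζ.1) := by
        have := hζ.2.1
        rw [hnorm_stretch hζ.1] at this
        exact this.le.trans (mul_le_mul_of_nonneg_left (hnorm_one_le ζ.1) (Real.sqrt_nonneg _))
      have h3 : ρ₁ ^ 2 ≤ ζ.2 * (n * weight ζ.1) ^ 2 := by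
        calc ρ₁ ^ 2 ≤ (√ζ.2 * (n * weight ζ.1)) ^ 2 := pow_le_pow_left₀ hρ₁.le h2 2
          _ = _ := by rw [mul_pow, Real.sq_sqrt hζ.1.le]
      rw [div_le_iff₀ hζ.1, div_pow, div_mul_eq_mul_div, div_mul_eq_mul_div,
        le_div_iff₀ (by positivity)]
      nlinarith
    calc |f ζ.1| / ζ.2 = |f ζ.1| * (1 / ζ.2) := by ring
      _ ≤ (K * (weight ζ.1 ^ m * Real.exp (-c * (weight ζ.1 - 1)))) *
          ((n / ρ₁) ^ 2 * weight ζ.1 ^ 2) := by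
          have := hζ.1
          exact mul_le_mul (hb _) h1 (by positivity) (by positivity)
      _ = K * (n / ρ₁) ^ 2 * (weight ζ.1 ^ (m + 2) * Real.exp (-c * (weight ζ.1 - 1))) := by ring
      _ ≤ K * (n / ρ₁) ^ 2 * (K' * Real.exp (-(c / 2) * (weight ζ.1 - 1))) := by
          refine mul_le_mul_of_nonneg_left (hw _ (one_le_weight _)) (by positivity)
      _ = _ := by ring

/-- Cancellation of homogeneous kernels of critical degree over annuli. -/
theorem setIntegral_annulus_div {f : (Idx p → ℝ) → ℝ} (hf : Continuous f) {c K : ℝ}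
    (hc : 0 < c) (hK : 0 ≤ K) {m : ℕ}
    (hb : ∀ v, |f v| ≤ K * (weight v ^ m * Real.exp (-c * (weight v - 1))))
    (h0 : ∫ v, f v = 0) {ρ₁ : ℝ} (hρ₁ : 0 < ρ₁) (ρ₂ : ℝ) :
    ∫ ζ in annulus p ρ₁ ρ₂, f ζ.1 / ζ.2 = 0 := by
  rcases le_or_gt ρ₂ ρ₁ with hle | hlt
  · have : annulus p ρ₁ ρ₂ = ∅ :=
      Set.eq_empty_of_forall_notMem fun ζ hζ => by linarith [hζ.2.1, hζ.2.2]
    rw [this]; simp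
  have hint := (integrable_indicator_iff (measurableSet_annulus ρ₁ ρ₂)).2
    (integrableOn_annulus_div hf hc hK hb hρ₁ ρ₂)
  rw [← integral_indicator (measurableSet_annulus ρ₁ ρ₂), Measure.volume_eq_prod,
    integral_prod _ hint]
  -- The norm of `stretch (v, t)` is √t l with l = ‖(v, 1)‖, so the fibre over v is the interval
  -- from (ρ₁/l)² to (ρ₂/l)². The integral of dt/t over it does not depend on l.
  have hinner : ∀ v : Idx p → ℝ, ∫ t, (annulus p ρ₁ ρ₂).indicator
      (fun ζ : Pt p => f ζ.1 / ζ.2) (v, t) = f v * Real.log (ρ₂ ^ 2 / ρ₁ ^ 2) := by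
    intro v
    set l := hnorm ((v, 1) : Pt p) with hl
    have hl1 : 0 < l := one_pos.trans_le (one_le_hnorm_one v)
    have hfib : ∀ t, ((v, t) : Pt p) ∈ annulus p ρ₁ ρ₂ ↔
        t ∈ Set.Ioo ((ρ₁ / l) ^ 2) ((ρ₂ / l) ^ 2) := by
      intro t
      rw [Set.mem_Ioo]
      constructor
      · rintro ⟨ht, h1, h2⟩
        rw [hnorm_stretch ht] at h1 h2
        have h1' : ρ₁ / l < √t := by rwa [div_lt_iff₀ hl1]
        have h2' : √t < ρ₂ / l := by rwa [lt_div_iff₀ hl1]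
        exact ⟨(Real.lt_sqrt (by positivity)).1 h1', (Real.sqrt_lt' (by
          exact (Real.sqrt_nonneg _).trans_lt h2')).1 h2'⟩
      · rintro ⟨h1, h2⟩
        have ht : 0 < t := lt_of_le_of_lt (by positivity) h1
        have hpos : 0 < ρ₂ / l := by have := hρ₁.trans hlt; positivity
        refine ⟨ht, ?_, ?_⟩
        · rw [hnorm_stretch ht, ← div_lt_iff₀ hl1]
          exact (Real.lt_sqrt (by positivity)).2 h1
        · rw [hnorm_stretch ht, ← lt_div_iff₀ hl1]
          exact (Real.sqrt_lt' hpos).2 h2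
    have hind : (fun t => (annulus p ρ₁ ρ₂).indicator (fun ζ : Pt p => f ζ.1 / ζ.2) (v, t)) =
        (Set.Ioo ((ρ₁ / l) ^ 2) ((ρ₂ / l) ^ 2)).indicator fun t => f v * (1 / t) := by
      ext t
      by_cases ht : ((v, t) : Pt p) ∈ annulus p ρ₁ ρ₂
      · rw [Set.indicator_of_mem ht, Set.indicator_of_mem ((hfib t).1 ht)]
        ring
      · rw [Set.indicator_of_notMem ht, Set.indicator_of_notMem fun h => ht ((hfib t).2 h)]
    have hle : (ρ₁ / l) ^ 2 ≤ (ρ₂ / l) ^ 2 := by gcongr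
    have hρ₂ := hρ₁.trans hlt
    rw [hind, integral_indicator measurableSet_Ioo, integral_const_mul,
      ← integral_Ioc_eq_integral_Ioo,
      ← intervalIntegral.integral_of_le hle,
      integral_one_div_of_pos (by positivity) (by positivity)]
    congr 2
    field_simp
  simp only [hinner]
  rw [integral_mul_const, h0, zero_mul]

/-! ### The remainder after removal of the principal part. -/

/-- The normalised kernel: after the substitution `param` the kernel `∂ᵢ∂ⱼγ` has density
`normKer t v / t`. -/
def normKer (A B : Matrix (Idx p) (Idx p) ℝ) (i j : Fin (p 0)) (t : ℝ) (v : Idx p → ℝ) : ℝ :=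
  (E B (-t)).det * prefactor A B t * gaussHess (covMat A B t)⁻¹ ⟨0, i⟩ ⟨0, j⟩ v

theorem contDiff_det_E_mul_prefactor {A B : Matrix (Idx p) (Idx p) ℝ} (h : IsCanonicalPair p A B) :
    ContDiff ℝ 1 fun t => (E B (-t)).det * prefactor A B t := by
  have h1 : ContDiff ℝ 1 fun t => (E B t).det :=
    (contDiff_det (n := ∞) (contDiff_E B)).of_le (by simp)
  exact (h1.comp contDiff_neg).mul (contDiff_prefactor h)

theorem continuous_normKer {A B : Matrix (Idx p) (Idx p) ℝ} (h : IsCanonicalPair p A B)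
    (i j : Fin (p 0)) : Continuous fun ζ : Pt p => normKer A B i j ζ.2 ζ.1 :=
  ((contDiff_det_E_mul_prefactor h).continuous.comp continuous_snd).mul
    (continuous_gaussHess h _ _)

/-- The Jacobian cancels √t^Q of the singularity √t^(Q+2), leaving the critical density 1/t. -/
theorem jac_mul_hessSol {A B : Matrix (Idx p) (Idx p) ℝ} (h : IsCanonicalPair p A B)
    (i j : Fin (p 0)) {ζ : Pt p} (hζ : 0 < ζ.2) :
    jac B ζ.2 * hessSol A B i j (stretch ζ) = normKer A B i j ζ.2 ζ.1 / ζ.2 := by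
  have h2 : (stretch ζ).2 = ζ.2 := rfl
  have hs : √ζ.2 ≠ 0 := (Real.sqrt_pos.2 hζ).ne'
  rw [hessSol_of_pos h i j (by rw [h2]; exact hζ), unitPt_stretch hζ, h2, jac, normKer, pow_add,
    Real.sq_sqrt hζ.le]
  field_simp

/-- The second bound is the mean value theorem in t at fixed v. It relies on M⁻¹ and the prefactor
being C¹ up to t = 0, so that passing to the homogeneous limit gains a factor t. -/
theorem exists_normKer_bounds {A B : Matrix (Idx p) (Idx p) ℝ} (h : IsCanonicalPair p A B) :
    ∃ c K : ℝ, 0 < c ∧ 0 ≤ K ∧ ∀ (i j : Fin (p 0)), ∀ t ∈ Set.Icc (0 : ℝ) 1, ∀ v,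
      |normKer A B i j t v| ≤ K * (weight v ^ 4 * Real.exp (-c * (weight v - 1))) ∧
      |normKer A B i j t v - normKer A B i j 0 v| ≤
        K * t * (weight v ^ 4 * Real.exp (-c * (weight v - 1))) := by
  obtain ⟨c, K₁, hc, hK₁, hb, hbd⟩ := exists_gaussHess_bounds h 1
  have hpf := contDiff_det_E_mul_prefactor h
  set g : ℝ → ℝ := fun t => (E B (-t)).det * prefactor A B t with hg
  obtain ⟨K₂, hK₂, hp⟩ := exists_bound_Icc hpf.continuous 1
  obtain ⟨K₃, hK₃, hp'⟩ := exists_bound_Icc (hpf.continuous_deriv le_rfl) 1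
  refine ⟨c, (K₂ + K₃) * K₁, hc, by positivity, fun i j t ht v => ?_⟩
  set e := weight v ^ 4 * Real.exp (-c * (weight v - 1)) with he
  have he0 : 0 ≤ e := by have := weight_pos v; positivity
  constructor
  · rw [normKer, abs_mul]
    calc |(E B (-t)).det * prefactor A B t| *
          |gaussHess (covMat A B t)⁻¹ ⟨0, i⟩ ⟨0, j⟩ v| ≤ K₂ * (K₁ * e) :=
          mul_le_mul (hp t ht) (hb t ht _ _ v) (abs_nonneg _) (by linarith)
      _ ≤ (K₂ + K₃) * K₁ * e := by
          rw [mul_assoc]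
          gcongr
          linarith
  · have key : ∀ s ∈ Set.Icc (0 : ℝ) 1, ∃ D, HasDerivAt (fun s => normKer A B i j s v) D s ∧
        |D| ≤ (K₂ + K₃) * K₁ * e := by
      intro s hs
      obtain ⟨D, hD, hDb⟩ := hbd ⟨0, i⟩ ⟨0, j⟩ id 1 (fun _ => v) 0 s 1 hs (hasDerivAt_id s)
        (fun k => hasDerivAt_const _ _) (by simp)
        (fun k => by simpa using (weight_pos v).le)
      have hdg : HasDerivAt g (deriv g s) s := (hpf.differentiable (by simp) s).hasDerivAt
      refine ⟨_, hdg.fun_mul hD, ?_⟩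
      refine (abs_add_le _ _).trans ?_
      rw [abs_mul, abs_mul]
      have h1 : |deriv g s| * |gaussHess (covMat A B (id s))⁻¹ ⟨0, i⟩ ⟨0, j⟩ v| ≤ K₃ * (K₁ * e) :=
        mul_le_mul (hp' s hs) (hb s hs _ _ v) (abs_nonneg _) (by linarith)
      have h2 : |g s| * |D| ≤ K₂ * (K₁ * 1 * e) :=
        mul_le_mul (hp s hs) hDb (abs_nonneg _) (by linarith)
      exact (add_le_add h1 h2).trans (le_of_eq (by ring))
    choose! D hD hDb using key
    have hsub : Set.Icc (0 : ℝ) t ⊆ Set.Icc 0 1 := Set.Icc_subset_Icc_right ht.2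
    have := (convex_Icc (0 : ℝ) t).norm_image_sub_le_of_norm_hasDerivWithin_le
      (f := fun s => normKer A B i j s v) (f' := D)
      (fun s hs => (hD s (hsub hs)).hasDerivWithinAt) (fun s hs => hDb s (hsub hs))
      (Set.left_mem_Icc.2 ht.1) (Set.right_mem_Icc.2 ht.1)
    rw [Real.norm_eq_abs, Real.norm_eq_abs, sub_zero, abs_of_nonneg ht.1] at this
    linarith

/-- The part of the transformed kernel left after removing its homogeneous principal part. -/
def remKer (A B : Matrix (Idx p) (Idx p) ℝ) (η : Pt p → ℝ) (i j : Fin (p 0)) (b : Pt p → ℝ)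
    (x ζ : Pt p) : ℝ :=
  b (param B x ζ) * η (stretch ζ) * normKer A B i j ζ.2 ζ.1 - b x * normKer A B i j 0 ζ.1

theorem d_param (B : Matrix (Idx p) (Idx p) ℝ) (x ζ : Pt p) :
    d B x (param B x ζ) = hnorm (stretch ζ) := by rw [d, inv_param_comp]

/-- The difference vanishes for ‖z‖ ≤ ρ₀/2, and beyond that ‖z‖^α is bounded below. -/
theorem exists_cutoff_sub_one_bound {ρ₀ : ℝ} (hρ₀ : 0 < ρ₀) {η : Pt p → ℝ} (hη : IsCutoff ρ₀ η)
    {α : ℝ} (hα : 0 < α) : ∃ K : ℝ, 0 ≤ K ∧ ∀ z, |η z - 1| ≤ K * hnorm z ^ α := by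
  obtain ⟨K, hK, hb⟩ := exists_cutoff_bound hη
  have hp : 0 < (ρ₀ / 2) ^ α := Real.rpow_pos_of_pos (by positivity) α
  refine ⟨(K + 1) / (ρ₀ / 2) ^ α, by positivity, fun z => ?_⟩
  have hz := hnorm_nonneg z
  rcases le_or_gt (hnorm z) (ρ₀ / 2) with hle | hlt
  · rw [hη.eq_one z hle, sub_self, abs_zero]
    positivity
  · have h1 : (ρ₀ / 2) ^ α ≤ hnorm z ^ α :=
      Real.rpow_le_rpow (by positivity) hlt.le hα.le
    calc |η z - 1| ≤ |η z| + |1| := abs_sub _ _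
      _ ≤ K + 1 := by rw [abs_one]; linarith [hb z]
      _ = (K + 1) / (ρ₀ / 2) ^ α * (ρ₀ / 2) ^ α := by field_simp
      _ ≤ _ := by gcongr

/-- Unfreezing b, the cutoff and the time costs O(ρ^α) each, ρ being the norm of `stretch ζ`. Since
ρ ≤ n √t W, this is O(t^(α/2) W), which makes the density 1/t integrable. -/
theorem exists_remKer_bound {A B : Matrix (Idx p) (Idx p) ℝ} (h : IsCanonicalPair p A B) {ρ₀ : ℝ}
    (hρ₀ : 0 < ρ₀) (hρ₁ : ρ₀ < 1) {η : Pt p → ℝ} (hη : IsCutoff ρ₀ η) {α : ℝ} (hα : 0 < α)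
    (hα1 : α ≤ 1) {K : ℝ} (hK : 0 ≤ K) : ∃ c M : ℝ, 0 < c ∧ 0 ≤ M ∧
      ∀ (i j : Fin (p 0)) (b : Pt p → ℝ), (∀ x, |b x| ≤ K) →
      (∀ x y, |b x - b y| ≤ K * d B x y ^ α) → ∀ x ζ, 0 < ζ.2 → hnorm (stretch ζ) < ρ₀ →
      |remKer A B η i j b x ζ / ζ.2| ≤
        M * (Real.exp (-c * (weight ζ.1 - 1)) * ζ.2 ^ (α / 2 - 1)) := by
  obtain ⟨c, K₁, hc, hK₁, hb⟩ := exists_normKer_bounds h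
  obtain ⟨K₂, hK₂, hb₂⟩ := exists_cutoff_sub_one_bound hρ₀ hη hα
  obtain ⟨K₃, hK₃, hb₃⟩ := exists_cutoff_bound hη
  -- Four powers of the weight come from `exists_normKer_bounds` and a fifth from converting ρ^α
  -- into t^(α/2).
  obtain ⟨K₄, hK₄, hb₄⟩ := exists_weight_pow_mul_exp_le hc 5
  set n : ℝ := (((Fintype.card (Idx p) : ℕ) : ℝ) + 1) with hn
  have hn1 : 1 ≤ n := le_add_of_nonneg_left (by positivity)
  set M₁ := K * K₃ * K₁ + K * K₂ * K₁ + K * K₁ with hM₁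
  have hM₁0 : 0 ≤ M₁ := by positivity
  refine ⟨c / 2, M₁ * n * K₄, half_pos hc, by positivity, fun i j b hbK hbα x ζ hζ hw => ?_⟩
  set ρ := hnorm (stretch ζ) with hρ
  have hρ0 : 0 < ρ := hnorm_pos_of_pos (z := stretch ζ) hζ
  have hρle : ρ ≤ 1 := by linarith
  set W := weight ζ.1 with hW
  have hW1 : 1 ≤ W := one_le_weight _
  set e := W ^ 4 * Real.exp (-c * (W - 1)) with he
  have he0 : 0 ≤ e := by positivity
  have htρ2 : ζ.2 ≤ ρ ^ 2 := (le_abs_self _).trans (abs_snd_le_hnorm_sq (stretch ζ))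
  have hρα : ρ ≤ ρ ^ α := Real.self_le_rpow_of_le_one hρ0.le hρle hα1
  have htρ : ζ.2 ≤ ρ ^ α := by nlinarith
  have ht1 : ζ.2 ∈ Set.Icc (0 : ℝ) 1 := ⟨hζ.le, htρ2.trans (pow_le_one₀ hρ0.le hρle)⟩
  obtain ⟨hg, hg0⟩ := hb i j ζ.2 ht1 ζ.1
  have hρα0 : 0 ≤ ρ ^ α := Real.rpow_nonneg hρ0.le _
  have hrem : |remKer A B η i j b x ζ| ≤ M₁ * (ρ ^ α * e) := by
    have hsplit : remKer A B η i j b x ζ =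
        (b (param B x ζ) - b x) * η (stretch ζ) * normKer A B i j ζ.2 ζ.1 +
        b x * (η (stretch ζ) - 1) * normKer A B i j ζ.2 ζ.1 +
        b x * (normKer A B i j ζ.2 ζ.1 - normKer A B i j 0 ζ.1) := by
      rw [remKer]; ring
    have e1 : |(b (param B x ζ) - b x) * η (stretch ζ) * normKer A B i j ζ.2 ζ.1| ≤
        K * ρ ^ α * K₃ * (K₁ * e) := by
      rw [abs_mul, abs_mul]
      refine mul_le_mul (mul_le_mul ?_ (hb₃ _) (abs_nonneg _) (by positivity)) hg (abs_nonneg _)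
        (by positivity)
      rw [abs_sub_comm]
      have := hbα x (param B x ζ)
      rwa [d_param] at this
    have e2 : |b x * (η (stretch ζ) - 1) * normKer A B i j ζ.2 ζ.1| ≤
        K * (K₂ * ρ ^ α) * (K₁ * e) := by
      rw [abs_mul, abs_mul]
      exact mul_le_mul (mul_le_mul (hbK x) (hb₂ _) (abs_nonneg _) hK) hg (abs_nonneg _)
        (by positivity)
    have e3 : |b x * (normKer A B i j ζ.2 ζ.1 - normKer A B i j 0 ζ.1)| ≤
        K * (K₁ * ρ ^ α * e) := by
      rw [abs_mul]
      refine mul_le_mul (hbK x) (hg0.trans ?_) (abs_nonneg _) hK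
      gcongr
    rw [hsplit]
    refine (abs_add_le _ _).trans ((add_le_add ((abs_add_le _ _).trans
      (add_le_add e1 e2)) e3).trans (le_of_eq ?_))
    rw [hM₁]; ring
  have hρW : ρ ^ α ≤ n * W * ζ.2 ^ (α / 2) := by
    have h1 : ρ ≤ √ζ.2 * (n * W) := by
      rw [hρ, hnorm_stretch hζ]
      exact mul_le_mul_of_nonneg_left (hnorm_one_le _) (Real.sqrt_nonneg _)
    have hnW : 1 ≤ n * W := by nlinarith
    calc ρ ^ α ≤ (√ζ.2 * (n * W)) ^ α := Real.rpow_le_rpow hρ0.le h1 hα.le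
      _ = √ζ.2 ^ α * (n * W) ^ α := Real.mul_rpow (Real.sqrt_nonneg _) (by linarith)
      _ ≤ √ζ.2 ^ α * (n * W) := by
          gcongr
          simpa using Real.rpow_le_rpow_of_exponent_le hnW hα1
      _ = n * W * ζ.2 ^ (α / 2) := by
          rw [Real.sqrt_eq_rpow, ← Real.rpow_mul hζ.le, one_div_mul_eq_div]
          ring
  have hpow : ζ.2 ^ (α / 2) / ζ.2 = ζ.2 ^ (α / 2 - 1) := (Real.rpow_sub_one hζ.ne' _).symm
  have hp0 : 0 ≤ ζ.2 ^ (α / 2 - 1) := Real.rpow_nonneg hζ.le _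
  rw [abs_div, abs_of_pos hζ]
  calc |remKer A B η i j b x ζ| / ζ.2 ≤ M₁ * ((n * W * ζ.2 ^ (α / 2)) * e) / ζ.2 := by
        gcongr
        exact hrem.trans (by gcongr)
    _ = M₁ * n * ((W ^ 5 * Real.exp (-c * (W - 1))) * (ζ.2 ^ (α / 2) / ζ.2)) := by
        rw [he]; ring
    _ ≤ M₁ * n * ((K₄ * Real.exp (-(c / 2) * (W - 1))) * ζ.2 ^ (α / 2 - 1)) := by
        rw [hpow]
        refine mul_le_mul_of_nonneg_left (mul_le_mul_of_nonneg_right (hb₄ W hW1) hp0)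
          (by positivity)
    _ = _ := by ring

/-! ### Truncated integrals and the principal value. -/

theorem continuous_d_left (B : Matrix (Idx p) (Idx p) ℝ) (y : Pt p) : Continuous fun x => d B x y :=
  continuous_hnorm.comp (continuous_comp B continuous_const continuous_id)

theorem continuous_d_right (B : Matrix (Idx p) (Idx p) ℝ) (x : Pt p) :
    Continuous fun y => d B x y :=
  continuous_hnorm.comp (continuous_comp B (continuous_inv B continuous_id) continuous_const)

theorem continuous_of_holder {B : Matrix (Idx p) (Idx p) ℝ} {α : ℝ} (hα : 0 < α) {K : ℝ}
    {f : Pt p → ℝ} (hf : ∀ x y, |f x - f y| ≤ K * d B x y ^ α) : Continuous f := by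
  rw [continuous_iff_continuousAt]
  intro y
  rw [ContinuousAt, tendsto_iff_norm_sub_tendsto_zero]
  have h1 : Filter.Tendsto (fun x => K * d B x y ^ α) (𝓝 y) (𝓝 0) := by
    have h2 : Continuous fun x => K * d B x y ^ α :=
      continuous_const.mul ((continuous_d_left B y).rpow_const fun _ => Or.inr hα.le)
    have h3 := h2.tendsto y
    rwa [d_self, Real.zero_rpow hα.ne', mul_zero] at h3
  exact squeeze_zero (fun x => norm_nonneg _) (fun x => hf x y) h1

theorem measurable_hessSol {A B : Matrix (Idx p) (Idx p) ℝ} (h : IsCanonicalPair p A B)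
    (i j : Fin (p 0)) : Measurable (hessSol A B i j) := by
  have hs : MeasurableSet {z : Pt p | 0 < z.2} := measurableSet_lt measurable_const measurable_snd
  have hu : Measurable fun z : Pt p => ((unitPt z, z.2) : Pt p) := by
    refine Measurable.prodMk (measurable_pi_lambda _ fun k => ?_) measurable_snd
    exact ((measurable_pi_apply k).comp measurable_fst).div (by fun_prop)
  have heq : hessSol A B i j = {z : Pt p | 0 < z.2}.indicator fun z =>
      prefactor A B z.2 * (√z.2 ^ (Q p + 2))⁻¹ *
        gaussHess (covMat A B z.2)⁻¹ ⟨0, i⟩ ⟨0, j⟩ (unitPt z) := by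
    ext z
    by_cases hz : 0 < z.2
    · rw [Set.indicator_of_mem (s := {z : Pt p | 0 < z.2}) hz, hessSol_of_pos h i j hz]
    · rw [Set.indicator_of_notMem (s := {z : Pt p | 0 < z.2}) hz,
        hessSol_of_nonpos A B i j (not_lt.1 hz)]
  rw [heq]
  refine Measurable.indicator (Measurable.mul (Measurable.mul ?_ (by fun_prop)) ?_) hs
  · exact (contDiff_prefactor h).continuous.measurable.comp measurable_snd
  · have hG := (continuous_gaussHess h ⟨0, i⟩ ⟨0, j⟩).measurable.comp hu
    simpa only [Function.comp_def] using hG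

theorem measurable_kernel {A B : Matrix (Idx p) (Idx p) ℝ} (h : IsCanonicalPair p A B) {ρ₀ : ℝ}
    {η : Pt p → ℝ} (hη : IsCutoff ρ₀ η) (i j : Fin (p 0)) (a : Pt p → ℝ) {b : Pt p → ℝ}
    (hb : Continuous b) (x : Pt p) : Measurable fun y => kernel A B η i j a b x y := by
  have h1 : Measurable (k₀ A B η i j) :=
    hη.smooth.continuous.measurable.mul (measurable_hessSol h i j)
  exact (measurable_const.mul (h1.comp (continuous_comp B (continuous_inv B continuous_id)
    continuous_const).measurable)).mul hb.measurable

theorem kernel_eq_zero_of_le (A B : Matrix (Idx p) (Idx p) ℝ) (η : Pt p → ℝ) (i j : Fin (p 0))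
    (a b : Pt p → ℝ) {x y : Pt p} (hxy : x.2 ≤ y.2) : kernel A B η i j a b x y = 0 := by
  rw [kernel, k₀_eq, hessSol_of_nonpos, mul_zero, mul_zero, zero_mul]
  rw [inv_comp_eq]
  simpa using hxy

theorem jac_mul_kernel {A B : Matrix (Idx p) (Idx p) ℝ} (h : IsCanonicalPair p A B) (η : Pt p → ℝ)
    (i j : Fin (p 0)) (a b : Pt p → ℝ) (x : Pt p) {ζ : Pt p} (hζ : 0 < ζ.2) :
    jac B ζ.2 * kernel A B η i j a b x (param B x ζ) =
      a x * b x * (normKer A B i j 0 ζ.1 / ζ.2) + a x * (remKer A B η i j b x ζ / ζ.2) := by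
  have h1 := jac_mul_hessSol h i j hζ
  rw [kernel, inv_param_comp, k₀_eq, remKer]
  linear_combination (a x * η (stretch ζ) * b (param B x ζ)) * h1

theorem continuous_remKer {A B : Matrix (Idx p) (Idx p) ℝ} (h : IsCanonicalPair p A B) {ρ₀ : ℝ}
    {η : Pt p → ℝ} (hη : IsCutoff ρ₀ η) (i j : Fin (p 0)) {b : Pt p → ℝ} (hb : Continuous b)
    (x : Pt p) : Continuous (remKer A B η i j b x) := by
  have h1 : Continuous fun ζ : Pt p => normKer A B i j 0 ζ.1 :=
    continuous_const.mul ((continuous_gaussHess_const _ _ _).comp continuous_fst)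
  exact (((hb.comp (continuous_param B x)).mul
    (hη.smooth.continuous.comp continuous_stretch)).mul (continuous_normKer h i j)).sub
      (continuous_const.mul h1)

/-- The remainder kernels have a common integrable majorant. -/
theorem exists_remKer_majorant {A B : Matrix (Idx p) (Idx p) ℝ} (h : IsCanonicalPair p A B)
    {ρ₀ : ℝ} (hρ₀ : 0 < ρ₀) (hρ₁ : ρ₀ < 1) {η : Pt p → ℝ} (hη : IsCutoff ρ₀ η) {α : ℝ}
    (hα : 0 < α) (hα1 : α ≤ 1) {K : ℝ} (hK : 0 ≤ K) :
    ∃ g : Pt p → ℝ, Integrable g ∧ (∀ ζ, 0 ≤ g ζ) ∧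
      ∀ (i j : Fin (p 0)) (b : Pt p → ℝ), (∀ x, |b x| ≤ K) →
      (∀ x y, |b x - b y| ≤ K * d B x y ^ α) → ∀ x, ∀ ζ ∈ annulus p 0 ρ₀,
      |remKer A B η i j b x ζ / ζ.2| ≤ g ζ := by
  obtain ⟨c, M, hc, hM, hb⟩ := exists_remKer_bound h hρ₀ hρ₁ hη hα hα1 hK
  -- The exponent exceeds -1 because α > 0.
  have hint : IntegrableOn (fun t : ℝ => t ^ (α / 2 - 1)) (Set.Ioo 0 1) :=
    (intervalIntegral.integrableOn_Ioo_rpow_iff one_pos).2 (by linarith)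
  refine ⟨_, (integrable_mul_indicator hc hint).const_mul M, fun ζ => ?_,
    fun i j b hbK hbα x ζ hζ => ?_⟩
  · refine mul_nonneg hM (mul_nonneg (Real.exp_pos _).le ?_)
    exact Set.indicator_nonneg (fun t ht => Real.rpow_nonneg ht.1.le _) _
  · have hlt : ζ.2 < 1 := (annulus_snd_lt hζ).trans_le (pow_le_one₀ hρ₀.le hρ₁.le)
    have hmem : ζ.2 ∈ Set.Ioo (0 : ℝ) 1 := ⟨hζ.1, hlt⟩
    rw [Set.indicator_of_mem hmem]
    exact hb i j b hbK hbα x ζ hζ.1 hζ.2.2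

theorem annulus_subset {ρ₁ ρ₂ ρ₀ : ℝ} (h₁ : 0 ≤ ρ₁) (h₂ : ρ₂ ≤ ρ₀) :
    annulus p ρ₁ ρ₂ ⊆ annulus p 0 ρ₀ := fun _ hζ =>
  ⟨hζ.1, h₁.trans_lt hζ.2.1, hζ.2.2.trans_le h₂⟩

theorem integrableOn_remKer {A B : Matrix (Idx p) (Idx p) ℝ} (h : IsCanonicalPair p A B)
    {ρ₀ : ℝ} {η : Pt p → ℝ} (hη : IsCutoff ρ₀ η) {i j : Fin (p 0)} {b : Pt p → ℝ}
    (hb : Continuous b) {x : Pt p} {g : Pt p → ℝ} (hg : Integrable g)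
    (hgb : ∀ ζ ∈ annulus p 0 ρ₀, |remKer A B η i j b x ζ / ζ.2| ≤ g ζ) :
    IntegrableOn (fun ζ => remKer A B η i j b x ζ / ζ.2) (annulus p 0 ρ₀) :=
  hg.integrableOn.mono'
    ((continuous_remKer h hη i j hb x).measurable.div measurable_snd).aestronglyMeasurable
    ((ae_restrict_iff' (measurableSet_annulus 0 ρ₀)).2 (Filter.Eventually.of_forall hgb))

/-- Truncated integrals of the kernel, computed in the coordinates of `param`: the homogeneous
principal part does not contribute. -/
theorem setIntegral_kernel {A B : Matrix (Idx p) (Idx p) ℝ} (h : IsCanonicalPair p A B)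
    {ρ₀ : ℝ} {η : Pt p → ℝ} (hη : IsCutoff ρ₀ η) (i j : Fin (p 0)) (a : Pt p → ℝ) {b : Pt p → ℝ}
    (hb : Continuous b) {z₀ : Pt p} {R : ℝ} (hs : tsupport b ⊆ ball B z₀ R) (x : Pt p)
    (hrem : IntegrableOn (fun ζ => remKer A B η i j b x ζ / ζ.2) (annulus p 0 ρ₀))
    {P : Set ℝ} (hP : MeasurableSet P) {ρ₁ ρ₂ : ℝ} (hρ₁ : 0 < ρ₁) (hρ₂ : ρ₂ ≤ ρ₀)
    (hiff : ∀ s < ρ₀, s ∈ P ↔ ρ₁ < s ∧ s < ρ₂) :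
    IntegrableOn (fun y => kernel A B η i j a b x y) {y | y ∈ ball B z₀ R ∧ d B x y ∈ P} ∧
    ∫ y in {y | y ∈ ball B z₀ R ∧ d B x y ∈ P}, kernel A B η i j a b x y =
      a x * ∫ ζ in annulus p ρ₁ ρ₂, remKer A B η i j b x ζ / ζ.2 := by
  have hmP : MeasurableSet {y : Pt p | d B x y ∈ P} := (continuous_d_right B x).measurable hP
  have hmU : MeasurableSet {y : Pt p | y ∈ ball B z₀ R ∧ d B x y ∈ P} :=
    (measurableSet_lt (continuous_d_right B z₀).measurable measurable_const).inter hmP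
  have hm0 : MeasurableSet {ζ : Pt p | 0 < ζ.2} := measurableSet_lt measurable_const measurable_snd
  have hmA := measurableSet_annulus (p := p) ρ₁ ρ₂
  set f : Pt p → ℝ := {y : Pt p | d B x y ∈ P}.indicator fun y => kernel A B η i j a b x y with hf
  -- The restriction to the ball can be dropped because b vanishes outside it.
  have hind : {y : Pt p | y ∈ ball B z₀ R ∧ d B x y ∈ P}.indicator
      (fun y => kernel A B η i j a b x y) = f := by
    ext y
    by_cases hyP : d B x y ∈ P
    · by_cases hyB : y ∈ ball B z₀ R
      · rw [hf, Set.indicator_of_mem (s := {y : Pt p | y ∈ ball B z₀ R ∧ d B x y ∈ P}) ⟨hyB, hyP⟩,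
          Set.indicator_of_mem (s := {y : Pt p | d B x y ∈ P}) hyP]
      · have hb0 : b y = 0 := image_eq_zero_of_notMem_tsupport fun hy => hyB (hs hy)
        rw [hf, Set.indicator_of_notMem (s := {y : Pt p | y ∈ ball B z₀ R ∧ d B x y ∈ P})
          (fun hy => hyB hy.1), Set.indicator_of_mem (s := {y : Pt p | d B x y ∈ P}) hyP,
          kernel, hb0,
          mul_zero]
    · rw [hf, Set.indicator_of_notMem (s := {y : Pt p | y ∈ ball B z₀ R ∧ d B x y ∈ P})
        (fun hy => hyP hy.2), Set.indicator_of_notMem (s := {y : Pt p | d B x y ∈ P}) hyP]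
  have hfm : Measurable f := (measurable_kernel h hη i j a hb x).indicator hmP
  have hfk : ∀ y, kernel A B η i j a b x y = 0 → f y = 0 := fun y hy => by
    by_cases hyP : d B x y ∈ P
    · rw [hf, Set.indicator_of_mem (s := {y : Pt p | d B x y ∈ P}) hyP, hy]
    · rw [hf, Set.indicator_of_notMem (s := {y : Pt p | d B x y ∈ P}) hyP]
  have hf0 : ∀ y, x.2 ≤ y.2 → f y = 0 := fun y hy =>
    hfk y (kernel_eq_zero_of_le A B η i j a b hy)
  set F : Pt p → ℝ := fun ζ =>
    a x * b x * (normKer A B i j 0 ζ.1 / ζ.2) + a x * (remKer A B η i j b x ζ / ζ.2) with hF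
  -- The cutoff kills the kernel from norm ρ₀ on, so P matters only below ρ₀, where it cuts out an
  -- annulus. This treats the ranges d > ε and r₁ < d < r₂ together.
  have hpull : ∀ ζ ∈ {ζ : Pt p | 0 < ζ.2}, jac B ζ.2 * f (param B x ζ) =
      (annulus p ρ₁ ρ₂).indicator F ζ := by
    intro ζ hζ
    rcases lt_or_ge (hnorm (stretch ζ)) ρ₀ with hlt | hge
    · have hmem : ζ ∈ annulus p ρ₁ ρ₂ ↔ d B x (param B x ζ) ∈ P := by
        rw [d_param, hiff _ hlt]
        exact and_iff_right hζ
      by_cases hA : ζ ∈ annulus p ρ₁ ρ₂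
      · rw [Set.indicator_of_mem hA, hf,
          Set.indicator_of_mem (s := {y : Pt p | d B x y ∈ P}) (hmem.1 hA)]
        exact jac_mul_kernel h η i j a b x hζ
      · rw [Set.indicator_of_notMem hA, hf,
          Set.indicator_of_notMem (s := {y : Pt p | d B x y ∈ P}) (fun hh => hA (hmem.2 hh)),
          mul_zero]
    · have hA : ζ ∉ annulus p ρ₁ ρ₂ := fun hA => absurd (hA.2.2.trans_le hρ₂) (not_lt.2 hge)
      have hk : kernel A B η i j a b x (param B x ζ) = 0 := by
        rw [kernel, inv_param_comp, k₀_eq, hη.eq_zero _ hge, zero_mul, mul_zero, zero_mul]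
      rw [Set.indicator_of_notMem hA, hfk _ hk, mul_zero]
  obtain ⟨c, K, hc, hK, hnb⟩ := exists_normKer_bounds h
  have hnb0 := fun v => (hnb i j 0 ⟨le_rfl, zero_le_one⟩ v).1
  have hnc : Continuous (normKer A B i j 0) :=
    continuous_const.mul (continuous_gaussHess_const _ _ _)
  have hn0 : ∫ v, normKer A B i j 0 v = 0 := by
    simp only [normKer]
    rw [integral_const_mul, integral_gaussHess h le_rfl, mul_zero]
  have hi1 : IntegrableOn (fun ζ : Pt p => normKer A B i j 0 ζ.1 / ζ.2) (annulus p ρ₁ ρ₂) :=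
    integrableOn_annulus_div hnc hc hK hnb0 hρ₁ ρ₂
  have hi2 : IntegrableOn (fun ζ => remKer A B η i j b x ζ / ζ.2) (annulus p ρ₁ ρ₂) :=
    hrem.mono_set (annulus_subset hρ₁.le hρ₂)
  have hFi : IntegrableOn F (annulus p ρ₁ ρ₂) :=
    (hi1.const_mul (a x * b x)).add (hi2.const_mul (a x))
  constructor
  · rw [← integrable_indicator_iff hmU, hind]
    refine integrable_param B x hfm hf0 ?_
    refine IntegrableOn.congr_fun ?_ (fun ζ hζ => (hpull ζ hζ).symm) hm0
    exact ((integrable_indicator_iff hmA).2 hFi).integrableOn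
  · have hsub : {ζ : Pt p | 0 < ζ.2} ∩ annulus p ρ₁ ρ₂ = annulus p ρ₁ ρ₂ :=
      Set.inter_eq_right.2 fun ζ hζ => hζ.1
    rw [← integral_indicator hmU, hind, integral_param B x hfm hf0,
      setIntegral_congr_fun hm0 hpull, setIntegral_indicator hmA,
      hsub]
    simp only [hF]
    rw [integral_add (hi1.const_mul (a x * b x)) (hi2.const_mul (a x)), integral_const_mul,
      integral_const_mul, setIntegral_annulus_div hnc hc hK hnb0 hn0 hρ₁ ρ₂, mul_zero, zero_add]

/-- Each point of the limiting annulus belongs to the truncated ones once ε is below its norm;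
dominated convergence applies with the integrand itself as majorant. -/
theorem tendsto_setIntegral_annulus {ρ₀ : ℝ} {f : Pt p → ℝ}
    (hf : IntegrableOn f (annulus p 0 ρ₀)) :
    Filter.Tendsto (fun ε : ℝ => ∫ ζ in annulus p ε ρ₀, f ζ) (𝓝[>] 0)
      (𝓝 (∫ ζ in annulus p 0 ρ₀, f ζ)) := by
  have hi := (integrable_indicator_iff (measurableSet_annulus 0 ρ₀)).2 hf
  simp only [← integral_indicator (measurableSet_annulus _ ρ₀)]
  refine tendsto_integral_filter_of_dominated_convergence
    (fun ζ => ‖(annulus p 0 ρ₀).indicator f ζ‖) ?_ ?_ hi.norm ?_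
  · filter_upwards [self_mem_nhdsWithin] with ε hε
    exact ((integrable_indicator_iff (measurableSet_annulus ε ρ₀)).2
      (hf.mono_set (annulus_subset (le_of_lt hε) le_rfl))).aestronglyMeasurable
  · filter_upwards [self_mem_nhdsWithin] with ε hε
    refine Filter.Eventually.of_forall fun ζ => ?_
    exact norm_indicator_le_of_subset (annulus_subset (le_of_lt hε) le_rfl) f ζ
  · refine Filter.Eventually.of_forall fun ζ => ?_
    refine tendsto_const_nhds.congr' ?_
    by_cases hζ : ζ ∈ annulus p 0 ρ₀
    · filter_upwards [Ioo_mem_nhdsGT hζ.2.1] with ε hε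
      have hmem : ζ ∈ annulus p ε ρ₀ := ⟨hζ.1, hε.2, hζ.2.2⟩
      rw [Set.indicator_of_mem hζ, Set.indicator_of_mem hmem]
    · filter_upwards [self_mem_nhdsWithin] with ε hε
      rw [Set.indicator_of_notMem hζ, Set.indicator_of_notMem
        fun h => hζ (annulus_subset (le_of_lt hε) le_rfl h)]

end OU

end

theorem mainTheorem6 {r : ℕ} (p : Fin (r + 1) → ℕ) (A B : Matrix (OU.Idx p) (OU.Idx p) ℝ)
    (hAB : OU.IsCanonicalPair p A B) :
    ∃ R₀ : ℝ, 0 < R₀ ∧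
      ∀ (i j : Fin (p 0)) (ρ₀ : ℝ), 0 < ρ₀ → ρ₀ < 1 →
      ∀ η : OU.Pt p → ℝ, OU.IsCutoff ρ₀ η →
      ∀ α : ℝ, 0 < α → ∀ K : ℝ≥0,
      ∃ c : ℝ, 0 < c ∧
        ∀ z₀ ∈ OU.strip p, ∀ R : ℝ, 0 < R → R ≤ R₀ →
        ∀ a b : OU.Pt p → ℝ,
          OU.holderNorm B α a ≤ K → OU.holderNorm B α b ≤ K →
          tsupport a ⊆ OU.ball B z₀ R → tsupport b ⊆ OU.ball B z₀ R →
          -- growth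
          (∀ x ∈ OU.ball B z₀ R, ∀ y ∈ OU.ball B z₀ R, x ≠ y →
            |OU.kernel A B η i j a b x y| ≤ c / OU.d B x y ^ (OU.Q p + 2)) ∧
          -- Hölder smoothness
          (∀ x₀ ∈ OU.ball B z₀ R, ∀ x ∈ OU.ball B z₀ R, ∀ y ∈ OU.ball B z₀ R,
            c * OU.d B x₀ x ≤ OU.d B x₀ y →
            |OU.kernel A B η i j a b x y - OU.kernel A B η i j a b x₀ y| ≤
              c * (OU.d B x₀ x ^ α / OU.d B x₀ y ^ ((OU.Q p : ℝ) + 2 + α))) ∧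
          -- the truncated kernels are integrable
          (∀ x ∈ OU.ball B z₀ R, ∀ ε : ℝ, 0 < ε →
            IntegrableOn (fun y => OU.kernel A B η i j a b x y)
              {y | y ∈ OU.ball B z₀ R ∧ ε < OU.d B x y}) ∧
          -- cancellation
          (∀ x ∈ OU.ball B z₀ R, ∀ r₁ r₂ : ℝ, 0 < r₁ → r₁ < r₂ →
            |∫ y in {y | y ∈ OU.ball B z₀ R ∧ r₁ < OU.d B x y ∧ OU.d B x y < r₂},
              OU.kernel A B η i j a b x y| ≤ c) ∧
          -- existence of the principal value
          (∃ h : OU.Pt p → ℝ, ∀ x ∈ OU.ball B z₀ R,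
            Filter.Tendsto
              (fun ε : ℝ => ∫ y in {y | y ∈ OU.ball B z₀ R ∧ ε < OU.d B x y},
                OU.kernel A B η i j a b x y)
              (𝓝[>] 0) (𝓝 (h x))) := by
  -- R₀ = 1 serves to bound the d-diameter of the balls uniformly, as required by
  -- `exists_kernel_holder`.
  refine ⟨1, one_pos, fun i j ρ₀ hρ₀ hρ₁ η hη α hα K => ?_⟩
  rcases le_or_gt α 1 with hα1 | hα1
  · have hK : (0 : ℝ) ≤ K := K.2
    obtain ⟨c₁, hc₁, hgrowth⟩ := OU.exists_kernel_growth hAB hη hK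
    obtain ⟨c₂, hc₂, hholder⟩ := OU.exists_kernel_holder hAB hη hα hα1 hK
    obtain ⟨g, hg, hg0, hgb⟩ := OU.exists_remKer_majorant hAB hρ₀ hρ₁ hη hα hα1 hK
    have hI : 0 ≤ ∫ ζ, g ζ := integral_nonneg hg0
    -- The summands serve growth, Hölder smoothness and cancellation in turn; the 1 ensures
    -- positivity.
    refine ⟨c₁ + c₂ + K * (∫ ζ, g ζ) + 1, by positivity, ?_⟩
    set c := c₁ + c₂ + K * (∫ ζ, g ζ) + 1 with hc
    have hKI : 0 ≤ K * ∫ ζ, g ζ := mul_nonneg hK hI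
    intro z₀ _ R _ hR a b ha hb _ hsb
    obtain ⟨haK, haα⟩ := OU.holderNorm_le ha
    obtain ⟨hbK, hbα⟩ := OU.holderNorm_le hb
    have hbc : Continuous b := OU.continuous_of_holder hα hbα
    have hrem := fun x => OU.integrableOn_remKer hAB hη hbc hg (hgb i j b hbK hbα x)
    -- The range d > ε has no outer radius, but the cutoff supplies ρ₀.
    have hpv : ∀ x, ∀ ε : ℝ, 0 < ε → _ := fun x ε hε =>
      OU.setIntegral_kernel hAB hη i j a hbc hsb x (hrem x) (measurableSet_Ioi (a := ε)) hε le_rfl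
        (fun s hs => ⟨fun h => ⟨h, hs⟩, fun h => h.1⟩)
    refine ⟨fun x _ y _ _ => ?_, fun x₀ hx₀ x hx y hy hd => ?_, fun x _ ε hε => (hpv x ε hε).1,
      fun x _ r₁ r₂ hr₁ _ => ?_,
      fun x => a x * ∫ ζ in OU.annulus p 0 ρ₀, OU.remKer A B η i j b x ζ / ζ.2, fun x _ => ?_⟩
    · refine (hgrowth i j a b haK hbK x y).trans ?_
      have := OU.d_nonneg B x y
      gcongr
      linarith
    · have h0 := OU.d_nonneg B x₀ x
      have h1 := OU.d_nonneg B x₀ y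
      refine (hholder i j a b haK hbK haα z₀ R hR x₀ hx₀ x hx y hy (le_trans ?_ hd)).trans ?_
      · gcongr
        linarith
      · gcongr
        linarith
    · have h1 := (OU.setIntegral_kernel hAB hη i j a hbc hsb x (hrem x)
        (measurableSet_Ioo (a := r₁) (b := r₂)) hr₁ (min_le_right r₂ ρ₀)
        (fun s hs => ⟨fun h => ⟨h.1, lt_min h.2 hs⟩, fun h => ⟨h.1, (lt_min_iff.1 h.2).1⟩⟩)).2
      have h2 : |∫ ζ in OU.annulus p r₁ (min r₂ ρ₀), OU.remKer A B η i j b x ζ / ζ.2| ≤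
          ∫ ζ, g ζ := by
        refine (norm_integral_le_of_norm_le (f := fun ζ => OU.remKer A B η i j b x ζ / ζ.2)
          hg.integrableOn
          ((ae_restrict_iff' (OU.measurableSet_annulus _ _)).2
            (Filter.Eventually.of_forall fun ζ hζ => hgb i j b hbK hbα x ζ
              (OU.annulus_subset hr₁.le (min_le_right _ _) hζ)))).trans ?_
        exact setIntegral_le_integral hg (Filter.Eventually.of_forall hg0)
      refine le_trans (le_of_eq (congrArg abs h1)) ?_
      rw [abs_mul]
      refine (mul_le_mul (haK x) h2 (abs_nonneg _) hK).trans ?_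
      linarith
    · refine ((OU.tendsto_setIntegral_annulus (hrem x)).const_mul (a x)).congr' ?_
      filter_upwards [self_mem_nhdsWithin] with ε hε
      exact (hpv x ε hε).2.symm
  -- For α > 1 the function a vanishes, so the kernel is zero and any positive constant works.
  · refine ⟨1, one_pos, fun z₀ _ R _ _ a b ha _ hsa _ => ?_⟩
    have ha0 : ∀ x, a x = 0 := OU.eq_zero_of_holder_gt_one hAB hα1 (OU.holderNorm_le ha).2 hsa
    have hk : ∀ x y, OU.kernel A B η i j a b x y = 0 := fun x y => by
      rw [OU.kernel, ha0, zero_mul, zero_mul]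
    simp only [hk]
    refine ⟨fun x _ y _ _ => ?_, fun x₀ _ x _ y _ _ => ?_, fun x _ ε _ => integrableOn_zero,
      fun x _ r₁ r₂ _ _ => by simp, 0, fun x _ => by simp⟩
    · have := OU.d_nonneg B x y
      simp only [abs_zero]
      positivity
    · have h0 := OU.d_nonneg B x₀ x
      have h1 := OU.d_nonneg B x₀ y
      simp only [sub_self, abs_zero]
      positivity
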